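/- Let $k\ge 1$ and $L>k$ be integers, let $V_L$ be the set of $L$-tuples $(u_1<\dots<u_L)$ of positive integers, listed as $V_L=\{v_1,v_2,\dots\}$, and set $s(2^{j-1}+i2^{j})=v_j$ for $j\ge1$, $i\ge0$. Let $(r_n)_{n\ge1}$ be a nondecreasing sequence of integers with $r_n>L$ for all $n$. Construct columns by cutting and stacking as follows. $C_1$ is the single level $[0,1)$. Given the column $C_n$ of height $h_n$ (a stack of $h_n$ disjoint left-closed, right-open intervals of equal length), let $s(n)=(u_1,\dots,u_L)$ and $\sigma=u_1+\dots+u_L$, and cut $C_n$ into $r_n$ subcolumns of equal width, numbered $1,\dots,r_n$ from left to right. Place $(2L+1)h_n+\sigma$ spacers (new disjoint intervals of the same width) on subcolumn $i$ for $1\le i\le r_n-L-1$, and $h_n+u_d$ spacers on subcolumn $r_n-L-1+d$ for $1\le d\le L$. Stack each subcolumn on top of its left neighbour, and finally put $g_n$ further spacers on top, where $g_n$ is the height of the resulting stack; this gives $C_{n+1}$, of height $h_{n+1}=2g_n$. Let $X=\bigcup_n C_n\subset\mathbb R$ with Lebesgue measure $\mu$, and let $T$ be the transformation of $X$ that translates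 every level of every $C_n$ other than the top one onto the level directly above it. There exist such sequences with $$\sum_{n=1}^\infty \Big(\frac1{r_n}\Big)^{k}=\infty\quad\text{and}\quad \sum_{n=1}^\infty \Big(\frac1{r_n}\Big)^{k+1}<\infty ,$$ for every such sequence the construction can be carried out, and every resulting $T$ has the following properties. 1. $T$ is an invertible (mod $\mu$) measure-preserving transformation, $\mu(X)=\infty$, and $T$ is rank-one: there is a sequence of columns (finitely many disjoint measurable levels of finite measure, each carried by $T$ to the next one mod $\mu$) such that every set of finite measure is approximated arbitrarily well, by all sufficiently late columns, by unions of levels. 2. $T$ has zero Krengel entropy: $\sup_F \mu(F)\,h(T_F,\mu(\cdot\mid F))=0$, the supremum being over all measurable $F$ with $0<\mu(F)<\infty$, where $T_F$ is the transformation induced on $F$ (the first return map) and $h$ is Kolmogorov–Sinai entropy. 3. $T$ has ergodic index exactly $k$: for $m\ge1$, the $m$-fold Cartesian product $T\times\dots\times T$ is ergodic for the product measure if and only if $m\le k$. 4. $T$ is partially rigid: there are $c>0$ and $t_1<t_2<\dots$ with $\liminf_j\mu(T^{-t_j}A\cap A)\ge c\,\mu(A)$ for all measurable $A$ with $\mu(A)<\infty$.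 Moreover, $T$ has infinite conservative index: all its finite Cartesian products are conservative. In particular, for every positive integer $k$ there is a rank-one infinite measure-preserving transformation of zero Krengel entropy with ergodic index exactly $k$ and infinite conservative index. -/

import Mathlib

open MeasureTheory Filter Set
open scoped ENNReal

noncomputable section

/-! ### Measure-theoretic notions for a transformation `T` of a measure space -/

/-- `T` is invertible modulo `μ`-null sets, as a measure-preserving transformation. -/
def InvertibleMod {α : Type*} [MeasurableSpace α] (T : α → α) (μ : Measure α) : Prop :=
  ∃ S : α → α, MeasurePreserving S μ μ ∧ (∀ᵐ x ∂μ, S (T x) = x) ∧ ∀ᵐ x ∂μ, T (S x) = x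

/-- The `m`-fold Cartesian product `T × ⋯ × T`. -/
def prodPow {α : Type*} (T : α → α) (m : ℕ) : (Fin m → α) → (Fin m → α) :=
  fun x i => T (x i)

/-- `T` has ergodic index exactly `k`: the `m`-fold product (`m ≥ 1`) is ergodic for the product
measure precisely when `m ≤ k`. -/
def HasErgodicIndex {α : Type*} [MeasurableSpace α] (T : α → α) (μ : Measure α) (k : ℕ) : Prop :=
  ∀ m : ℕ, 1 ≤ m → (Ergodic (prodPow T m) (Measure.pi fun _ : Fin m => μ) ↔ m ≤ k)

/-- `T` has infinite conservative index: all finite Cartesian products of `T` are conservative. -/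
def HasInfiniteConservativeIndex {α : Type*} [MeasurableSpace α] (T : α → α) (μ : Measure α) :
    Prop :=
  ∀ m : ℕ, 1 ≤ m → Conservative (prodPow T m) (Measure.pi fun _ : Fin m => μ)

/-- `T` is partially rigid: for some `c > 0` and some increasing sequence of times `t j`,
`liminf μ(T^{-t j} A ∩ A) ≥ c μ(A)` for every set `A` of finite measure. -/
def PartiallyRigid {α : Type*} [MeasurableSpace α] (T : α → α) (μ : Measure α) : Prop :=
  ∃ c : ℝ≥0∞, 0 < c ∧ ∃ t : ℕ → ℕ, StrictMono t ∧ ∀ A : Set α, MeasurableSet A → μ A ≠ ⊤ →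
    c * μ A ≤ liminf (fun j => μ ((T^[t j]) ⁻¹' A ∩ A)) atTop

/-- `T` is rank-one: there is a sequence of columns (`I n i`, `i < h n`, is the `i`-th level of the
`n`-th column; the levels are disjoint, of finite measure, and `T` carries each level to the next
one modulo null sets) such that every set of finite measure is approximated, by all columns that are
far enough in the sequence, by unions of levels. -/
def RankOne {α : Type*} [MeasurableSpace α] (T : α → α) (μ : Measure α) : Prop :=
  ∃ (h : ℕ → ℕ) (I : ℕ → ℕ → Set α),
    (∀ n, ∀ i < h n, MeasurableSet (I n i) ∧ μ (I n i) ≠ ⊤) ∧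
    (∀ n, ∀ i < h n, ∀ j < h n, i ≠ j → Disjoint (I n i) (I n j)) ∧
    (∀ n i, i + 1 < h n → T ⁻¹' (I n (i + 1)) =ᵐ[μ] I n i) ∧
    ∀ A : Set α, MeasurableSet A → μ A ≠ ⊤ → ∀ ε : ℝ≥0∞, 0 < ε →
      ∀ᶠ n in atTop, ∃ J ⊆ Finset.range (h n), μ (symmDiff A (⋃ i ∈ J, I n i)) < ε

/-! ### Krengel entropy -/

/-- Shannon entropy of the finite partition `{P = j}`. -/
def partitionEntropy {α ι : Type*} [MeasurableSpace α] [Fintype ι] (ν : Measure α) (P : α → ι) :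
    ℝ :=
  ∑ j, Real.negMulLog (ν.real (P ⁻¹' {j}))

/-- The join of the partitions `P, S⁻¹P, …, S^{-(n-1)}P`. -/
def joinPartition {α ι : Type*} (S : α → α) (P : α → ι) (n : ℕ) : α → (Fin n → ι) :=
  fun x i => P (S^[i] x)

/-- Kolmogorov–Sinai entropy of `S` for the probability measure `ν`. -/
def ksEntropy {α : Type*} [MeasurableSpace α] (S : α → α) (ν : Measure α) : ℝ≥0∞ :=
  ⨆ (m : ℕ) (P : α → Fin m) (_ : Measurable P),
    limsup (fun n : ℕ => ENNReal.ofReal (partitionEntropy ν (joinPartition S P n) / n)) atTop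

/-- The first return time to `F` (with value `0` at points that never return). -/
def returnTime {α : Type*} (T : α → α) (F : Set α) (x : α) : ℕ :=
  sInf {n | 0 < n ∧ T^[n] x ∈ F}

/-- The transformation induced by `T` on `F`. -/
def inducedMap {α : Type*} (T : α → α) (F : Set α) (x : α) : α :=
  T^[returnTime T F x] x

/-- Krengel entropy of a conservative measure-preserving transformation: the supremum over all sets
`F` of positive finite measure of `μ(F)` times the entropy of the transformation induced on `F`,
with respect to the normalized restriction of `μ` to `F`. -/
def krengelEntropy {α : Type*} [MeasurableSpace α] (T : α → α) (μ : Measure α) : ℝ≥0∞ :=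
  ⨆ (F : Set α) (_ : MeasurableSet F) (_ : μ F ≠ 0) (_ : μ F ≠ ⊤),
    μ F * ksEntropy (inducedMap T F) (ProbabilityTheory.cond μ F)

/-! ### Cutting and stacking -/

/-- A column of intervals of a common width; `base` lists the left endpoints of the levels, from
bottom to top. The level with left endpoint `a` is the interval `[a, a + width)`. -/
structure IntervalColumn where
  width : ℝ
  base : List ℝ

/-- The height (number of levels) of a column. -/
def IntervalColumn.height (C : IntervalColumn) : ℕ := C.base.length

/-- `C'` is obtained from `C` by cutting it into `r` subcolumns of equal width, numbered
`0, …, r - 1` from left to right, placing `s i` spacers (new intervals, disjoint from each other and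
from the levels of `C`) on top of subcolumn `i`, and stacking subcolumn `i + 1` on top of
subcolumn `i`. -/
def IntervalColumn.CutStack (C C' : IntervalColumn) (r : ℕ) (s : ℕ → ℕ) : Prop :=
  C'.width = C.width / r ∧
  (∃ S : ℕ → List ℝ, (∀ i < r, (S i).length = s i) ∧
    C'.base = (List.range r).flatMap fun i : ℕ => C.base.map (fun a => a + (i : ℝ) * C'.width) ++ S i) ∧
  C'.base.Pairwise fun a b => Disjoint (Ico a (a + C'.width)) (Ico b (b + C'.width))

/-- The space `X`, union of all levels of all columns. -/
def stackSpace (C : ℕ → IntervalColumn) : Set ℝ :=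
  ⋃ n, ⋃ a ∈ (C n).base, Ico a (a + (C n).width)

/-- Lebesgue measure on `X`. -/
def stackMeasure (C : ℕ → IntervalColumn) : Measure ℝ := volume.restrict (stackSpace C)

/-- `y` lies directly above `x` in some column of the sequence. -/
def StackStep (C : ℕ → IntervalColumn) (x y : ℝ) : Prop :=
  ∃ (n i : ℕ) (hi : i + 1 < (C n).base.length),
    x ∈ Ico (C n).base[i] ((C n).base[i] + (C n).width) ∧
      y = x + ((C n).base[i + 1] - (C n).base[i])

open Classical in
/-- The transformation defined by a sequence of columns: each level that is not the top one is
translated onto the level above it. (Points to which this does not apply are left fixed.) -/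
def stackMap (C : ℕ → IntervalColumn) (x : ℝ) : ℝ :=
  if h : ∃ y, StackStep C x y then h.choose else x

/-! ### The family of constructions -/

/-- The set `V_L` of increasing `L`-tuples of positive integers. -/
def increasingTuples (L : ℕ) : Set (Fin L → ℕ) := {u | StrictMono u ∧ ∀ d, 0 < u d}

/-- The number of spacers on subcolumn `i` (`0 ≤ i < r`, numbered from `0`) of a column of height
`h`: `(2L+1)h + σ` on each of the first `r - L - 1` subcolumns, `h + u_d` on the `d`-th of the next
`L` subcolumns, and on the last one the `g` spacers that are placed on top of the whole stack, `g`
being the height of the stack before. -/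
def spacerCount (L h r : ℕ) (u : Fin L → ℕ) (i : ℕ) : ℕ :=
  if i < r - L - 1 then (2 * L + 1) * h + ∑ d, u d
  else if hd : i - (r - L - 1) < L then h + u ⟨i - (r - L - 1), hd⟩
  else r * h + (r - L - 1) * ((2 * L + 1) * h + ∑ d, u d) + (L * h + ∑ d, u d)

/-- The parameters: a nondecreasing sequence `r` of integers greater than `L`, and a listing `v`
of `V_L`. -/
structure IsParameter (L : ℕ) (r : ℕ → ℕ) (v : ℕ → Fin L → ℕ) : Prop where
  mono : Monotone r
  lt : ∀ n, L < r n
  listing : Set.range v = increasingTuples L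

/-- `C` is a sequence of columns built from the parameters, starting with the single level `[0, 1)`.
Indices start at `0`, so step `n` here is step `n + 1` when counting from `1`; the tuple used in step
`2^{j-1} + i 2^j` (counting from `1`) is the `j`-th one of the listing, i.e. the tuple with index
`j - 1 = padicValNat 2 (n + 1)` when counting from `0`. -/
def IsConstruction (L : ℕ) (r : ℕ → ℕ) (v : ℕ → Fin L → ℕ) (C : ℕ → IntervalColumn) : Prop :=
  C 0 = ⟨1, [0]⟩ ∧
  ∀ n, (C n).CutStack (C (n + 1)) (r n)
    (spacerCount L (C n).height (r n) (v (padicValNat 2 (n + 1))))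

end

/-! Cut a column of height `h` into `r` copies and put `q = r - L - 1`. For `c < q` the distance
from copy `c` to copy `c + 1` is `a = (2L+2)h + σ`; the remaining `L` distances are `2h + u_d`, and
they add up to `a - 2h`. The regular distances give recurrence, the irregular ones decide
ergodicity.

Recurrence. Since `∑ r^{-(k+1)}` converges, `q / r → 1`, so the time `a` brings almost all of every
level back to itself. This gives rigidity, even with constant `1`, and, applied in all coordinates
at once, conservativity of all products.

Ergodicity for `m ≤ k`. Let `s` be invariant, dense in a product of levels `a_i` of column `n`, with
complement dense in a product of levels `b_i`. Some tuple of `V_L` contains all the numbers `N + a_i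
- b_i`, where `N = h_n + 1`. In each step that uses it, the single time `2h + N` carries a copy of
the first product onto a copy of the second, so `s` cannot be dense in one and sparse in the other.
Two of the `r^m` choices of copies are spent on this, and the others are treated at later steps. The
untreated proportion is the product of the `1 - 2/r^m` over these steps. It vanishes because `∑
r^{-m}` diverges, also along an arithmetic progression, `r` being nondecreasing
(`pow_W_le_of_connects`, `ergodic_prodPow`).

Failure of ergodicity for `m > k`. If `c < q`, then the difference of the positions of `c'` and `c`
is equal to any other such difference or at least `2h` away from it (`copyPos_separated`). Hence the
displacements of the coordinates, which agree in a late column, agree in all earlier ones, unless at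
some stage all `m` coordinates lie in the last `L + 1` copies (`sub_height_eq`). That has
conditional probability `((L+1)/r)^m`, which is summable, so on a set of positive measure unequal
displacements never occur (`not_ergodic_prodPow`).

Entropy. Only conservativity and the columns matter. A union `F'` of levels is visited in cyclic
order, so an orbit of the map induced on `F ≈ F'` is described by an initial phase and rare
corrections; a Kraft-type bound for this code makes the entropy vanish
(`ksEntropy_inducedMap_eq_zero`). -/

noncomputable section

/-! ### Systems of columns -/

/-- A sequence of columns of intervals: the `i`-th level of the `n`-th column (`i < h n`) is
`[b n i, b n i + w n)`, the `c`-th of the `r n` copies of the `n`-th column occupies the levels of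
the next column from `pos n c` on. -/
structure ColumnSystem where
  X : Set ℝ
  h : ℕ → ℕ
  r : ℕ → ℕ
  pos : ℕ → ℕ → ℕ
  w : ℕ → ℝ
  b : ℕ → ℕ → ℝ
  w_pos : ∀ n, 0 < w n
  two_le : ∀ n, 2 ≤ r n
  w_succ : ∀ n, w n = r n * w (n + 1)
  h_pos : ∀ n, 0 < h n
  disj : ∀ n i j, i < h n → j < h n → i ≠ j →
    Disjoint (Ico (b n i) (b n i + w n)) (Ico (b n j) (b n j + w n))
  base_succ : ∀ n c i, c < r n → i < h n → b (n + 1) (pos n c + i) = b n i + c * w (n + 1)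
  -- At least `h n` further levels lie above each point of a copy. This keeps every point of the
  -- space away from the tops of late columns.
  room : ∀ n c i, c < r n → i < h n → pos n c + i + h n < h (n + 1)
  mem_X : ∀ x, x ∈ X ↔ ∃ n i, i < h n ∧ x ∈ Ico (b n i) (b n i + w n)

namespace ColumnSystem

variable (S : ColumnSystem)

/-- The `i`-th level of the `n`-th column. -/
def lev (n i : ℕ) : Set ℝ := Ico (S.b n i) (S.b n i + S.w n)

/-- The invariant measure. -/
def μ : Measure ℝ := volume.restrict S.X

/-- The measure of a level of the `n`-th column. -/
def W (n : ℕ) : ℝ≥0∞ := ENNReal.ofReal (S.w n)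

variable {S}

lemma r_pos (n : ℕ) : 0 < S.r n := by have := S.two_le n; omega

lemma measurableSet_lev (n i : ℕ) : MeasurableSet (S.lev n i) := measurableSet_Ico

lemma lev_subset_X {n i : ℕ} (hi : i < S.h n) : S.lev n i ⊆ S.X :=
  fun x hx => (S.mem_X x).2 ⟨n, i, hi, hx⟩

lemma exists_lev {x : ℝ} (hx : x ∈ S.X) : ∃ n i, i < S.h n ∧ x ∈ S.lev n i := (S.mem_X x).1 hx

lemma X_eq_iUnion : S.X = ⋃ n, ⋃ i ∈ Finset.range (S.h n), S.lev n i := by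
  ext x
  simp only [S.mem_X, mem_iUnion, Finset.mem_range, exists_prop]
  rfl

lemma measurableSet_X : MeasurableSet S.X := by
  rw [X_eq_iUnion]
  exact MeasurableSet.iUnion fun n => Finset.measurableSet_biUnion _ fun i _ => measurableSet_lev n i

lemma μ_apply {n i : ℕ} (hi : i < S.h n) : S.μ (S.lev n i) = S.W n := by
  rw [μ, Measure.restrict_apply (measurableSet_lev n i), inter_eq_left.2 (lev_subset_X hi), lev,
    Real.volume_Ico, W]
  congr 1; ring

lemma W_ne_zero (n : ℕ) : S.W n ≠ 0 := by simp [W, S.w_pos n]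

lemma W_ne_top (n : ℕ) : S.W n ≠ ⊤ := ENNReal.ofReal_ne_top

lemma W_succ (n : ℕ) : S.W n = S.r n * S.W (n + 1) := by
  rw [W, W, S.w_succ n, ENNReal.ofReal_mul (by positivity), ENNReal.ofReal_natCast]

lemma lev_unique {n i j : ℕ} {x : ℝ} (hi : i < S.h n) (hj : j < S.h n) (hx : x ∈ S.lev n i)
    (hx' : x ∈ S.lev n j) : i = j := by
  by_contra hij
  exact Set.disjoint_left.1 (S.disj n i j hi hj hij) hx hx'

lemma disjoint_lev {n i j : ℕ} (hi : i < S.h n) (hj : j < S.h n) (hij : i ≠ j) :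
    Disjoint (S.lev n i) (S.lev n j) := S.disj n i j hi hj hij

lemma pos_add_lt {n c i : ℕ} (hc : c < S.r n) (hi : i < S.h n) : S.pos n c + i < S.h (n + 1) := by
  have := S.room n c i hc hi; omega

lemma lev_succ_subset {n c i : ℕ} (hc : c < S.r n) (hi : i < S.h n) :
    S.lev (n + 1) (S.pos n c + i) ⊆ S.lev n i := by
  have hw := S.w_pos (n + 1)
  have hc' : (c : ℝ) + 1 ≤ S.r n := by exact_mod_cast hc
  have h0 : 0 ≤ (c : ℝ) * S.w (n + 1) := by positivity
  have h1 : ((c : ℝ) + 1) * S.w (n + 1) ≤ S.r n * S.w (n + 1) := by gcongr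
  intro x hx
  simp only [lev, S.base_succ n c i hc hi, S.w_succ n, mem_Ico] at hx ⊢
  constructor <;> nlinarith [hx.1, hx.2]

lemma exists_lev_succ {n i : ℕ} {x : ℝ} (hi : i < S.h n) (hx : x ∈ S.lev n i) :
    ∃ c < S.r n, x ∈ S.lev (n + 1) (S.pos n c + i) := by
  have hw := S.w_pos (n + 1)
  simp only [lev, S.w_succ n, mem_Ico] at hx
  have h0 : 0 ≤ (x - S.b n i) / S.w (n + 1) := div_nonneg (by linarith [hx.1]) hw.le
  have hlt : ⌊(x - S.b n i) / S.w (n + 1)⌋₊ < S.r n := by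
    rw [Nat.floor_lt h0, div_lt_iff₀ hw]; linarith [hx.2]
  refine ⟨_, hlt, ?_⟩
  have h1 := Nat.floor_le h0
  have h2 := Nat.lt_floor_add_one ((x - S.b n i) / S.w (n + 1))
  rw [le_div_iff₀ hw] at h1
  rw [div_lt_iff₀ hw] at h2
  simp only [lev, S.base_succ n _ i hlt hi, mem_Ico]
  constructor <;> nlinarith

lemma lev_eq_iUnion {n i : ℕ} (hi : i < S.h n) :
    S.lev n i = ⋃ c ∈ Finset.range (S.r n), S.lev (n + 1) (S.pos n c + i) := by
  ext x
  simp only [mem_iUnion, Finset.mem_range, exists_prop]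
  exact ⟨exists_lev_succ hi, fun ⟨c, hc, hx⟩ => lev_succ_subset hc hi hx⟩

lemma base_mem_lev (n i : ℕ) : S.b n i ∈ S.lev n i := by
  simp [lev, S.w_pos n]

lemma pos_add_inj {n c c' i i' : ℕ} (hc : c < S.r n) (hc' : c' < S.r n) (hi : i < S.h n)
    (hi' : i' < S.h n) (heq : S.pos n c + i = S.pos n c' + i') : c = c' ∧ i = i' := by
  have h1 := lev_succ_subset hc hi (base_mem_lev (n + 1) _)
  have h2 := lev_succ_subset hc' hi' (base_mem_lev (n + 1) _)
  rw [heq] at h1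
  have hii := lev_unique hi hi' h1 h2
  subst hii
  have h3 := S.base_succ n c i hc hi
  have h4 := S.base_succ n c' i hc' hi
  rw [heq, h4] at h3
  have := S.w_pos (n + 1)
  have h5 : (c' : ℝ) = c := by
    have : (c' : ℝ) * S.w (n + 1) = c * S.w (n + 1) := by linarith
    exact mul_right_cancel₀ (by positivity) this
  exact ⟨by exact_mod_cast h5.symm, rfl⟩

lemma disjoint_lev_succ {n c c' i : ℕ} (hc : c < S.r n) (hc' : c' < S.r n) (hi : i < S.h n)
    (hne : c ≠ c') : Disjoint (S.lev (n + 1) (S.pos n c + i)) (S.lev (n + 1) (S.pos n c' + i)) :=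
  disjoint_lev (pos_add_lt hc hi) (pos_add_lt hc' hi) fun heq =>
    hne (pos_add_inj hc hc' hi hi heq).1

lemma h_lt_succ (n : ℕ) : S.h n < S.h (n + 1) := by
  have := S.room n 0 0 (r_pos n) (S.h_pos n); omega

lemma h_strictMono : StrictMono S.h := strictMono_nat_of_lt_succ h_lt_succ

lemma le_h (n : ℕ) : n ≤ S.h n := h_strictMono.id_le n

/-- Every later column contains, with a point, the whole copy of the present column. -/
lemma exists_refinement {n n' i : ℕ} {x : ℝ} (hn : n ≤ n') (hi : i < S.h n) (hx : x ∈ S.lev n i) :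
    ∃ o, x ∈ S.lev n' (o + i) ∧ ∀ j < S.h n, o + j < S.h n' ∧ S.lev n' (o + j) ⊆ S.lev n j := by
  induction n', hn using Nat.le_induction with
  | base => exact ⟨0, by simpa using hx, fun j hj => by rw [zero_add]; exact ⟨hj, Subset.rfl⟩⟩
  | succ m hm ih =>
    obtain ⟨o, hxo, ho⟩ := ih
    obtain ⟨c, hc, hxc⟩ := exists_lev_succ (ho i hi).1 hxo
    refine ⟨S.pos m c + o, by rwa [add_assoc], fun j hj => ?_⟩
    rw [add_assoc]
    exact ⟨pos_add_lt hc (ho j hj).1, (lev_succ_subset hc (ho j hj).1).trans (ho j hj).2⟩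

/-- A point of the space is eventually far below the top of the columns. -/
lemma eventually_mem_lev {x : ℝ} (hx : x ∈ S.X) (N : ℕ) :
    ∀ᶠ n in atTop, ∃ i, x ∈ S.lev n i ∧ i + N < S.h n := by
  obtain ⟨n₀, i₀, hi₀, hx₀⟩ := exists_lev hx
  filter_upwards [eventually_gt_atTop (n₀ + N)] with n hn
  obtain ⟨m, rfl⟩ : ∃ m, n = m + 1 := ⟨n - 1, by omega⟩
  obtain ⟨o, hxo, ho⟩ := exists_refinement (n' := m) (by omega) hi₀ hx₀
  obtain ⟨c, hc, hxc⟩ := exists_lev_succ (ho i₀ hi₀).1 hxo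
  refine ⟨_, hxc, ?_⟩
  have h1 := S.room m c _ hc (ho i₀ hi₀).1
  have h2 := S.le_h m
  omega

/-- All levels of one copy are translated by the same amount, so the displacement to the next level
is inherited by later columns. This is why the columns define a single-valued map. -/
lemma base_sub_eq {n n' i i' : ℕ} {x : ℝ} (hn : n ≤ n') (hi : i + 1 < S.h n) (hx : x ∈ S.lev n i)
    (hi' : i' + 1 < S.h n') (hx' : x ∈ S.lev n' i') :
    S.b n' (i' + 1) - S.b n' i' = S.b n (i + 1) - S.b n i := by
  have key : ∃ j, j + 1 < S.h n' ∧ x ∈ S.lev n' j ∧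
      S.b n' (j + 1) - S.b n' j = S.b n (i + 1) - S.b n i := by
    induction n', hn using Nat.le_induction generalizing i' with
    | base => exact ⟨i, hi, hx, rfl⟩
    | succ m hm ih =>
      obtain ⟨o, hxo, ho⟩ := exists_refinement hm (by omega) hx
      obtain ⟨j, hj, hxj, hb⟩ := ih (ho _ hi).1 hxo
      obtain ⟨c, hc, hxc⟩ := exists_lev_succ (by omega) hxj
      refine ⟨S.pos m c + j, pos_add_lt hc hj, hxc, ?_⟩
      rw [add_assoc, S.base_succ m c _ hc hj, S.base_succ m c j hc (by omega), ← hb]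
      ring
  obtain ⟨j, hj, hxj, hb⟩ := key
  rwa [lev_unique (by omega) (by omega) hx' hxj]

end ColumnSystem

/-- A sequence of columns together with the transformation it defines. -/
structure StackSystem extends ColumnSystem where
  T : ℝ → ℝ
  step : ∀ n i x, i + 1 < h n → x ∈ Ico (b n i) (b n i + w n) →
    T x = x + (b n (i + 1) - b n i)
  off : ∀ x, x ∉ X → T x = x

/-! ### The transformation: injectivity, invariance of the measure, invertibility -/

namespace StackSystem

open ColumnSystem

variable {S : StackSystem}

lemma T_mem_lev {n i : ℕ} {x : ℝ} (hi : i + 1 < S.h n) (hx : x ∈ S.lev n i) :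
    S.T x ∈ S.lev n (i + 1) := by
  rw [S.step n i x hi hx]
  simp only [lev, mem_Ico] at hx ⊢
  constructor <;> linarith [hx.1, hx.2]

lemma iterate_mem_lev {n i t : ℕ} {x : ℝ} (hi : i + t < S.h n) (hx : x ∈ S.lev n i) :
    S.T^[t] x ∈ S.lev n (i + t) := by
  induction t with
  | zero => simpa using hx
  | succ t ih =>
    rw [Function.iterate_succ_apply', ← add_assoc]
    exact T_mem_lev (by omega) (ih (by omega))

lemma T_mem_X {x : ℝ} (hx : x ∈ S.X) : S.T x ∈ S.X := by
  obtain ⟨n, i, hxi, hi⟩ := (eventually_mem_lev hx 1).exists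
  exact lev_subset_X hi (T_mem_lev hi hxi)

lemma T_mem_X_iff {x : ℝ} : S.T x ∈ S.X ↔ x ∈ S.X := by
  refine ⟨fun h => ?_, T_mem_X⟩
  by_contra hx
  rw [S.off x hx] at h
  exact hx h

/-- In a later column where `x` is not on the top level, `S.T x` lies in a copy of column `n`, at
height `i + 1` of that copy. The level directly beneath, which contains `x`, is therefore a copy of
level `i`. -/
lemma mem_lev_of_T {n i : ℕ} {x : ℝ} (hi : i + 1 < S.h n) (hx : S.T x ∈ S.lev n (i + 1)) :
    x ∈ S.lev n i := by
  have hxX : x ∈ S.X := T_mem_X_iff.1 (lev_subset_X hi hx)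
  obtain ⟨m, ⟨j, hxj, hj⟩, hm⟩ := ((eventually_mem_lev hxX 1).and (eventually_ge_atTop n)).exists
  obtain ⟨o, hxo, ho⟩ := exists_refinement hm hi hx
  have h1 := lev_unique hj (ho _ hi).1 (T_mem_lev hj hxj) hxo
  obtain rfl : j = o + i := by omega
  exact (ho i (by omega)).2 hxj

lemma iterate_mem_lev_iff {n i t : ℕ} {x : ℝ} (hi : i + t < S.h n) :
    S.T^[t] x ∈ S.lev n (i + t) ↔ x ∈ S.lev n i := by
  refine ⟨fun hx => ?_, iterate_mem_lev hi⟩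
  induction t with
  | zero => simpa using hx
  | succ t ih =>
    rw [Function.iterate_succ_apply', ← add_assoc] at hx
    exact ih (by omega) (mem_lev_of_T (by omega) hx)

/-- Fixing the points off `X` makes this hold on all of `ℝ`, so that `T` is a measurable embedding
and has a measurable left inverse. -/
lemma T_injective : Function.Injective S.T := by
  intro x y hxy
  by_cases hx : x ∈ S.X
  · have hy : y ∈ S.X := by rw [← T_mem_X_iff, ← hxy]; exact T_mem_X hx
    obtain ⟨n, ⟨i, hxi, hi⟩, ⟨j, hyj, hj⟩⟩ :=
      ((eventually_mem_lev hx 1).and (eventually_mem_lev hy 1)).exists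
    have h1 := T_mem_lev hj hyj
    rw [← hxy] at h1
    obtain rfl : i = j := by have := lev_unique hi hj (T_mem_lev hi hxi) h1; omega
    rw [S.step n i x hi hxi, S.step n i y hj hyj] at hxy
    linarith
  · have hy : y ∉ S.X := by rw [← T_mem_X_iff, ← hxy, T_mem_X_iff]; exact hx
    rwa [S.off x hx, S.off y hy] at hxy

/-- The union of the levels of the `n`-th column other than the top one. -/
def lower (S : StackSystem) (n : ℕ) : Set ℝ := ⋃ i ∈ Finset.range (S.h n - 1), S.lev n i

/-- The union of the levels of the `n`-th column other than the bottom one. -/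
def upper (S : StackSystem) (n : ℕ) : Set ℝ := ⋃ i ∈ Finset.range (S.h n - 1), S.lev n (i + 1)

lemma mem_lower {n : ℕ} {x : ℝ} : x ∈ S.lower n ↔ ∃ i, i + 1 < S.h n ∧ x ∈ S.lev n i := by
  simp only [lower, mem_iUnion, Finset.mem_range, exists_prop]
  exact exists_congr fun i => and_congr_left fun _ => by omega

lemma mem_upper {n : ℕ} {x : ℝ} : x ∈ S.upper n ↔ ∃ i, i + 1 < S.h n ∧ x ∈ S.lev n (i + 1) := by
  simp only [upper, mem_iUnion, Finset.mem_range, exists_prop]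
  exact exists_congr fun i => and_congr_left fun _ => by omega

lemma lower_mono : Monotone S.lower := by
  refine monotone_nat_of_le_succ fun n x hx => ?_
  rw [mem_lower] at hx ⊢
  obtain ⟨i, hi, hx⟩ := hx
  obtain ⟨c, hc, hxc⟩ := exists_lev_succ (by omega) hx
  refine ⟨_, ?_, hxc⟩
  have := S.room n c i hc (by omega)
  omega

lemma upper_mono : Monotone S.upper := by
  refine monotone_nat_of_le_succ fun n x hx => ?_
  rw [mem_upper] at hx ⊢
  obtain ⟨i, hi, hx⟩ := hx
  obtain ⟨c, hc, hxc⟩ := exists_lev_succ hi hx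
  have := S.room n c _ hc hi
  exact ⟨S.pos n c + i, by omega, hxc⟩

lemma iUnion_lower : ⋃ n, S.lower n = S.X := by
  ext x
  simp only [mem_iUnion, mem_lower]
  constructor
  · rintro ⟨n, i, hi, hx⟩
    exact lev_subset_X (by omega) hx
  · intro hx
    obtain ⟨n, i, hxi, hi⟩ := (eventually_mem_lev hx 1).exists
    exact ⟨n, i, hi, hxi⟩

lemma measurable_T : Measurable S.T := by
  intro A hA
  have : S.T ⁻¹' A = (A \ S.X) ∪ ⋃ n, ⋃ i ∈ Finset.range (S.h n - 1),
      S.lev n i ∩ (fun x => x + (S.b n (i + 1) - S.b n i)) ⁻¹' A := by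
    ext x
    simp only [mem_preimage, mem_union, Set.mem_sdiff, mem_iUnion, Finset.mem_range, mem_inter_iff,
      exists_prop]
    by_cases hx : x ∈ S.X
    · simp only [hx, not_true_eq_false, and_false, false_or]
      constructor
      · intro h
        obtain ⟨n, i, hxi, hi⟩ := (eventually_mem_lev hx 1).exists
        refine ⟨n, i, by omega, hxi, ?_⟩
        rwa [← S.step n i x hi hxi]
      · rintro ⟨n, i, hi, hxi, h⟩
        rwa [S.step n i x (by omega) hxi]
    · simp only [hx, not_false_eq_true, and_true, S.off x hx, iff_self_or]
      rintro ⟨n, i, hi, hxi, h⟩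
      exact absurd (lev_subset_X (by omega) hxi) hx
  rw [this]
  refine (hA.diff measurableSet_X).union (MeasurableSet.iUnion fun n =>
    Finset.measurableSet_biUnion _ fun i _ => (measurableSet_lev n i).inter ?_)
  exact (measurable_id.add_const _) hA

lemma measure_preimage_lower {A : Set ℝ} (hA : MeasurableSet A) (n : ℕ) :
    volume (S.T ⁻¹' A ∩ S.lower n) = volume (A ∩ S.upper n) := by
  have e1 : S.T ⁻¹' A ∩ S.lower n =
      ⋃ i ∈ Finset.range (S.h n - 1), (S.T ⁻¹' A ∩ S.lev n i) := by
    rw [lower, inter_iUnion₂]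
  have e2 : A ∩ S.upper n = ⋃ i ∈ Finset.range (S.h n - 1), (A ∩ S.lev n (i + 1)) := by
    rw [upper, inter_iUnion₂]
  rw [e1, e2, measure_biUnion_finset, measure_biUnion_finset]
  · refine Finset.sum_congr rfl fun i hi => ?_
    rw [Finset.mem_range] at hi
    have : S.T ⁻¹' A ∩ S.lev n i =
        (fun x => x + (S.b n (i + 1) - S.b n i)) ⁻¹' (A ∩ S.lev n (i + 1)) := by
      ext x
      simp only [mem_inter_iff, mem_preimage]
      have : x ∈ S.lev n i ↔ x + (S.b n (i + 1) - S.b n i) ∈ S.lev n (i + 1) := by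
        simp only [lev, mem_Ico]
        constructor <;> rintro ⟨h1, h2⟩ <;> constructor <;> linarith
      rw [← this]
      refine and_congr_left fun hx => ?_
      rw [S.step n i x (by omega) hx]
    rw [this, measure_preimage_add_right]
  · intro i hi j hj hij
    simp only [Finset.coe_range, mem_Iio] at hi hj
    exact (disjoint_lev (by omega) (by omega) (by omega)).mono inter_subset_right inter_subset_right
  · exact fun i _ => hA.inter (measurableSet_lev n _)
  · intro i hi j hj hij
    simp only [Finset.coe_range, mem_Iio] at hi hj
    exact (disjoint_lev (by omega) (by omega) hij).mono inter_subset_right inter_subset_right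
  · exact fun i _ => (measurable_T hA).inter (measurableSet_lev n _)

lemma w_tendsto : Tendsto S.w atTop (nhds 0) := by
  have hle : ∀ n, S.w n ≤ S.w 0 * (1 / 2) ^ n := by
    intro n
    induction n with
    | zero => simp
    | succ n ih =>
      have h1 := S.w_succ n
      have h2 : (2 : ℝ) ≤ S.r n := by exact_mod_cast S.two_le n
      have h3 := S.w_pos (n + 1)
      rw [pow_succ]
      nlinarith
  refine squeeze_zero (fun n => (S.w_pos n).le) hle ?_
  have := (tendsto_pow_atTop_nhds_zero_of_lt_one (r := (1 / 2 : ℝ)) (by norm_num)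
    (by norm_num)).const_mul (S.w 0)
  simpa using this

lemma W_tendsto : Tendsto S.W atTop (nhds 0) := by
  have := ENNReal.tendsto_ofReal (S.w_tendsto)
  rwa [ENNReal.ofReal_zero] at this

/-- A point never seen above a bottom level lies in the bottom level of every late column, and the
widths tend to `0`. -/
lemma volume_diff_upper : volume (S.X \ ⋃ n, S.upper n) = 0 := by
  have key : ∀ n, ∀ i < S.h n, volume (S.lev n i \ ⋃ n, S.upper n) = 0 := by
    intro n i hi
    have hle : ∀ᶠ m in atTop, volume (S.lev n i \ ⋃ n, S.upper n) ≤ S.W m := by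
      filter_upwards [eventually_ge_atTop n] with m hm
      have hsub : S.lev n i \ ⋃ n, S.upper n ⊆ S.lev m 0 := by
        rintro x ⟨hx, hxu⟩
        obtain ⟨o, hxo, ho⟩ := exists_refinement hm hi hx
        rcases Nat.eq_zero_or_pos (o + i) with h0 | h0
        · rwa [h0] at hxo
        · refine absurd (mem_iUnion.2 ⟨m, mem_upper.2 ⟨o + i - 1, ?_, ?_⟩⟩) hxu
          · have := (ho i hi).1; omega
          · rwa [Nat.sub_add_cancel h0]
      refine (measure_mono hsub).trans (le_of_eq ?_)
      rw [lev, Real.volume_Ico, W]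
      congr 1; ring
    exact le_antisymm (ge_of_tendsto W_tendsto hle) zero_le
  have : S.X \ ⋃ n, S.upper n =
      ⋃ n, ⋃ i ∈ Finset.range (S.h n), (S.lev n i \ ⋃ n, S.upper n) := by
    conv_lhs => rw [X_eq_iUnion]
    simp only [iUnion_sdiff]
  rw [this, measure_iUnion_null_iff]
  intro n
  refine (measure_biUnion_null_iff (Finset.range (S.h n)).countable_toSet).2 fun i hi => ?_
  exact key n i (Finset.mem_range.1 hi)

/-- On the part of a column below its top level the map is a finite union of translations. These
parts exhaust `X`, and their images exhaust `X` up to a null set. -/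
lemma measurePreserving_T : MeasurePreserving S.T S.μ S.μ := by
  refine ⟨measurable_T, Measure.ext fun A hA => ?_⟩
  rw [Measure.map_apply measurable_T hA, μ, Measure.restrict_apply (measurable_T hA),
    Measure.restrict_apply hA]
  have h1 : Tendsto (fun n => volume (S.T ⁻¹' A ∩ S.lower n)) atTop
      (nhds (volume (S.T ⁻¹' A ∩ S.X))) := by
    rw [← iUnion_lower, inter_iUnion]
    exact tendsto_measure_iUnion_atTop fun a b hab => inter_subset_inter_right _ (lower_mono hab)
  have h2 : Tendsto (fun n => volume (A ∩ S.upper n)) atTop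
      (nhds (volume (A ∩ ⋃ n, S.upper n))) := by
    rw [inter_iUnion]
    exact tendsto_measure_iUnion_atTop fun a b hab => inter_subset_inter_right _ (upper_mono hab)
  have h3 : volume (A ∩ ⋃ n, S.upper n) = volume (A ∩ S.X) := by
    refine le_antisymm (measure_mono (inter_subset_inter_right _ (iUnion_subset fun n x hx => ?_))) ?_
    · obtain ⟨i, hi, hx⟩ := mem_upper.1 hx
      exact lev_subset_X hi hx
    · calc volume (A ∩ S.X) ≤ volume ((A ∩ ⋃ n, S.upper n) ∪ (S.X \ ⋃ n, S.upper n)) := by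
            refine measure_mono fun x hx => ?_
            by_cases hxu : x ∈ ⋃ n, S.upper n
            · exact Or.inl ⟨hx.1, hxu⟩
            · exact Or.inr ⟨hx.2, hxu⟩
        _ ≤ _ := measure_union_le _ _
        _ = _ := by rw [volume_diff_upper, add_zero]
  simp only [measure_preimage_lower hA] at h1
  rw [← h3]
  exact tendsto_nhds_unique h1 h2

lemma invertibleMod : InvertibleMod S.T S.μ := by
  have hemb : MeasurableEmbedding S.T := measurable_T.measurableEmbedding T_injective
  obtain ⟨g, hg, hgT⟩ := hemb.exists_measurable_extend measurable_id fun _ => ⟨0⟩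
  have hgT' : ∀ x, g (S.T x) = x := fun x => congrFun hgT x
  refine ⟨g, ⟨hg, ?_⟩, ae_of_all _ hgT', ?_⟩
  · conv_lhs => rw [← measurePreserving_T.map_eq]
    rw [Measure.map_map hg measurable_T, hgT, Measure.map_id]
  · have h0 : S.μ (⋃ n, S.upper n)ᶜ = 0 := by
      rw [μ, Measure.restrict_apply, inter_comm, ← sdiff_eq, volume_diff_upper]
      exact (MeasurableSet.iUnion fun n => Finset.measurableSet_biUnion _
        fun i _ => measurableSet_lev n _).compl
    have : ∀ᵐ x ∂S.μ, x ∈ ⋃ n, S.upper n := h0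
    filter_upwards [this] with x hx
    obtain ⟨n, hx⟩ := mem_iUnion.1 hx
    obtain ⟨i, hi, hx⟩ := mem_upper.1 hx
    set y := x - (S.b n (i + 1) - S.b n i)
    have hy : y ∈ S.lev n i := by
      simp only [lev, mem_Ico] at hx ⊢
      constructor <;> simp only [y] <;> linarith [hx.1, hx.2]
    have hTy : S.T y = x := by rw [S.step n i y hi hy]; simp [y]
    rw [← hTy, hgT']

end StackSystem

namespace StackSystem

open ColumnSystem

variable {S : StackSystem}

/-! ### Approximation by levels -/

/-- Enclose `A ∩ X` in an open set `U` of almost the same measure. Since the widths tend to `0`, the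
levels contained in `U` fill up `U ∩ X`, and the sets they cover increase with `n`; hence all late
columns work. -/
lemma exists_finset_approx {A : Set ℝ} (hA : MeasurableSet A) (hfin : S.μ A ≠ ⊤) {ε : ℝ≥0∞}
    (hε : 0 < ε) : ∀ᶠ n in atTop, ∃ J ⊆ Finset.range (S.h n),
      S.μ (symmDiff A (⋃ i ∈ J, S.lev n i)) < ε := by
  classical
  rw [μ, Measure.restrict_apply hA] at hfin
  have hε2 : ε / 2 ≠ 0 := (ENNReal.half_pos hε.ne').ne'
  obtain ⟨U, hAU, hU, hUlt⟩ := (A ∩ S.X).exists_isOpen_lt_add hfin hε2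
  let J : ℕ → Finset ℕ := fun n => (Finset.range (S.h n)).filter fun i => S.lev n i ⊆ U
  let V : ℕ → Set ℝ := fun n => ⋃ i ∈ J n, S.lev n i
  have hV : ∀ n x, x ∈ V n ↔ ∃ i < S.h n, S.lev n i ⊆ U ∧ x ∈ S.lev n i := by
    intro n x
    simp only [V, J, mem_iUnion, Finset.mem_filter, Finset.mem_range, exists_prop, and_assoc]
  have hVmeas : ∀ n, MeasurableSet (V n) :=
    fun n => Finset.measurableSet_biUnion _ fun i _ => measurableSet_lev n i
  have hVmono : Monotone V := by
    refine monotone_nat_of_le_succ fun n x hx => ?_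
    rw [hV] at hx ⊢
    obtain ⟨i, hi, hiU, hx⟩ := hx
    obtain ⟨c, hc, hxc⟩ := exists_lev_succ hi hx
    exact ⟨_, pos_add_lt hc hi, (lev_succ_subset hc hi).trans hiU, hxc⟩
  have hVU : ∀ n, V n ⊆ U := by
    intro n x hx
    obtain ⟨i, hi, hiU, hx⟩ := (hV n x).1 hx
    exact hiU hx
  have hVX : ∀ n, V n ⊆ S.X := by
    intro n x hx
    obtain ⟨i, hi, hiU, hx⟩ := (hV n x).1 hx
    exact lev_subset_X hi hx
  have hcov : ⋂ n, ((U ∩ S.X) \ V n) = ∅ := by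
    rw [eq_empty_iff_forall_notMem]
    intro x hx
    simp only [mem_iInter, Set.mem_sdiff] at hx
    obtain ⟨⟨hxU, hxX⟩, -⟩ := hx 0
    obtain ⟨δ, hδ, hball⟩ := Metric.isOpen_iff.1 hU x hxU
    obtain ⟨n, ⟨i, hxi, hi⟩, hn⟩ := ((eventually_mem_lev hxX 0).and
      (w_tendsto.eventually (gt_mem_nhds hδ))).exists
    refine (hx n).2 ((hV n x).2 ⟨i, hi, fun y hy => hball ?_, hxi⟩)
    rw [Metric.mem_ball, Real.dist_eq, abs_lt]
    simp only [lev, mem_Ico] at hxi hy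
    constructor <;> linarith [hxi.1, hxi.2, hy.1, hy.2]
  have hUfin : volume (U ∩ S.X) ≠ ⊤ := by
    refine ne_top_of_le_ne_top ?_ (measure_mono inter_subset_left)
    refine (hUlt.trans_le le_top).ne
  have hlim : Tendsto (fun n => volume ((U ∩ S.X) \ V n)) atTop (nhds 0) := by
    rw [← measure_empty (μ := (volume : Measure ℝ)), ← hcov]
    refine tendsto_measure_iInter_atTop (fun n => ?_)
      (fun a b hab => sdiff_subset_sdiff_right (hVmono hab)) ⟨0, ?_⟩
    · exact ((hU.measurableSet.inter measurableSet_X).diff (hVmeas n)).nullMeasurableSet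
    · exact ne_top_of_le_ne_top hUfin (measure_mono sdiff_subset)
  filter_upwards [hlim.eventually (gt_mem_nhds hε2.bot_lt)] with n hn
  refine ⟨J n, Finset.filter_subset _ _, ?_⟩
  change S.μ (symmDiff A (V n)) < ε
  have hdiff : volume (U \ (A ∩ S.X)) ≤ ε / 2 := by
    rw [measure_sdiff hAU (hA.inter measurableSet_X).nullMeasurableSet hfin]
    exact tsub_le_iff_left.2 hUlt.le
  rw [μ, Measure.restrict_apply ((hA.symmDiff (hVmeas n)))]
  calc volume (symmDiff A (V n) ∩ S.X)
      ≤ volume (((U ∩ S.X) \ V n) ∪ (U \ (A ∩ S.X))) := by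
        refine measure_mono ?_
        rintro x ⟨hx | hx, hxX⟩
        · exact Or.inl ⟨⟨hAU ⟨hx.1, hxX⟩, hxX⟩, hx.2⟩
        · exact Or.inr ⟨hVU n hx.1, fun h => hx.2 h.1⟩
    _ ≤ _ := measure_union_le _ _
    _ < ε / 2 + ε / 2 := ENNReal.add_lt_add_of_lt_of_le
        (ne_top_of_le_ne_top (hUlt.trans_le le_top).ne (measure_mono sdiff_subset)) hn hdiff
    _ = ε := ENNReal.add_halves ε

lemma rankOne : RankOne S.T S.μ := by
  refine ⟨S.h, S.lev, fun n i hi => ⟨measurableSet_lev n i, ?_⟩,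
    fun n i hi j hj hij => disjoint_lev hi hj hij, fun n i hi => ?_,
    fun A hA hfin ε hε => exists_finset_approx hA hfin hε⟩
  · rw [μ_apply hi]; exact W_ne_top n
  · refine Filter.EventuallyEq.of_eq (Set.ext fun x => ?_)
    exact ⟨mem_lev_of_T hi, T_mem_lev hi⟩

/-- Under `hgrow`, the measure of the column at least doubles in each step. -/
lemma μ_univ (hgrow : ∀ n, 2 * (S.r n * S.h n) ≤ S.h (n + 1)) : S.μ univ = ⊤ := by
  have hle : ∀ n, S.h n * S.W n ≤ S.μ univ := by
    intro n
    calc (S.h n : ℝ≥0∞) * S.W n = ∑ i ∈ Finset.range (S.h n), S.μ (S.lev n i) := by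
          rw [Finset.sum_congr rfl fun i hi => μ_apply (Finset.mem_range.1 hi)]
          simp
      _ = S.μ (⋃ i ∈ Finset.range (S.h n), S.lev n i) := by
          rw [measure_biUnion_finset]
          · intro i hi j hj hij
            simp only [Finset.coe_range, mem_Iio] at hi hj
            exact disjoint_lev hi hj hij
          · exact fun i _ => measurableSet_lev n i
      _ ≤ _ := measure_mono (subset_univ _)
  have hpow : ∀ n, 2 ^ n * S.W 0 ≤ S.h n * S.W n := by
    intro n
    induction n with
    | zero =>
      have : (1 : ℝ≥0∞) ≤ S.h 0 := by exact_mod_cast S.h_pos 0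
      rw [pow_zero]
      gcongr
    | succ n ih =>
      have h1 : (2 : ℝ≥0∞) * (S.r n * S.h n) ≤ S.h (n + 1) := by exact_mod_cast hgrow n
      calc (2 : ℝ≥0∞) ^ (n + 1) * S.W 0 = 2 * (2 ^ n * S.W 0) := by ring
        _ ≤ 2 * (S.h n * S.W n) := by gcongr
        _ = 2 * (S.r n * S.h n) * S.W (n + 1) := by rw [W_succ n]; ring
        _ ≤ _ := by gcongr
  have hlim : Tendsto (fun n : ℕ => (2 : ℝ≥0∞) ^ n * S.W 0) atTop (nhds ⊤) := by
    have h2 : Tendsto (fun n : ℕ => (2 : ℝ≥0∞) ^ n) atTop (nhds ⊤) :=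
      ENNReal.tendsto_pow_atTop_nhds_top_iff.2 (by norm_num)
    have := ENNReal.Tendsto.mul_const h2 (b := S.W 0) (Or.inl ENNReal.top_ne_zero)
    rwa [ENNReal.top_mul (W_ne_zero 0)] at this
  exact top_unique (le_of_tendsto hlim (Eventually.of_forall fun n => (hpow n).trans (hle n)))

/-! ### Products of levels -/

/-- The measure of the `m`-fold product. -/
def μpi (S : StackSystem) (m : ℕ) : Measure (Fin m → ℝ) := Measure.pi fun _ => S.μ

/-- A product of levels of the `n`-th column. -/
def rect (S : StackSystem) {m : ℕ} (n : ℕ) (y : Fin m → ℕ) : Set (Fin m → ℝ) :=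
  univ.pi fun i => S.lev n (y i)

instance : SigmaFinite S.μ := by unfold μ; infer_instance

lemma μpi_eq (m : ℕ) : S.μpi m = volume.restrict (univ.pi fun _ => S.X) := by
  rw [μpi, volume_pi, Measure.restrict_pi_pi]
  rfl

variable {m : ℕ}

lemma measurableSet_rect (n : ℕ) (y : Fin m → ℕ) : MeasurableSet (S.rect n y) :=
  MeasurableSet.univ_pi fun i => measurableSet_lev n (y i)

lemma μpi_rect {n : ℕ} {y : Fin m → ℕ} (hy : ∀ i, y i < S.h n) :
    S.μpi m (S.rect n y) = S.W n ^ m := by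
  rw [μpi, rect, Measure.pi_pi]
  simp [μ_apply (hy _)]

lemma measurePreserving_prodPow : MeasurePreserving (prodPow S.T m) (S.μpi m) (S.μpi m) :=
  measurePreserving_pi (fun _ => S.μ) (fun _ => S.μ) fun _ => measurePreserving_T

lemma prodPow_iterate (T : ℝ → ℝ) (t : ℕ) (x : Fin m → ℝ) :
    (prodPow T m)^[t] x = fun i => T^[t] (x i) := by
  induction t with
  | zero => rfl
  | succ t ih =>
    rw [Function.iterate_succ_apply', ih]
    funext i
    simp [prodPow, Function.iterate_succ_apply']

/-- Lebesgue's density theorem for products of levels. -/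
lemma exists_rect_density {A : Set (Fin m → ℝ)} (hA : MeasurableSet A) (hpos : S.μpi m A ≠ 0)
    {ε : ℝ≥0∞} (hε : ε ≠ 0) :
    ∀ᶠ n in atTop, ∃ y : Fin m → ℕ, (∀ i, y i < S.h n) ∧
      S.μpi m (S.rect n y \ A) ≤ ε * S.W n ^ m := by
  rw [μpi_eq, Measure.restrict_apply hA] at hpos
  have hXm : MeasurableSet (univ.pi fun _ : Fin m => S.X) :=
    MeasurableSet.univ_pi fun _ => measurableSet_X
  set A' := A ∩ univ.pi fun _ => S.X with hA'
  have hA'm : MeasurableSet A' := hA.inter hXm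
  have hne : volume.restrict A' ≠ 0 := by rwa [Ne, Measure.restrict_eq_zero]
  have : (ae (volume.restrict A')).NeBot := ae_neBot.2 hne
  obtain ⟨x, hx, hxA⟩ := ((IsUnifLocDoublingMeasure.ae_tendsto_measure_inter_div
    (volume : Measure (Fin m → ℝ)) A' 1).and (ae_restrict_mem hA'm)).exists
  have hy : ∀ᶠ n in atTop, ∃ y : Fin m → ℕ, ∀ i, x i ∈ S.lev n (y i) ∧ y i < S.h n := by
    have : ∀ i, ∀ᶠ n in atTop, ∃ y, x i ∈ S.lev n y ∧ y + 0 < S.h n :=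
      fun i => eventually_mem_lev (hxA.2 i (mem_univ i)) 0
    filter_upwards [eventually_all.2 this] with n hn
    choose y hy using hn
    exact ⟨y, hy⟩
  obtain ⟨y, hy⟩ := hy.choice
  -- For the sup metric a product of levels is a cube, that is, a closed ball up to its boundary.
  -- The density point `x` lies in it but need not be its centre, hence the density theorem for
  -- balls with moving centres.
  have hsub : ∀ n, S.rect n (y n) ⊆
      Metric.closedBall (fun i => S.b n (y n i) + S.w n / 2) (S.w n / 2) := by
    intro n z hz
    rw [Metric.mem_closedBall, dist_pi_le_iff (by linarith [S.w_pos n])]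
    intro i
    have := hz i (mem_univ i)
    simp only [lev, mem_Ico] at this
    rw [Real.dist_eq, abs_le]
    constructor <;> linarith [this.1, this.2]
  have hδ : Tendsto (fun n => S.w n / 2) atTop (nhdsWithin 0 (Ioi 0)) := by
    rw [tendsto_nhdsWithin_iff]
    refine ⟨by simpa using S.w_tendsto.div_const 2, Eventually.of_forall fun n => ?_⟩
    exact half_pos (S.w_pos n)
  have hlim := hx (fun n i => S.b n (y n i) + S.w n / 2) (fun n => S.w n / 2) hδ (by
    filter_upwards [hy] with n hn
    rw [one_mul]
    exact hsub n fun i _ => (hn i).1)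
  have hvol : ∀ n, volume (Metric.closedBall (fun i => S.b n (y n i) + S.w n / 2) (S.w n / 2)) =
      S.W n ^ m := by
    intro n
    rw [Real.volume_pi_closedBall _ (by linarith [S.w_pos n]), W,
      mul_div_cancel₀ _ (two_ne_zero' ℝ), Fintype.card_fin, ENNReal.ofReal_pow (S.w_pos n).le]
  filter_upwards [hy, hlim.eventually (lt_mem_nhds
    (ENNReal.sub_lt_self ENNReal.one_ne_top one_ne_zero hε))] with n hn hlt
  refine ⟨y n, fun i => (hn i).2, ?_⟩
  rw [hvol] at hlt
  set B := Metric.closedBall (fun i => S.b n (y n i) + S.w n / 2) (S.w n / 2) with hB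
  have hW0 : S.W n ^ m ≠ 0 := pow_ne_zero _ (W_ne_zero n)
  have hWt : S.W n ^ m ≠ ⊤ := ENNReal.pow_ne_top (W_ne_top n)
  have h1 : (1 - ε) * S.W n ^ m ≤ volume (A' ∩ B) :=
    ENNReal.mul_le_of_le_div hlt.le
  rw [μpi_eq, Measure.restrict_apply ((measurableSet_rect n _).diff hA)]
  calc volume (S.rect n (y n) \ A ∩ univ.pi fun _ => S.X) ≤ volume (B \ (A' ∩ B)) := by
        refine measure_mono ?_
        rintro z ⟨⟨hz, hzA⟩, -⟩
        exact ⟨hsub n hz, fun h => hzA h.1.1⟩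
    _ = volume B - volume (A' ∩ B) := by
        refine measure_sdiff inter_subset_right
          (hA'm.inter Metric.isClosed_closedBall.measurableSet).nullMeasurableSet ?_
        exact ne_top_of_le_ne_top (by rw [hvol]; exact hWt) (measure_mono inter_subset_right)
    _ ≤ S.W n ^ m - (1 - ε) * S.W n ^ m := by rw [hvol]; exact tsub_le_tsub_left h1 _
    _ ≤ ε * S.W n ^ m := by
        rw [tsub_le_iff_right, ← add_mul]
        calc S.W n ^ m = 1 * S.W n ^ m := (one_mul _).symm
          _ ≤ _ := by gcongr; exact le_add_tsub

/-! ### Rigidity -/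

/-- The part of a level that lies in the first `q` copies of the column. -/
def core (S : StackSystem) (q n i : ℕ) : Set ℝ :=
  ⋃ c ∈ Finset.range q, S.lev (n + 1) (S.pos n c + i)

lemma measurableSet_core (q n i : ℕ) : MeasurableSet (S.core q n i) :=
  Finset.measurableSet_biUnion _ fun _ _ => measurableSet_lev _ _

lemma core_subset {q n i : ℕ} (hq : q ≤ S.r n) (hi : i < S.h n) : S.core q n i ⊆ S.lev n i := by
  refine iUnion₂_subset fun c hc => lev_succ_subset ?_ hi
  exact (Finset.mem_range.1 hc).trans_le hq

lemma μ_core {q n i : ℕ} (hq : q ≤ S.r n) (hi : i < S.h n) :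
    S.μ (S.core q n i) = q * S.W (n + 1) := by
  rw [core, measure_biUnion_finset]
  · rw [Finset.sum_congr rfl fun c hc =>
      μ_apply (pos_add_lt ((Finset.mem_range.1 hc).trans_le hq) hi)]
    simp
  · intro c hc c' hc' hne
    simp only [Finset.coe_range, mem_Iio] at hc hc'
    exact disjoint_lev_succ (hc.trans_le hq) (hc'.trans_le hq) hi hne
  · exact fun c _ => measurableSet_lev _ _

lemma μ_core' {q n i : ℕ} (hq : q ≤ S.r n) (hi : i < S.h n) :
    S.μ (S.core q n i) = (q / S.r n : ℝ≥0∞) * S.W n := by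
  have h0 : (S.r n : ℝ≥0∞) ≠ 0 := by exact_mod_cast (r_pos n).ne'
  rw [μ_core hq hi, W_succ n, ← mul_assoc, ENNReal.div_mul_cancel h0 (ENNReal.natCast_ne_top _)]

/-- The time `a` moves each of the first `q` copies onto the next copy. -/
lemma core_subset_preimage {q n i a : ℕ}
    (hq : ∀ c < q, c + 1 < S.r n ∧ S.pos n (c + 1) = S.pos n c + a) (hi : i < S.h n) :
    S.core q n i ⊆ S.T^[a] ⁻¹' S.lev n i := by
  refine iUnion₂_subset fun c hc x hx => ?_
  obtain ⟨h1, h2⟩ := hq c (Finset.mem_range.1 hc)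
  have h3 := pos_add_lt h1 hi
  have heq : S.pos n (c + 1) + i = S.pos n c + i + a := by omega
  refine lev_succ_subset h1 hi ?_
  rw [heq]
  exact iterate_mem_lev (by omega) hx

/-- The proportion `q n / r n` of every level returns to that level at time `a n`. Approximating `A`
by levels gives the liminf bound with constant `1`, the three thirds of `δ` paying for replacing `A`
by `V` and back. -/
lemma partiallyRigid {q a : ℕ → ℕ} (hqr : ∀ n, q n ≤ S.r n)
    (hq : ∀ n, ∀ c < q n, c + 1 < S.r n ∧ S.pos n (c + 1) = S.pos n c + a n)
    (hlim : Tendsto (fun n => (q n / S.r n : ℝ≥0∞)) atTop (nhds 1)) (ha : StrictMono a) :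
    PartiallyRigid S.T S.μ := by
  refine ⟨1, one_pos, a, ha, fun A hA hfin => ?_⟩
  rw [one_mul]
  refine le_of_forall_lt fun b hb => ?_
  obtain ⟨b', hbb', hb'⟩ := exists_between hb
  refine hbb'.trans_le ?_
  obtain ⟨δ, hδ, hbδ⟩ := ENNReal.lt_iff_exists_add_pos_lt.1 hb'
  have hδ3 : (0 : ℝ≥0∞) < δ / 3 := ENNReal.div_pos (by exact_mod_cast hδ.ne') (by norm_num)
  have hmul : Tendsto (fun n => (q n / S.r n : ℝ≥0∞) * S.μ A) atTop (nhds (S.μ A)) := by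
    have := ENNReal.Tendsto.mul_const hlim (b := S.μ A) (Or.inr hfin)
    rwa [one_mul] at this
  refine le_liminf_of_le (by isBoundedDefault) ?_
  filter_upwards [exists_finset_approx hA hfin hδ3, hmul.eventually (lt_mem_nhds hbδ)]
    with n ⟨J, hJ, happ⟩ hn
  set V := ⋃ i ∈ J, S.lev n i with hV
  have hVm : MeasurableSet V := Finset.measurableSet_biUnion _ fun i _ => measurableSet_lev n i
  have hTm : Measurable (S.T^[a n]) := measurable_T.iterate _
  have hTp := measurePreserving_T (S := S) |>.iterate (a n)
  have hVeq : S.μ V = J.card * S.W n := by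
    rw [hV, measure_biUnion_finset]
    · rw [Finset.sum_congr rfl fun i hi => μ_apply (Finset.mem_range.1 (hJ hi))]
      simp
    · intro i hi j hj hij
      exact disjoint_lev (Finset.mem_range.1 (hJ hi)) (Finset.mem_range.1 (hJ hj)) hij
    · exact fun i _ => measurableSet_lev n i
  have hcore : (q n / S.r n : ℝ≥0∞) * S.μ V ≤ S.μ (S.T^[a n] ⁻¹' V ∩ V) := by
    calc (q n / S.r n : ℝ≥0∞) * S.μ V = ∑ i ∈ J, S.μ (S.core (q n) n i) := by
          rw [Finset.sum_congr rfl fun i hi => μ_core' (hqr n) (Finset.mem_range.1 (hJ hi)), hVeq]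
          simp; ring
      _ = S.μ (⋃ i ∈ J, S.core (q n) n i) := by
          rw [measure_biUnion_finset]
          · intro i hi j hj hij
            have hi' := Finset.mem_range.1 (hJ hi)
            have hj' := Finset.mem_range.1 (hJ hj)
            exact (disjoint_lev hi' hj' hij).mono (core_subset (hqr n) hi')
              (core_subset (hqr n) hj')
          · exact fun i _ => measurableSet_core _ _ _
      _ ≤ _ := by
          refine measure_mono (iUnion₂_subset fun i hi x hx => ⟨?_, ?_⟩)
          · exact mem_iUnion₂.2 ⟨i, hi,
              core_subset_preimage (hq n) (Finset.mem_range.1 (hJ hi)) hx⟩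
          · exact mem_iUnion₂.2 ⟨i, hi, core_subset (hqr n) (Finset.mem_range.1 (hJ hi)) hx⟩
  have hratio : (q n / S.r n : ℝ≥0∞) ≤ 1 := by
    refine ENNReal.div_le_of_le_mul ?_
    rw [one_mul]
    exact_mod_cast hqr n
  have h3 : δ / 3 + δ / 3 + δ / 3 = (δ : ℝ≥0∞) := ENNReal.add_thirds _
  have hfinal : b' + δ ≤ S.μ (S.T^[a n] ⁻¹' A ∩ A) + δ := by
    calc b' + δ ≤ (q n / S.r n : ℝ≥0∞) * S.μ A := hn.le
      _ ≤ (q n / S.r n : ℝ≥0∞) * (S.μ V + δ / 3) := by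
          gcongr
          calc S.μ A ≤ S.μ (V ∪ symmDiff A V) := measure_mono fun x hx => by
                by_cases hxV : x ∈ V
                · exact Or.inl hxV
                · exact Or.inr (Or.inl ⟨hx, hxV⟩)
            _ ≤ S.μ V + S.μ (symmDiff A V) := measure_union_le _ _
            _ ≤ _ := by gcongr
      _ ≤ S.μ (S.T^[a n] ⁻¹' V ∩ V) + δ / 3 := by
          rw [mul_add]
          exact add_le_add hcore (mul_le_of_le_one_left' hratio)
      _ ≤ (S.μ (S.T^[a n] ⁻¹' A ∩ A) + δ / 3 + δ / 3) + δ / 3 := by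
          gcongr
          calc S.μ (S.T^[a n] ⁻¹' V ∩ V) ≤ S.μ ((S.T^[a n] ⁻¹' A ∩ A) ∪
                  (S.T^[a n] ⁻¹' symmDiff A V) ∪ symmDiff A V) := measure_mono fun x hx => by
                by_cases hxA : x ∈ A
                · by_cases hxT : S.T^[a n] x ∈ A
                  · exact Or.inl (Or.inl ⟨hxT, hxA⟩)
                  · exact Or.inl (Or.inr (Or.inr ⟨hx.1, hxT⟩))
                · exact Or.inr (Or.inr ⟨hx.2, hxA⟩)
            _ ≤ S.μ (S.T^[a n] ⁻¹' A ∩ A) + S.μ (S.T^[a n] ⁻¹' symmDiff A V) +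
                  S.μ (symmDiff A V) :=
                (measure_union_le _ _).trans (by gcongr; exact measure_union_le _ _)
            _ ≤ _ := by
                rw [hTp.measure_preimage (hA.symmDiff hVm).nullMeasurableSet]
                gcongr
      _ = S.μ (S.T^[a n] ⁻¹' A ∩ A) + δ := by rw [add_assoc, add_assoc, ← add_assoc (_ / _), h3]
  exact (ENNReal.add_le_add_iff_right ENNReal.coe_ne_top).1 hfinal

/-- Take a product `R` of levels of which `A` misses at most a quarter. More than half of `R`
returns to `R` at time `a n`. If no point of `A` returned to `A`, each of these points would be
outside `A` now or at time `a n`, which accounts for at most half of `R`. -/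
lemma hasInfiniteConservativeIndex {q a : ℕ → ℕ} (hqr : ∀ n, q n ≤ S.r n)
    (hq : ∀ n, ∀ c < q n, c + 1 < S.r n ∧ S.pos n (c + 1) = S.pos n c + a n)
    (hlim : Tendsto (fun n => (q n / S.r n : ℝ≥0∞)) atTop (nhds 1)) (ha : StrictMono a) :
    HasInfiniteConservativeIndex S.T S.μ := by
  intro m _
  change Conservative (prodPow S.T m) (S.μpi m)
  refine ⟨measurePreserving_prodPow.quasiMeasurePreserving, fun A hA hpos => ?_⟩
  have hpow : Tendsto (fun n => (q n / S.r n : ℝ≥0∞) ^ m) atTop (nhds 1) := by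
    have := ENNReal.Tendsto.pow (n := m) hlim
    rwa [one_pow] at this
  have h4 : (4 : ℝ≥0∞)⁻¹ ≠ 0 := by simp
  have h12 : (4 : ℝ≥0∞)⁻¹ + 4⁻¹ < 1 := by
    rw [← two_mul, ← div_eq_mul_inv, ENNReal.div_lt_iff] <;> norm_num
  obtain ⟨n, ⟨y, hy, hyA⟩, hn, hn1⟩ := ((exists_rect_density hA hpos h4).and
    ((hpow.eventually (lt_mem_nhds h12)).and (eventually_ge_atTop 1))).exists
  have hane : a n ≠ 0 := by have := ha.id_le n; simp at this; omega
  by_contra hcon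
  push Not at hcon
  set R := S.rect n y with hR
  let R₀ : Set (Fin m → ℝ) := univ.pi fun i => S.core (q n) n (y i)
  have hTp := (measurePreserving_prodPow (S := S) (m := m)).iterate (a n)
  have hcov : R₀ ⊆ (R \ A) ∪ (prodPow S.T m)^[a n] ⁻¹' (R \ A) := by
    intro x hx
    have hxR : x ∈ R := fun i hi => core_subset (hqr n) (hy i) (hx i hi)
    by_cases hxA : x ∈ A
    · refine Or.inr ⟨fun i hi => ?_, hcon x hxA _ hane⟩
      rw [prodPow_iterate]
      exact core_subset_preimage (hq n) (hy i) (hx i hi)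
    · exact Or.inl ⟨hxR, hxA⟩
  have hmeas : S.μpi m R₀ = (q n / S.r n : ℝ≥0∞) ^ m * S.W n ^ m := by
    rw [μpi, Measure.pi_pi]
    simp [μ_core' (hqr n) (hy _), mul_pow]
  have hle : (q n / S.r n : ℝ≥0∞) ^ m * S.W n ^ m ≤ (4⁻¹ + 4⁻¹) * S.W n ^ m := by
    rw [← hmeas, add_mul]
    refine (measure_mono hcov).trans ((measure_union_le _ _).trans ?_)
    rw [hTp.measure_preimage ((measurableSet_rect n y).diff hA).nullMeasurableSet]
    exact add_le_add hyA hyA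
  refine absurd hle (not_le.2 ?_)
  exact (ENNReal.mul_lt_mul_iff_left (pow_ne_zero _ (W_ne_zero n))
    (ENNReal.pow_ne_top (W_ne_top n))).2 hn

end StackSystem

namespace StackSystem

open ColumnSystem

variable {S : StackSystem} {m : ℕ}

/-! ### Ergodic products -/

/-- The copies of the `n`-th column in the next one, for a product of levels. -/
def copies (S : StackSystem) (m n : ℕ) : Finset (Fin m → ℕ) :=
  Fintype.piFinset fun _ => Finset.range (S.r n)

lemma mem_copies {n : ℕ} {c : Fin m → ℕ} : c ∈ S.copies m n ↔ ∀ i, c i < S.r n := by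
  simp [copies]

lemma card_copies (n : ℕ) : (S.copies m n).card = S.r n ^ m := by
  simp [copies]

lemma measure_rect_inter {n : ℕ} {y : Fin m → ℕ} (hy : ∀ i, y i < S.h n) {s : Set (Fin m → ℝ)}
    (hs : MeasurableSet s) : S.μpi m (S.rect n y ∩ s) =
      ∑ c ∈ S.copies m n, S.μpi m (S.rect (n + 1) (fun i => S.pos n (c i) + y i) ∩ s) := by
  have hcov : S.rect n y = ⋃ c ∈ S.copies m n, S.rect (n + 1) (fun i => S.pos n (c i) + y i) := by
    ext x
    simp only [mem_iUnion, exists_prop, mem_copies]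
    constructor
    · intro hx
      choose c hc hxc using fun i => exists_lev_succ (hy i) (hx i (mem_univ i))
      exact ⟨c, hc, fun i _ => hxc i⟩
    · rintro ⟨c, hc, hx⟩ i hi
      exact lev_succ_subset (hc i) (hy i) (hx i hi)
  rw [hcov, iUnion₂_inter, measure_biUnion_finset]
  · intro c hc c' hc' hne
    obtain ⟨i, hi⟩ := Function.ne_iff.1 hne
    refine Set.disjoint_left.2 fun x hx hx' => ?_
    exact Set.disjoint_left.1 (disjoint_lev_succ (mem_copies.1 hc i) (mem_copies.1 hc' i) (hy i) hi)
      (hx.1 i (mem_univ i)) (hx'.1 i (mem_univ i))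
  · exact fun c _ => (measurableSet_rect _ _).inter hs

lemma measure_rect_inter_shift {n t : ℕ} {y : Fin m → ℕ} (hy : ∀ i, y i + t < S.h n)
    {s : Set (Fin m → ℝ)} (hs : MeasurableSet s) (hinv : prodPow S.T m ⁻¹' s = s) :
    S.μpi m (S.rect n (fun i => y i + t) ∩ s) = S.μpi m (S.rect n y ∩ s) := by
  have hpre : (prodPow S.T m)^[t] ⁻¹' (S.rect n (fun i => y i + t) ∩ s) = S.rect n y ∩ s := by
    have hs' : (prodPow S.T m)^[t] ⁻¹' s = s := by
      rw [Set.preimage_iterate_eq]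
      exact Function.iterate_fixed hinv t
    rw [preimage_inter, hs']
    congr 1
    ext x
    simp only [mem_preimage, prodPow_iterate, rect, mem_univ_pi]
    exact forall_congr' fun i => iterate_mem_lev_iff (hy i)
  rw [← hpre, ((measurePreserving_prodPow (S := S)).iterate t).measure_preimage
    ((measurableSet_rect _ _).inter hs).nullMeasurableSet]

/-- At stage `n` a translation carries one copy of the levels `a` to another copy of the levels `b`,
in all coordinates at once. -/
def Connects (S : StackSystem) (n : ℕ) (a b : Fin m → ℕ) : Prop :=
  ∃ e ∈ S.copies m n, ∃ f ∈ S.copies m n, e ≠ f ∧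
    ∃ t, ∀ i, S.pos n (e i) + a i + t = S.pos n (f i) + b i

/-- This bounds from below the defect `D`, the measure of `sᶜ` in the first product plus that of `s`
in the second. Split both products according to the copies `c` in column `n + 1`. A connected pair
`e`, `f` satisfies `D e + D f ≥ W (n + 1) ^ m`, and the induction hypothesis applies to the other `r
^ m - 2` copies, which explains the factor `κ = 1 - 2 / r ^ m`. The common offset `o` cancels in the
connecting relation, so the same `a` and `b` serve at all later stages; `κ = 1` stands for a step
that is not used. -/
lemma pow_W_le_of_connects {s : Set (Fin m → ℝ)} (hs : MeasurableSet s)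
    (hinv : prodPow S.T m ⁻¹' s = s) {a b : Fin m → ℕ} {κ : ℕ → ℝ≥0∞} (K : ℕ) :
    ∀ (n : ℕ) (o : Fin m → ℕ), (∀ i, o i + a i < S.h n) → (∀ i, o i + b i < S.h n) →
      (∀ l, n ≤ l → κ l = 1 ∨ (S.Connects l a b ∧ κ l * (S.r l ^ m : ℕ) + 2 = (S.r l ^ m : ℕ))) →
      S.W n ^ m ≤ 2 * (S.μpi m (S.rect n (fun i => o i + a i) ∩ sᶜ) +
        S.μpi m (S.rect n (fun i => o i + b i) ∩ s)) +
          S.W n ^ m * ∏ l ∈ Finset.range K, κ (n + l) := by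
  classical
  induction K with
  | zero => intro n o _ _ _; simp
  | succ K ih =>
    intro n o ha hb hκ
    let D : (Fin m → ℕ) → ℝ≥0∞ := fun c =>
      S.μpi m (S.rect (n + 1) (fun i => S.pos n (c i) + o i + a i) ∩ sᶜ) +
        S.μpi m (S.rect (n + 1) (fun i => S.pos n (c i) + o i + b i) ∩ s)
    have hsum : S.μpi m (S.rect n (fun i => o i + a i) ∩ sᶜ) +
        S.μpi m (S.rect n (fun i => o i + b i) ∩ s) = ∑ c ∈ S.copies m n, D c := by
      rw [measure_rect_inter ha hs.compl, measure_rect_inter hb hs, ← Finset.sum_add_distrib]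
      simp only [D, add_assoc]
    set P := ∏ l ∈ Finset.range K, κ (n + 1 + l) with hP
    have hprod : ∏ l ∈ Finset.range (K + 1), κ (n + l) = κ n * P := by
      rw [Finset.prod_range_succ', mul_comm, hP]
      simp only [add_zero, add_assoc, add_comm 1]
    have hD : ∀ c ∈ S.copies m n, S.W (n + 1) ^ m ≤ 2 * D c + S.W (n + 1) ^ m * P := by
      intro c hc
      rw [mem_copies] at hc
      refine ih (n + 1) (fun i => S.pos n (c i) + o i) (fun i => ?_) (fun i => ?_)
        fun l hl => hκ l (by omega)
      · rw [add_assoc]; exact pos_add_lt (hc i) (ha i)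
      · rw [add_assoc]; exact pos_add_lt (hc i) (hb i)
    have hWn : S.W n ^ m = (S.r n ^ m : ℕ) * S.W (n + 1) ^ m := by
      rw [W_succ n, mul_pow]; push_cast; rfl
    rw [hsum, hprod]
    rcases hκ n le_rfl with h1 | ⟨⟨e, he, f, hf, hef, t, ht⟩, h2⟩
    · rw [h1, one_mul]
      calc S.W n ^ m = ∑ c ∈ S.copies m n, S.W (n + 1) ^ m := by
            rw [Finset.sum_const, card_copies, nsmul_eq_mul, hWn]
        _ ≤ ∑ c ∈ S.copies m n, (2 * D c + S.W (n + 1) ^ m * P) := Finset.sum_le_sum hD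
        _ = _ := by
            rw [Finset.sum_add_distrib, ← Finset.mul_sum, Finset.sum_const, card_copies,
              nsmul_eq_mul, hWn, mul_assoc]
    · have hfe : f ∈ (S.copies m n).erase e := Finset.mem_erase.2 ⟨hef.symm, hf⟩
      set C := ((S.copies m n).erase e).erase f with hC
      have hcard : (C.card : ℝ≥0∞) = κ n * (S.r n ^ m : ℕ) := by
        have h3 : C.card + 2 = S.r n ^ m := by
          rw [← card_copies (S := S) (m := m) n, ← Finset.card_erase_add_one he,
            ← Finset.card_erase_add_one hfe]
        have h4 : (C.card : ℝ≥0∞) + 2 = κ n * (S.r n ^ m : ℕ) + 2 := by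
          rw [h2, ← h3]; push_cast; rfl
        exact (ENNReal.add_left_inj (by norm_num)).1 h4
      -- The translation by `t` carries the first product in copy `e` onto the second in copy `f`.
      -- By invariance `s` has the same measure in both, so what is missing from the defect at `e`
      -- appears in the defect at `f`.
      have hDef : S.W (n + 1) ^ m ≤ D e + D f := by
        rw [mem_copies] at he hf
        have hea : ∀ i, S.pos n (e i) + o i + a i < S.h (n + 1) := fun i => by
          rw [add_assoc]; exact pos_add_lt (he i) (ha i)
        have hfb : ∀ i, S.pos n (f i) + o i + b i < S.h (n + 1) := fun i => by
          rw [add_assoc]; exact pos_add_lt (hf i) (hb i)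
        have heq : (fun i => S.pos n (f i) + o i + b i) =
            fun i => S.pos n (e i) + o i + a i + t := by
          funext i; have := ht i; omega
        calc S.W (n + 1) ^ m
            = S.μpi m (S.rect (n + 1) (fun i => S.pos n (e i) + o i + a i)) :=
              (μpi_rect hea).symm
          _ ≤ S.μpi m (S.rect (n + 1) (fun i => S.pos n (e i) + o i + a i) ∩ sᶜ) +
              S.μpi m (S.rect (n + 1) (fun i => S.pos n (e i) + o i + a i) ∩ s) := by
              rw [← sdiff_eq, add_comm (S.μpi m (_ \ s)), measure_inter_add_sdiff _ hs]
          _ ≤ D e + D f := by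
              refine add_le_add le_self_add ?_
              rw [← measure_rect_inter_shift (t := t) _ hs hinv, ← heq]
              · exact le_add_self
              · intro i
                have := congrFun heq i
                rw [← this]
                exact hfb i
      calc S.W n ^ m = ∑ c ∈ S.copies m n, S.W (n + 1) ^ m := by
            rw [Finset.sum_const, card_copies, nsmul_eq_mul, hWn]
        _ = 2 * S.W (n + 1) ^ m + ∑ c ∈ C, S.W (n + 1) ^ m := by
            rw [← Finset.add_sum_erase _ _ he, ← Finset.add_sum_erase _ _ hfe, two_mul, add_assoc]
        _ ≤ 2 * (D e + D f) + ∑ c ∈ C, (2 * D c + S.W (n + 1) ^ m * P) := by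
            gcongr with c hc
            exact hD c (Finset.mem_of_mem_erase (Finset.mem_of_mem_erase hc))
        _ = 2 * ∑ c ∈ S.copies m n, D c + C.card * (S.W (n + 1) ^ m * P) := by
            rw [Finset.sum_add_distrib, ← Finset.mul_sum, Finset.sum_const, nsmul_eq_mul,
              ← Finset.add_sum_erase _ D he, ← Finset.add_sum_erase _ D hfe]
            ring
        _ = _ := by rw [hcard, hWn]; ring

/-- If `s` and `sᶜ` were both non-null, each would fill all but an eighth of some product of levels
of a common column. Twice the defect would then be at most half of `W n ^ m`, while the vanishing
infinite product forces it to be at least `W n ^ m`. -/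
lemma ergodic_prodPow
    (hcon : ∀ (n : ℕ) (a b : Fin m → ℕ), (∀ i, a i < S.h n) → (∀ i, b i < S.h n) →
      ∃ κ : ℕ → ℝ≥0∞, (∀ l, n ≤ l → κ l = 1 ∨
        (S.Connects l a b ∧ κ l * (S.r l ^ m : ℕ) + 2 = (S.r l ^ m : ℕ))) ∧
        Tendsto (fun K => ∏ l ∈ Finset.range K, κ (n + l)) atTop (nhds 0)) :
    Ergodic (prodPow S.T m) (S.μpi m) := by
  refine ⟨measurePreserving_prodPow, ⟨fun s hs hinv => ?_⟩⟩
  by_contra hcst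
  rw [eventuallyConst_set', not_or] at hcst
  have hs0 : S.μpi m s ≠ 0 := fun h => hcst.1 (ae_eq_empty.2 h)
  have hs1 : S.μpi m sᶜ ≠ 0 := fun h => hcst.2 (ae_eq_univ.2 h)
  have h8 : (8 : ℝ≥0∞)⁻¹ ≠ 0 := by simp
  obtain ⟨n, ⟨a, ha, hda⟩, ⟨b, hb, hdb⟩⟩ :=
    ((exists_rect_density hs hs0 h8).and (exists_rect_density hs.compl hs1 h8)).exists
  obtain ⟨κ, hκ, hlim⟩ := hcon n a b ha hb
  have hle := fun K => pow_W_le_of_connects hs hinv (a := a) (b := b) (κ := κ) K n (fun _ => 0)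
    (by simpa using ha) (by simpa using hb) hκ
  simp only [zero_add] at hle
  have hWt : S.W n ^ m ≠ ⊤ := ENNReal.pow_ne_top (W_ne_top n)
  have hlim' := ENNReal.Tendsto.const_mul hlim (a := S.W n ^ m) (Or.inr hWt)
  rw [mul_zero] at hlim'
  have hfin := ge_of_tendsto' (hlim'.const_add _) hle
  rw [add_zero] at hfin
  rw [sdiff_eq] at hda hdb
  rw [compl_compl] at hdb
  have : S.W n ^ m ≤ 2⁻¹ * S.W n ^ m := by
    calc S.W n ^ m ≤ _ := hfin
      _ ≤ 2 * (8⁻¹ * S.W n ^ m + 8⁻¹ * S.W n ^ m) := by gcongr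
      _ = (4 * 8⁻¹) * S.W n ^ m := by ring
      _ = 2⁻¹ * S.W n ^ m := by
          congr 1
          rw [show (8 : ℝ≥0∞) = 4 * 2 by norm_num, ENNReal.mul_inv (by norm_num) (by norm_num),
            ← mul_assoc, ENNReal.mul_inv_cancel (by norm_num) (by norm_num), one_mul]
  refine absurd this (not_le.2 ?_)
  conv_rhs => rw [← one_mul (S.W n ^ m)]
  exact (ENNReal.mul_lt_mul_iff_left (pow_ne_zero _ (W_ne_zero n)) hWt).2 (by simp)

/-! ### Products that are not ergodic -/

/-- The part of the `n`-th column that lies in copies with index at least `q`. -/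
def tail (S : StackSystem) (q n : ℕ) : Set ℝ :=
  ⋃ j ∈ Finset.range (S.h n), ⋃ c ∈ Finset.Ico q (S.r n), S.lev (n + 1) (S.pos n c + j)

lemma mem_tail {q n : ℕ} {x : ℝ} :
    x ∈ S.tail q n ↔ ∃ j < S.h n, ∃ c, q ≤ c ∧ c < S.r n ∧ x ∈ S.lev (n + 1) (S.pos n c + j) := by
  simp only [tail, mem_iUnion, Finset.mem_range, Finset.mem_Ico, exists_prop, and_assoc]

/-- Inside a level of column `n` the tail occupies `r n - q` of the `r n` copies. A level of an
earlier column is a disjoint union of levels of column `n`, so the proportion is at most the same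
there. -/
lemma μ_lev_inter_tail_le {q n : ℕ} (k : ℕ) : ∀ {n₀ i : ℕ}, n₀ + k = n → i < S.h n₀ →
    S.μ (S.lev n₀ i ∩ S.tail q n) ≤ ((S.r n - q : ℕ) / S.r n : ℝ≥0∞) * S.W n₀ := by
  have hr0 : (S.r n : ℝ≥0∞) ≠ 0 := by exact_mod_cast (r_pos n).ne'
  induction k with
  | zero =>
    rintro n₀ i rfl hi
    calc S.μ (S.lev n₀ i ∩ S.tail q n₀)
        ≤ S.μ (⋃ c ∈ Finset.Ico q (S.r n₀), S.lev (n₀ + 1) (S.pos n₀ c + i)) := by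
          refine measure_mono fun x hx => ?_
          obtain ⟨j, hj, c, hqc, hc, hxc⟩ := mem_tail.1 hx.2
          obtain rfl := lev_unique hi hj hx.1 (lev_succ_subset hc hj hxc)
          exact mem_iUnion₂.2 ⟨c, Finset.mem_Ico.2 ⟨hqc, hc⟩, hxc⟩
      _ ≤ ∑ c ∈ Finset.Ico q (S.r n₀), S.μ (S.lev (n₀ + 1) (S.pos n₀ c + i)) :=
          measure_biUnion_finset_le _ _
      _ = (S.r n₀ - q : ℕ) * S.W (n₀ + 1) := by
          rw [Finset.sum_congr rfl fun c hc => μ_apply (pos_add_lt (Finset.mem_Ico.1 hc).2 hi)]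
          simp
      _ = _ := by
          rw [W_succ n₀, ← mul_assoc]
          congr 1
          exact (ENNReal.div_mul_cancel hr0 (ENNReal.natCast_ne_top _)).symm
  | succ k ih =>
    intro n₀ i hn hi
    rw [lev_eq_iUnion hi, iUnion₂_inter]
    calc S.μ (⋃ c ∈ Finset.range (S.r n₀), S.lev (n₀ + 1) (S.pos n₀ c + i) ∩ S.tail q n)
        ≤ ∑ c ∈ Finset.range (S.r n₀), S.μ (S.lev (n₀ + 1) (S.pos n₀ c + i) ∩ S.tail q n) :=
          measure_biUnion_finset_le _ _
      _ ≤ ∑ c ∈ Finset.range (S.r n₀), ((S.r n - q : ℕ) / S.r n : ℝ≥0∞) * S.W (n₀ + 1) :=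
          Finset.sum_le_sum fun c hc =>
            ih (by omega) (pos_add_lt (Finset.mem_range.1 hc) hi)
      _ = _ := by rw [Finset.sum_const, Finset.card_range, nsmul_eq_mul, W_succ n₀]; ring

/-- Choose `n₁` so late that no coordinate reaches the top within `N` steps: there every height
changes by exactly `N`. Now descend to `n₀`. The height change in column `n + 1` is a difference of
copy positions plus a height change in column `n` of modulus less than `h n`. Two such position
differences therefore differ by less than `2 * h n`, and a coordinate outside the tail makes them
equal by `hsep`. -/
lemma sub_height_eq {q : ℕ → ℕ} (hsep : ∀ n c c' e e', c < q n → c < S.r n → c' < S.r n →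
      e < S.r n → e' < S.r n → (S.pos n c' : ℤ) - S.pos n c ≠ S.pos n e' - S.pos n e →
      2 * (S.h n : ℤ) ≤ |((S.pos n c' : ℤ) - S.pos n c) - (S.pos n e' - S.pos n e)|)
    {x : Fin m → ℝ} {N n₀ : ℕ} (hx : ∀ n, n₀ ≤ n → ∃ i, x i ∉ S.tail (q n) n)
    (hX : ∀ i, x i ∈ S.X) {y y' : Fin m → ℕ} (hy : ∀ i, y i < S.h n₀) (hy' : ∀ i, y' i < S.h n₀)
    (hxy : x ∈ S.rect n₀ y) (hxy' : (prodPow S.T m)^[N] x ∈ S.rect n₀ y') (i j : Fin m) :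
    (y' i : ℤ) - y i = y' j - y j := by
  have hev : ∀ i, ∀ᶠ n in atTop, ∃ H, x i ∈ S.lev n H ∧ H + N < S.h n :=
    fun i => eventually_mem_lev (hX i) N
  obtain ⟨n₁, hn₁, hle⟩ := ((eventually_all.2 hev).and (eventually_ge_atTop n₀)).exists
  choose H hH hHN using hn₁
  have key : ∀ k n, n + k = n₁ → n₀ ≤ n → ∀ H H' : Fin m → ℕ, (∀ i, H i < S.h n) → (∀ i, H' i < S.h n) →
      (∀ i, x i ∈ S.lev n (H i)) → (∀ i, S.T^[N] (x i) ∈ S.lev n (H' i)) →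
      ∀ i j, (H' i : ℤ) - H i = H' j - H j := by
    intro k
    induction k with
    | zero =>
      intro n hn _ G G' hG hG' hxG hxG'
      rw [add_zero] at hn
      subst hn
      have : ∀ i, G' i = G i + N := by
        intro i
        obtain h1 := lev_unique (hG i) (by have := hHN i; omega) (hxG i) (hH i)
        refine lev_unique (hG' i) ?_ (hxG' i) (iterate_mem_lev ?_ (hxG i)) <;>
          · rw [h1]; exact hHN i
      intro i j
      rw [this i, this j]; push_cast; ring
    | succ k ih =>
      intro n hn hn₀ G G' hG hG' hxG hxG'
      choose c hc hxc using fun i => exists_lev_succ (hG i) (hxG i)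
      choose c' hc' hxc' using fun i => exists_lev_succ (hG' i) (hxG' i)
      have hI := ih (n + 1) (by omega) (by omega) _ _ (fun i => pos_add_lt (hc i) (hG i))
        (fun i => pos_add_lt (hc' i) (hG' i)) hxc hxc'
      obtain ⟨i₀, hi₀⟩ := hx n hn₀
      have hq : c i₀ < q n := by
        by_contra hge
        exact hi₀ (mem_tail.2 ⟨_, hG i₀, c i₀, not_lt.1 hge, hc i₀, hxc i₀⟩)
      have hall : ∀ j, (G' j : ℤ) - G j = G' i₀ - G i₀ := by
        intro j
        have h1 := hI i₀ j
        push_cast at h1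
        by_cases hne : (S.pos n (c' i₀) : ℤ) - S.pos n (c i₀) = S.pos n (c' j) - S.pos n (c j)
        · linarith
        · have h2 := hsep n _ _ _ _ hq (hc i₀) (hc' i₀) (hc j) (hc' j) hne
          have b1 := hG i₀
          have b2 := hG' i₀
          have b3 := hG j
          have b4 := hG' j
          rcases abs_cases (((S.pos n (c' i₀) : ℤ) - S.pos n (c i₀)) -
            (S.pos n (c' j) - S.pos n (c j))) with h | h <;> omega
      intro i j
      rw [hall i, hall j]
  refine key (n₁ - n₀) n₀ (by omega) le_rfl y y' hy hy' (fun i => hxy i (mem_univ i)) (fun i => ?_) i j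
  have := hxy' i (mem_univ i)
  rwa [prodPow_iterate] at this

/-- `A` consists of the points of the product of bottom levels that never have all coordinates in
the tail. The height changes needed to enter `B` are `1` in one coordinate and `0` in the others, so
orbits from `A` never meet `B`. The sum condition makes `A` non-null. -/
lemma not_ergodic_prodPow {q : ℕ → ℕ}
    (hsep : ∀ n c c' e e', c < q n → c < S.r n → c' < S.r n →
      e < S.r n → e' < S.r n → (S.pos n c' : ℤ) - S.pos n c ≠ S.pos n e' - S.pos n e →
      2 * (S.h n : ℤ) ≤ |((S.pos n c' : ℤ) - S.pos n c) - (S.pos n e' - S.pos n e)|)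
    (hm : 2 ≤ m) (hcons : Conservative (prodPow S.T m) (S.μpi m)) {n₀ : ℕ} (hn₀ : 1 ≤ n₀)
    (hsum : ∑' k, ((S.r (n₀ + k) - q (n₀ + k) : ℕ) / S.r (n₀ + k) : ℝ≥0∞) ^ m < 1) :
    ¬ Ergodic (prodPow S.T m) (S.μpi m) := by
  intro herg
  have hh : 2 ≤ S.h n₀ := by
    have h1 := S.h_pos 0
    have h2 := h_lt_succ (S := S.toColumnSystem) 0
    have h3 := h_strictMono.monotone (f := S.h) hn₀
    simp only [zero_add] at h2
    omega
  let i₀ : Fin m := ⟨0, by omega⟩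
  let i₁ : Fin m := ⟨1, by omega⟩
  let y' : Fin m → ℕ := fun i => if i = i₀ then 1 else 0
  have hy' : ∀ i, y' i < S.h n₀ := by
    intro i
    simp only [y']
    split_ifs <;> omega
  set R := S.rect n₀ (fun _ : Fin m => 0) with hR
  set B := S.rect n₀ y' with hB
  have hy0 : ∀ i : Fin m, (fun _ => 0 : Fin m → ℕ) i < S.h n₀ := fun i => S.h_pos n₀
  let E : ℕ → Set (Fin m → ℝ) := fun k => univ.pi fun _ => S.tail (q (n₀ + k)) (n₀ + k)
  set A := R \ ⋃ k, E k with hA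
  set f := prodPow S.T m with hf
  -- Infinitely many visits, rather than one, make this set exactly invariant. Conservativity puts
  -- almost all of `B` into it, and `A` is disjoint from it.
  let s : Set (Fin m → ℝ) := {x | ∃ᶠ N in atTop, f^[N] x ∈ B}
  have hBm : MeasurableSet B := measurableSet_rect _ _
  have hsm : MeasurableSet s := by
    have : s = limsup (fun N => f^[N] ⁻¹' B) atTop := by
      ext x
      simp [s, mem_limsup_iff_frequently_mem]
    rw [this]
    exact MeasurableSet.measurableSet_limsup fun N =>
      (measurePreserving_prodPow (S := S)).measurable.iterate N hBm
  have hinv : f ⁻¹' s = s := by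
    ext x
    simp only [s, mem_preimage, mem_ofPred_eq, ← Function.iterate_succ_apply]
    conv_rhs => rw [← map_add_atTop_eq_nat 1, frequently_map]
  have hBs : S.μpi m (B \ s) = 0 := by
    have := hcons.ae_mem_imp_frequently_image_mem hBm.nullMeasurableSet
    rw [ae_iff] at this
    convert this using 2
    ext x
    simp [s]
  have hWt : S.W n₀ ^ m ≠ ⊤ := ENNReal.pow_ne_top (W_ne_top n₀)
  have hW0 : S.W n₀ ^ m ≠ 0 := pow_ne_zero _ (W_ne_zero n₀)
  have hB0 : S.μpi m B ≠ 0 := by rw [hB, μpi_rect hy']; exact hW0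
  have hA0 : S.μpi m A ≠ 0 := by
    intro h0
    have hEk : ∀ k, S.μpi m (R ∩ E k) ≤
        ((S.r (n₀ + k) - q (n₀ + k) : ℕ) / S.r (n₀ + k) : ℝ≥0∞) ^ m * S.W n₀ ^ m := by
      intro k
      rw [hR, rect, ← pi_inter_distrib, μpi, Measure.pi_pi, ← mul_pow]
      refine (Finset.prod_le_prod' fun i _ => μ_lev_inter_tail_le k rfl (S.h_pos n₀)).trans ?_
      simp
    have : S.W n₀ ^ m < S.W n₀ ^ m := by
      calc S.W n₀ ^ m = S.μpi m R := (μpi_rect hy0).symm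
        _ ≤ S.μpi m (A ∪ ⋃ k, (R ∩ E k)) := measure_mono fun x hx => by
            by_cases hxE : x ∈ ⋃ k, E k
            · rw [← inter_iUnion]
              exact Or.inr ⟨hx, hxE⟩
            · exact Or.inl ⟨hx, hxE⟩
        _ ≤ S.μpi m A + ∑' k, S.μpi m (R ∩ E k) :=
            (measure_union_le _ _).trans (by gcongr; exact measure_iUnion_le _)
        _ ≤ 0 + ∑' k, ((S.r (n₀ + k) - q (n₀ + k) : ℕ) / S.r (n₀ + k) : ℝ≥0∞) ^ m *
              S.W n₀ ^ m := add_le_add h0.le (ENNReal.tsum_le_tsum hEk)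
        _ = (∑' k, ((S.r (n₀ + k) - q (n₀ + k) : ℕ) / S.r (n₀ + k) : ℝ≥0∞) ^ m) *
              S.W n₀ ^ m := by rw [zero_add, ENNReal.tsum_mul_right]
        _ < 1 * S.W n₀ ^ m := (ENNReal.mul_lt_mul_iff_left hW0 hWt).2 hsum
        _ = _ := one_mul _
    exact lt_irrefl _ this
  have hAs : Disjoint A s := by
    refine Set.disjoint_left.2 fun x hx hxs => ?_
    obtain ⟨N, hN⟩ := Frequently.exists hxs
    have := sub_height_eq hsep (x := x) (N := N) (n₀ := n₀) (fun n hn => ?_)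
      (fun i => lev_subset_X (S.h_pos n₀) (hx.1 i (mem_univ i))) hy0 hy' hx.1 hN i₀ i₁
    · simp [y', i₀, i₁] at this
    · by_contra hcon
      push Not at hcon
      refine hx.2 (mem_iUnion.2 ⟨n - n₀, fun i _ => ?_⟩)
      rw [Nat.add_sub_cancel' hn]
      exact hcon i
  rcases eventuallyConst_set'.1 (herg.toPreErgodic.aeconst_set hsm hinv) with h | h
  · refine hB0 (le_antisymm ?_ zero_le)
    calc S.μpi m B ≤ S.μpi m (B \ s ∪ s) := measure_mono fun x hx => by
          by_cases hxs : x ∈ s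
          · exact Or.inr hxs
          · exact Or.inl ⟨hx, hxs⟩
      _ ≤ S.μpi m (B \ s) + S.μpi m s := measure_union_le _ _
      _ = 0 := by rw [hBs, ae_eq_empty.1 h, add_zero]
  · refine hA0 (le_antisymm ?_ zero_le)
    calc S.μpi m A ≤ S.μpi m sᶜ := measure_mono hAs.subset_compl_right
      _ = 0 := ae_eq_univ.1 h

end StackSystem

/-! ### The coding bound for entropy -/

/-- The entropy of a partition is at most the expected length of a code that satisfies Kraft's
inequality and determines the partition. -/
lemma partitionEntropy_le_integral {α ι κ : Type*} [MeasurableSpace α] [Fintype ι] [Fintype κ]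
    [MeasurableSpace κ] [MeasurableSingletonClass κ] {ν : Measure α} [IsProbabilityMeasure ν]
    {P : α → ι} {Z : α → κ} (hZ : Measurable Z) {f : κ → ι} (hPZ : ∀ᵐ x ∂ν, P x = f (Z x))
    {cost : κ → ℝ} (hcost : ∑ z, Real.exp (-cost z) ≤ 1) :
    partitionEntropy ν P ≤ ∫ x, cost (Z x) ∂ν := by
  classical
  let p : κ → ℝ := fun z => ν.real (Z ⁻¹' {z})
  have hp0 : ∀ z, 0 ≤ p z := fun z => measureReal_nonneg
  have hP : ∀ w, ν.real (P ⁻¹' {w}) = ∑ z ∈ Finset.univ.filter (fun z => f z = w), p z := by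
    intro w
    rw [sum_measureReal_preimage_singleton _ fun z _ => hZ (measurableSet_singleton z)]
    refine measureReal_congr ?_
    filter_upwards [hPZ] with x hx
    have : (x ∈ P ⁻¹' {w}) = (x ∈ Z ⁻¹' ((Finset.univ.filter fun z => f z = w : Finset κ) : Set κ)) := by
      simp [hx]
    exact this
  have hint : ∫ x, cost (Z x) ∂ν = ∑ z, p z * cost z := by
    rw [← integral_map hZ.aemeasurable (measurable_of_finite cost).aestronglyMeasurable,
      integral_fintype]
    · simp only [smul_eq_mul, p, map_measureReal_apply hZ (measurableSet_singleton _)]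
    · have := Measure.isProbabilityMeasure_map (μ := ν) hZ.aemeasurable
      exact Integrable.of_finite
  have hsum1 : ∑ z, p z = 1 := by
    have := sum_measureReal_preimage_singleton (μ := ν) Finset.univ
      fun z (_ : z ∈ Finset.univ) => hZ (measurableSet_singleton z)
    simpa [p] using this
  -- Gibbs' inequality on each fibre of `f`: every cost there is at least `-log (Q w)`, and `log x ≤
  -- x - 1` is applied to the ratio of `Q w` to the probability of the fibre.
  let Q : ι → ℝ := fun w => ∑ z ∈ Finset.univ.filter (fun z => f z = w), Real.exp (-cost z)
  have hle : ∀ w, Real.negMulLog (ν.real (P ⁻¹' {w})) ≤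
      ∑ z ∈ Finset.univ.filter (fun z => f z = w), (p z * cost z + Real.exp (-cost z) - p z) := by
    intro w
    have hPw := hP w
    have hpw0 : 0 ≤ ν.real (P ⁻¹' {w}) := measureReal_nonneg
    generalize ν.real (P ⁻¹' {w}) = pw at hPw hpw0 ⊢
    have hsplit : ∑ z ∈ Finset.univ.filter (fun z => f z = w),
        (p z * cost z + Real.exp (-cost z) - p z) =
        (∑ z ∈ Finset.univ.filter (fun z => f z = w), p z * cost z) + Q w - pw := by
      rw [Finset.sum_sub_distrib, Finset.sum_add_distrib, hPw]
    rw [hsplit]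
    rcases hpw0.eq_or_lt with h0 | h0
    · have hz : ∀ z ∈ Finset.univ.filter (fun z => f z = w), p z = 0 := by
        refine (Finset.sum_eq_zero_iff_of_nonneg fun z _ => hp0 z).1 ?_
        rw [← hPw, ← h0]
      rw [← h0, Finset.sum_eq_zero fun z hz' => by rw [hz z hz', zero_mul]]
      simp only [Real.negMulLog_zero, zero_add, sub_zero]
      exact Finset.sum_nonneg fun z _ => (Real.exp_pos _).le
    · have hne : (Finset.univ.filter (fun z => f z = w)).Nonempty := by
        by_contra hemp
        rw [Finset.not_nonempty_iff_eq_empty] at hemp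
        rw [hPw, hemp, Finset.sum_empty] at h0
        exact lt_irrefl _ h0
      have hQ : 0 < Q w := Finset.sum_pos (fun z _ => Real.exp_pos _) hne
      have h1 : pw * (-Real.log (Q w)) ≤
          ∑ z ∈ Finset.univ.filter (fun z => f z = w), p z * cost z := by
        rw [hPw, Finset.sum_mul]
        refine Finset.sum_le_sum fun z hz => mul_le_mul_of_nonneg_left ?_ (hp0 z)
        have : Real.exp (-cost z) ≤ Q w :=
          Finset.single_le_sum (f := fun z => Real.exp (-cost z))
            (fun z _ => (Real.exp_pos _).le) hz
        have := (Real.le_log_iff_exp_le hQ).2 this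
        linarith
      have h2 : Real.log (Q w / pw) ≤ Q w / pw - 1 := Real.log_le_sub_one_of_pos (by positivity)
      rw [Real.log_div hQ.ne' h0.ne'] at h2
      have h3 := mul_le_mul_of_nonneg_left h2 h0.le
      have h4 : pw * (Q w / pw - 1) = Q w - pw := by field_simp
      rw [h4] at h3
      rw [Real.negMulLog]
      nlinarith
  calc partitionEntropy ν P
      ≤ ∑ w, ∑ z ∈ Finset.univ.filter (fun z => f z = w),
          (p z * cost z + Real.exp (-cost z) - p z) := Finset.sum_le_sum fun w _ => hle w
    _ = ∑ z, (p z * cost z + Real.exp (-cost z) - p z) := Finset.sum_fiberwise _ _ _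
    _ = (∑ z, p z * cost z) + ∑ z, Real.exp (-cost z) - 1 := by
        rw [Finset.sum_sub_distrib, Finset.sum_add_distrib, hsum1]
    _ ≤ _ := by rw [hint]; linarith

/-! ### The induced transformation -/

section Induced

variable {α : Type*} {T : α → α} {F : Set α}

lemma returnTime_spec {x : α} (hx : ∃ n, 0 < n ∧ T^[n] x ∈ F) :
    0 < returnTime T F x ∧ T^[returnTime T F x] x ∈ F :=
  Nat.sInf_mem (s := {n | 0 < n ∧ T^[n] x ∈ F}) hx

lemma notMem_of_lt_returnTime {x : α} {n : ℕ} (hn : 0 < n) (hlt : n < returnTime T F x) :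
    T^[n] x ∉ F := fun h => Nat.notMem_of_lt_sInf hlt ⟨hn, h⟩

lemma returnTime_eq_iff {x : α} {n : ℕ} (hn : 0 < n) : returnTime T F x = n ↔
    T^[n] x ∈ F ∧ ∀ l < n, 0 < l → T^[l] x ∉ F := by
  constructor
  · rintro rfl
    refine ⟨(Nat.sInf_mem (Nat.nonempty_of_pos_sInf hn)).2, fun l hl hl0 => ?_⟩
    exact notMem_of_lt_returnTime hl0 hl
  · rintro ⟨h1, h2⟩
    refine le_antisymm (Nat.sInf_le ⟨hn, h1⟩) ?_
    by_contra hlt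
    have hs := returnTime_spec (T := T) (F := F) ⟨n, hn, h1⟩
    exact h2 _ (not_le.1 hlt) hs.1 hs.2

variable [MeasurableSpace α] {μ : Measure α}

lemma measurable_returnTime (hT : Measurable T) (hF : MeasurableSet F) :
    Measurable (returnTime T F) := by
  have hpos : ∀ n, 0 < n → MeasurableSet (returnTime T F ⁻¹' {n}) := by
    intro n hn
    have : returnTime T F ⁻¹' {n} =
        T^[n] ⁻¹' F ∩ ⋂ l ∈ Finset.range n, {x | 0 < l → T^[l] x ∉ F} := by
      ext x
      simp only [mem_preimage, mem_singleton_iff, returnTime_eq_iff hn, mem_inter_iff, mem_iInter,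
        Finset.mem_range]
      rfl
    rw [this]
    refine (hT.iterate n hF).inter (Finset.measurableSet_biInter _ fun l _ => ?_)
    by_cases hl : 0 < l
    · simp only [hl, forall_const]
      exact (hT.iterate l hF).compl
    · simp [hl]
  refine measurable_to_countable' fun n => ?_
  rcases Nat.eq_zero_or_pos n with rfl | hn
  · have : returnTime T F ⁻¹' {0} = (⋃ n, returnTime T F ⁻¹' {n + 1})ᶜ := by
      ext x
      simp only [mem_preimage, mem_singleton_iff, mem_compl_iff, mem_iUnion, not_exists]
      constructor
      · intro h n; omega
      · intro h
        by_contra h0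
        exact h (returnTime T F x - 1) (by omega)
    rw [this]
    exact (MeasurableSet.iUnion fun n => hpos _ n.succ_pos).compl
  · exact hpos n hn

lemma measurable_inducedMap (hT : Measurable T) (hF : MeasurableSet F) :
    Measurable (inducedMap T F) := by
  have h1 : Measurable fun p : ℕ × α => T^[p.1] p.2 :=
    measurable_from_prod_countable_right fun n => hT.iterate n
  exact h1.comp ((measurable_returnTime hT hF).prodMk measurable_id)

/-- Summing over all times before the return to `F`, the visits to a set `D` have measure at most
`μ D`. -/
lemma tsum_measure_visit_le (hT : MeasurePreserving T μ μ) (hF : MeasurableSet F) {D : Set α}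
    (hD : MeasurableSet D) :
    ∑' j, μ {y | y ∈ F ∧ (∀ l < j, T^[l + 1] y ∉ F) ∧ T^[j + 1] y ∈ D} ≤ μ D := by
  -- `T ⁻¹' E n` has the measure of `E n`. Its part in `F` is the `n`-th visit set and its part
  -- outside `F` is `E (n + 1)`, so the sum telescopes, starting from `E 0 = D`.
  let E : ℕ → Set α := fun n => {y | (∀ l < n, T^[l] y ∉ F) ∧ T^[n] y ∈ D}
  have hE : ∀ n, MeasurableSet (E n) := by
    intro n
    have : E n = (⋂ l ∈ Finset.range n, (T^[l] ⁻¹' F)ᶜ) ∩ T^[n] ⁻¹' D := by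
      ext x
      simp [E]
    rw [this]
    exact (Finset.measurableSet_biInter _ fun l _ => (hT.measurable.iterate l hF).compl).inter
      (hT.measurable.iterate n hD)
  have hstep : ∀ n, μ {y | y ∈ F ∧ (∀ l < n, T^[l + 1] y ∉ F) ∧ T^[n + 1] y ∈ D} + μ (E (n + 1)) =
      μ (E n) := by
    intro n
    rw [← hT.measure_preimage (hE n).nullMeasurableSet,
      ← measure_inter_add_sdiff (T ⁻¹' E n) hF]
    congr 2
    · ext y
      simp only [E, mem_preimage, mem_inter_iff, mem_ofPred_eq, ← Function.iterate_succ_apply]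
      tauto
    · ext y
      simp only [E, mem_preimage, Set.mem_sdiff, mem_ofPred_eq, ← Function.iterate_succ_apply]
      constructor
      · rintro ⟨h1, h2⟩
        exact ⟨⟨fun l hl => h1 (l + 1) (by omega), h2⟩, h1 0 (by omega)⟩
      · rintro ⟨⟨h1, h2⟩, h3⟩
        refine ⟨fun l hl => ?_, h2⟩
        cases l with
        | zero => exact h3
        | succ l => exact h1 l (by omega)
  refine ENNReal.tsum_le_of_sum_range_le fun n => ?_
  have hsum : ∑ j ∈ Finset.range n,
      μ {y | y ∈ F ∧ (∀ l < j, T^[l + 1] y ∉ F) ∧ T^[j + 1] y ∈ D} + μ (E n) = μ D := by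
    induction n with
    | zero => simp [E]
    | succ n ih => rw [Finset.sum_range_succ, add_assoc, hstep, ih]
  rw [← hsum]
  exact le_self_add

lemma ae_cond_returns (hcons : Conservative T μ) (hF : MeasurableSet F) :
    ∀ᵐ x ∂(ProbabilityTheory.cond μ F), x ∈ F ∧ ∃ n, 0 < n ∧ T^[n] x ∈ F := by
  have h1 := (ProbabilityTheory.cond_absolutelyContinuous (μ := μ) (s := F)).ae_le
    (hcons.ae_mem_imp_frequently_image_mem hF.nullMeasurableSet)
  filter_upwards [h1, ProbabilityTheory.ae_cond_mem hF] with x hx hxF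
  obtain ⟨n, hn, hn0⟩ := ((hx hxF).and_eventually (eventually_gt_atTop 0)).exists
  exact ⟨hxF, n, hn0, hn⟩

/-- The visit estimate shows that preimages do not gain measure. For a probability measure this
inequality, applied to `B` and to `Bᶜ`, is an equality. -/
lemma measurePreserving_inducedMap (hT : MeasurePreserving T μ μ) (hcons : Conservative T μ)
    (hF : MeasurableSet F) (hF0 : μ F ≠ 0) (hFt : μ F ≠ ⊤) :
    MeasurePreserving (inducedMap T F) (ProbabilityTheory.cond μ F)
      (ProbabilityTheory.cond μ F) := by
  have hprob : IsProbabilityMeasure (ProbabilityTheory.cond μ F) :=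
    ProbabilityTheory.cond_isProbabilityMeasure_of_finite hF0 hFt
  have hm := measurable_inducedMap hT.measurable hF
  set ν := ProbabilityTheory.cond μ F with hν
  have hle : ∀ B, MeasurableSet B → ν (inducedMap T F ⁻¹' B) ≤ ν B := by
    intro B hB
    have hnull : μ {x | x ∈ F ∧ ¬ ∃ n, 0 < n ∧ T^[n] x ∈ F} = 0 := by
      have := hcons.ae_mem_imp_frequently_image_mem hF.nullMeasurableSet
      rw [ae_iff] at this
      refine measure_mono_null ?_ this
      rintro x ⟨hxF, hx⟩ hcon
      obtain ⟨n, hn, hn0⟩ := ((hcon hxF).and_eventually (eventually_gt_atTop 0)).exists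
      exact hx ⟨n, hn0, hn⟩
    rw [hν, ProbabilityTheory.cond_apply hF, ProbabilityTheory.cond_apply hF]
    refine mul_le_mul_right ?_ _
    calc μ (F ∩ inducedMap T F ⁻¹' B)
        ≤ μ ({x | x ∈ F ∧ ¬ ∃ n, 0 < n ∧ T^[n] x ∈ F} ∪
          ⋃ j, {y | y ∈ F ∧ (∀ l < j, T^[l + 1] y ∉ F) ∧ T^[j + 1] y ∈ F ∩ B}) := by
          refine measure_mono fun x hx => ?_
          by_cases hret : ∃ n, 0 < n ∧ T^[n] x ∈ F
          · have hs := returnTime_spec hret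
            refine Or.inr (mem_iUnion.2 ⟨returnTime T F x - 1, hx.1, fun l hl => ?_, ?_⟩)
            · exact notMem_of_lt_returnTime l.succ_pos (by omega)
            · rw [Nat.sub_add_cancel hs.1]
              exact ⟨hs.2, hx.2⟩
          · exact Or.inl ⟨hx.1, hret⟩
      _ ≤ 0 + ∑' j, μ {y | y ∈ F ∧ (∀ l < j, T^[l + 1] y ∉ F) ∧ T^[j + 1] y ∈ F ∩ B} :=
          (measure_union_le _ _).trans (add_le_add hnull.le (measure_iUnion_le _))
      _ ≤ μ (F ∩ B) := by
          rw [zero_add]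
          exact tsum_measure_visit_le hT hF (hF.inter hB)
  refine ⟨hm, Measure.ext fun B hB => ?_⟩
  rw [Measure.map_apply hm hB]
  refine le_antisymm (hle B hB) ?_
  have h1 := hle Bᶜ hB.compl
  rw [preimage_compl, prob_compl_eq_one_sub (hm hB), prob_compl_eq_one_sub hB] at h1
  exact (ENNReal.sub_le_sub_iff_left prob_le_one ENNReal.one_ne_top).1 h1

end Induced

/-! ### Vanishing of the entropy of an induced transformation -/

section Coding

variable {α : Type*} {T : α → α} {F F' : Set α} {m J : ℕ}

/-- The number of visits to `D` before the first return to `F`. -/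
def visitCount (T : α → α) (F D : Set α) (y : α) : ℕ :=
  ∑ j ∈ Finset.range (returnTime T F y - 1), D.indicator 1 (T^[j + 1] y)

/-- Strictly between `y` and its return the orbit avoids `F`, so a visit to `F'` there is a visit to
`F' \ F`. -/
lemma phase_inducedMap {Φ : α → ℕ} {y : α} (hret : ∃ n, 0 < n ∧ T^[n] y ∈ F)
    (hΦ : ∀ j, Φ (T^[j + 1] y) ≡ Φ (T^[j] y) + F'.indicator 1 (T^[j] y) [MOD J]) :
    Φ (inducedMap T F y) ≡ Φ y + (F'.indicator 1 y + visitCount T F (F' \ F) y) [MOD J] := by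
  have key : ∀ j < returnTime T F y, Φ (T^[j + 1] y) ≡ Φ y + (F'.indicator 1 y +
      ∑ l ∈ Finset.range j, (F' \ F).indicator 1 (T^[l + 1] y)) [MOD J] := by
    intro j hj
    induction j with
    | zero => simpa using hΦ 0
    | succ j ih =>
      have hnot : T^[j + 1] y ∉ F := notMem_of_lt_returnTime j.succ_pos hj
      refine (hΦ (j + 1)).trans ?_
      have h2 : F'.indicator 1 (T^[j + 1] y) = (F' \ F).indicator (1 : α → ℕ) (T^[j + 1] y) := by
        by_cases h : T^[j + 1] y ∈ F' <;> simp [h, hnot, -Function.iterate_succ]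
      rw [Finset.sum_range_succ, ← add_assoc, ← add_assoc, h2, add_assoc (Φ y)]
      exact Nat.ModEq.add_right _ (ih (by omega))
  have h1 := (returnTime_spec hret).1
  have h2 := key (returnTime T F y - 1) (by omega)
  rwa [Nat.sub_add_cancel h1] at h2

/-- The length of a code symbol. -/
def symbolSize (e : Fin J × Fin (m + 1) × Bool) : ℕ :=
  e.1 + ((if e.2.1 = 0 then 0 else 1) + (if e.2.2 then 1 else 0))

lemma sum_pow_symbolSize_le {x : ℝ} (hx0 : 0 < x) (hx1 : x < 1) :
    ∑ e : Fin J × Fin (m + 1) × Bool, x ^ symbolSize e ≤ (1 - x)⁻¹ * ((1 + m * x) * (1 + x)) := by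
  have h1 : ∑ e : Fin J × Fin (m + 1) × Bool, x ^ symbolSize e =
      (∑ s : Fin J, x ^ (s : ℕ)) * ((∑ l : Fin (m + 1), x ^ (if l = 0 then 0 else 1)) *
        ∑ b : Bool, x ^ (if b then 1 else 0)) := by
    rw [Finset.sum_mul_sum, Finset.sum_mul_sum]
    simp only [symbolSize, pow_add, Fintype.sum_prod_type, Finset.mul_sum]
  rw [h1]
  have h2 : ∑ s : Fin J, x ^ (s : ℕ) ≤ (1 - x)⁻¹ := by
    rw [Fin.sum_univ_eq_sum_range fun s => x ^ s, ← tsum_geometric_of_lt_one hx0.le hx1]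
    exact (summable_geometric_of_lt_one hx0.le hx1).sum_le_tsum _ fun i _ => by positivity
  have h3 : ∑ l : Fin (m + 1), x ^ (if l = 0 then 0 else 1) = 1 + m * x := by
    rw [Fin.sum_univ_succ]
    simp [Fin.succ_ne_zero]
  have h4 : ∑ b : Bool, x ^ (if b then 1 else 0) = 1 + x := by
    simp [add_comm]
  rw [h3, h4]
  gcongr

/-- The generating function of the symbol sizes is bounded by a function of `x` that is free of `J`
and tends to `1` as `x → 0`. With `x = exp (-c)` small, the factor `exp (-η)` absorbs the excess.
Uniformity in `J` is essential, because `J` is chosen after `c`. -/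
lemma exists_symbol_cost (m : ℕ) {η : ℝ} (hη : 0 < η) : ∃ c : ℝ, 0 < c ∧ ∀ J : ℕ,
    ∑ e : Fin J × Fin (m + 1) × Bool, Real.exp (-(c * symbolSize e + η)) ≤ 1 := by
  have hcont : ContinuousAt (fun x : ℝ => (1 - x)⁻¹ * ((1 + m * x) * (1 + x))) 0 := by
    refine ContinuousAt.mul (ContinuousAt.inv₀ (by fun_prop) (by norm_num)) (by fun_prop)
  have hlt : (1 - (0 : ℝ))⁻¹ * ((1 + m * 0) * (1 + 0)) < Real.exp η := by
    simpa using hη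
  have hev := (hcont.eventually (gt_mem_nhds hlt)).filter_mono
    (nhdsWithin_le_nhds (s := Ioi 0))
  obtain ⟨x, ⟨hx, hx1⟩, hx0⟩ := ((hev.and (((gt_mem_nhds one_pos).filter_mono
    (nhdsWithin_le_nhds (s := Ioi (0 : ℝ)))))).and self_mem_nhdsWithin).exists
  refine ⟨-Real.log x, neg_pos.2 (Real.log_neg hx0 hx1), fun J => ?_⟩
  have hterm : ∀ e : Fin J × Fin (m + 1) × Bool,
      Real.exp (-(-Real.log x * symbolSize e + η)) = Real.exp (-η) * x ^ symbolSize e := by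
    intro e
    rw [← Real.exp_log hx0, ← Real.exp_nat_mul, ← Real.exp_add, Real.exp_log hx0]
    congr 1; ring
  simp only [hterm]
  rw [← Finset.mul_sum, Real.exp_neg, inv_mul_le_iff₀ (Real.exp_pos _), mul_one]
  exact (sum_pow_symbolSize_le hx0 hx1).trans hx.le

open Classical in
/-- The code symbol of a point: the number of unexpected visits before the return, the label when it
is not the one prescribed by the phase, and whether the point is missing from the approximating
set. -/
def codeSymbol (T : α → α) (F F' : Set α) (Φ : α → ℕ) (V : ℕ → Fin m) (P : α → Fin m) [NeZero J]
    (y : α) : Fin J × Fin (m + 1) × Bool :=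
  (Fin.ofNat J (visitCount T F (F' \ F) y), if P y = V (Φ y % J) then 0 else (P y).succ,
    decide (y ∉ F'))

/-- The advance of the phase recorded by a code symbol. -/
def symbolAdvance (e : Fin J × Fin (m + 1) × Bool) : ℕ := (if e.2.2 then 0 else 1) + e.1

/-- The label recorded by a code symbol when the phase is `φ`. -/
def symbolLabel (V : ℕ → Fin m) (φ : ℕ) (e : Fin J × Fin (m + 1) × Bool) : Fin m :=
  if h : e.2.1 = 0 then V (φ % J) else e.2.1.pred h

lemma symbolLabel_codeSymbol [NeZero J] {Φ : α → ℕ} {V : ℕ → Fin m} {P : α → Fin m} {y : α} {φ : ℕ}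
    (hφ : Φ y ≡ φ [MOD J]) :
    P y = symbolLabel V φ (codeSymbol (J := J) T F F' Φ V P y) := by
  have hφ' : Φ y % J = φ % J := hφ
  by_cases h : P y = V (Φ y % J)
  · simp only [symbolLabel, codeSymbol, h, if_true, dif_pos, hφ']
  · simp only [symbolLabel, codeSymbol, h, if_false, Fin.succ_ne_zero, dif_neg, not_false_eq_true,
      Fin.pred_succ]

lemma phase_codeSymbol [NeZero J] {Φ : α → ℕ} {V : ℕ → Fin m} {P : α → Fin m} {y : α}
    (h : Φ (inducedMap T F y) ≡
      Φ y + (F'.indicator 1 y + visitCount T F (F' \ F) y) [MOD J]) :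
    Φ (inducedMap T F y) ≡ Φ y + symbolAdvance (codeSymbol (J := J) T F F' Φ V P y) [MOD J] := by
  refine h.trans (Nat.ModEq.add_left _ ?_)
  have h1 : visitCount T F (F' \ F) y ≡
      ((Fin.ofNat J (visitCount T F (F' \ F) y) : Fin J) : ℕ) [MOD J] := by
    simp [Nat.ModEq]
  by_cases hy : y ∈ F'
  · simpa [symbolAdvance, codeSymbol, hy] using Nat.ModEq.add_left 1 h1
  · simpa [symbolAdvance, codeSymbol, hy] using h1

variable [MeasurableSpace α] {μ : Measure α}

lemma measurable_visitCount (hT : Measurable T) (hF : MeasurableSet F) {D : Set α}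
    (hD : MeasurableSet D) : Measurable (visitCount T F D) := by
  have h1 : Measurable fun p : ℕ × α =>
      ∑ j ∈ Finset.range (p.1 - 1), D.indicator (1 : α → ℕ) (T^[j + 1] p.2) := by
    refine measurable_from_prod_countable_right fun n => ?_
    change Measurable fun y => ∑ j ∈ Finset.range (n - 1), D.indicator (1 : α → ℕ) (T^[j + 1] y)
    exact Finset.measurable_sum _ fun j _ =>
      ((measurable_one : Measurable (1 : α → ℕ)).indicator hD).comp (hT.iterate (j + 1))
  exact h1.comp ((measurable_returnTime hT hF).prodMk measurable_id)

lemma lintegral_visitCount_le (hT : MeasurePreserving T μ μ) (hF : MeasurableSet F) {D : Set α}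
    (hD : MeasurableSet D) : ∫⁻ y in F, (visitCount T F D y : ℝ≥0∞) ∂μ ≤ μ D := by
  classical
  let A : ℕ → Set α := fun j => {y | y ∈ F ∧ (∀ l < j, T^[l + 1] y ∉ F) ∧ T^[j + 1] y ∈ D}
  have hA : ∀ j, MeasurableSet (A j) := by
    intro j
    have : A j = F ∩ ((⋂ l ∈ Finset.range j, (T^[l + 1] ⁻¹' F)ᶜ) ∩ T^[j + 1] ⁻¹' D) := by
      ext x
      simp only [A, mem_ofPred_eq, mem_inter_iff, mem_iInter, Finset.mem_range, mem_compl_iff,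
        mem_preimage]
    rw [this]
    exact hF.inter ((Finset.measurableSet_biInter _ fun l _ =>
      (hT.measurable.iterate (l + 1) hF).compl).inter (hT.measurable.iterate (j + 1) hD))
  calc ∫⁻ y in F, (visitCount T F D y : ℝ≥0∞) ∂μ
      ≤ ∫⁻ y in F, ∑' j, (A j).indicator 1 y ∂μ := by
        refine setLIntegral_mono' hF fun y hy => ?_
        rw [visitCount]
        push_cast
        refine le_trans (Finset.sum_le_sum fun j hj => ?_)
          (ENNReal.sum_le_tsum (Finset.range (returnTime T F y - 1)))
        rw [Finset.mem_range] at hj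
        by_cases h : T^[j + 1] y ∈ D
        · have : y ∈ A j := ⟨hy, fun l hl => notMem_of_lt_returnTime l.succ_pos (by omega), h⟩
          simp [this, h, -Function.iterate_succ]
        · simp [h, -Function.iterate_succ]
    _ = ∑' j, ∫⁻ y in F, (A j).indicator 1 y ∂μ :=
        lintegral_tsum fun j => (measurable_one.indicator (hA j)).aemeasurable
    _ ≤ ∑' j, μ (A j) := by
        refine ENNReal.tsum_le_tsum fun j => ?_
        rw [lintegral_indicator_one (hA j)]
        exact Measure.restrict_apply_le _ _
    _ ≤ μ D := tsum_measure_visit_le hT hF hD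

lemma measurable_codeSymbol [NeZero J] (hT : Measurable T) (hF : MeasurableSet F)
    (hF' : MeasurableSet F') {Φ : α → ℕ} (hΦ : Measurable Φ) (V : ℕ → Fin m) {P : α → Fin m}
    (hP : Measurable P) : Measurable (codeSymbol (J := J) T F F' Φ V P) := by
  classical
  have hV : Measurable fun y => V (Φ y % J) :=
    (measurable_from_nat (f := fun n => V (n % J))).comp hΦ
  refine Measurable.prodMk ?_ (Measurable.prodMk ?_ ?_)
  · exact (measurable_from_nat (f := fun n => Fin.ofNat J n)).comp
      (measurable_visitCount hT hF (hF'.diff hF))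
  · exact Measurable.ite (measurableSet_eq_fun hP hV) measurable_const
      ((measurable_of_finite (Fin.succ : Fin m → Fin (m + 1))).comp hP)
  · refine measurable_to_bool ?_
    convert! hF'.compl using 1
    ext x
    simp

/-- The three components of a symbol are nonzero only because of the three errors of the
approximation. The visit count is recorded modulo `J`, which can only decrease it. -/
lemma lintegral_symbolSize_le [NeZero J] (hT : MeasurePreserving T μ μ) (hF : MeasurableSet F)
    (hF' : MeasurableSet F') {Φ : α → ℕ} (hΦ : Measurable Φ) (V : ℕ → Fin m) {P : α → Fin m}
    (hP : Measurable P) :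
    ∫⁻ y in F, (symbolSize (codeSymbol (J := J) T F F' Φ V P y) : ℝ≥0∞) ∂μ ≤
      μ (F' \ F) + (μ (F ∩ {x | P x ≠ V (Φ x % J)}) + μ (F \ F')) := by
  classical
  have hm1 : MeasurableSet {x | P x ≠ V (Φ x % J)} :=
    (measurableSet_eq_fun hP ((measurable_from_nat (f := fun n => V (n % J))).comp hΦ)).compl
  have hm3 := measurable_visitCount (T := T) (F := F) hT.measurable hF (hF'.diff hF)
  calc ∫⁻ y in F, (symbolSize (codeSymbol (J := J) T F F' Φ V P y) : ℝ≥0∞) ∂μ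
      ≤ ∫⁻ y in F, ((visitCount T F (F' \ F) y : ℝ≥0∞) +
          (({x | P x ≠ V (Φ x % J)} : Set α).indicator 1 y + F'ᶜ.indicator 1 y)) ∂μ := by
        refine lintegral_mono fun y => ?_
        simp only [symbolSize, codeSymbol]
        push_cast
        refine add_le_add ?_ (add_le_add ?_ ?_)
        · exact_mod_cast Nat.mod_le _ _
        · by_cases h : P y = V (Φ y % J) <;> simp [h]
        · by_cases h : y ∈ F' <;> simp [h]
    _ = ∫⁻ y in F, (visitCount T F (F' \ F) y : ℝ≥0∞) ∂μ +
          (μ (F ∩ {x | P x ≠ V (Φ x % J)}) + μ (F \ F')) := by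
        rw [lintegral_add_left, lintegral_add_left, lintegral_indicator_one hm1,
          lintegral_indicator_one hF'.compl, Measure.restrict_apply hm1,
          Measure.restrict_apply hF'.compl, inter_comm, inter_comm F'ᶜ, Set.sdiff_eq]
        · rfl
        · exact (measurable_one : Measurable (1 : α → ℝ≥0∞)).indicator hm1
        · exact (measurable_from_nat (f := fun n => (n : ℝ≥0∞))).comp hm3
    _ ≤ _ := by gcongr; exact lintegral_visitCount_le hT hF (hF'.diff hF)

end Coding

/-! ### Entropy of the induced map from the code -/

section Coding

variable {α : Type*} [MeasurableSpace α] {μ : Measure α} {T : α → α} {F F' : Set α} {m J : ℕ}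

lemma sum_exp_code_le {c η : ℝ} (hJ : 0 < J)
    (hc : ∑ e : Fin J × Fin (m + 1) × Bool, Real.exp (-(c * symbolSize e + η)) ≤ 1) (N : ℕ) :
    ∑ z : Fin J × (Fin N → Fin J × Fin (m + 1) × Bool),
      Real.exp (-(Real.log J + ∑ i, (c * symbolSize (z.2 i) + η))) ≤ 1 := by
  have hJ' : (0 : ℝ) < J := by exact_mod_cast hJ
  have hterm : ∀ z : Fin J × (Fin N → Fin J × Fin (m + 1) × Bool),
      Real.exp (-(Real.log J + ∑ i, (c * symbolSize (z.2 i) + η))) =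
        (J : ℝ)⁻¹ * ∏ i, Real.exp (-(c * symbolSize (z.2 i) + η)) := by
    intro z
    rw [neg_add, Real.exp_add, Real.exp_neg, Real.exp_log hJ', ← Finset.sum_neg_distrib,
      Real.exp_sum]
  simp only [hterm, Fintype.sum_prod_type]
  rw [Finset.sum_const, ← Finset.mul_sum,
    ← Fintype.prod_sum fun (_ : Fin N) (e : Fin J × Fin (m + 1) × Bool) =>
      Real.exp (-(c * symbolSize e + η))]
  simp only [Finset.prod_const, Finset.card_univ, Fintype.card_fin, nsmul_eq_mul]
  rw [← mul_assoc, mul_inv_cancel₀ hJ'.ne', one_mul]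
  exact pow_le_one₀ (Finset.sum_nonneg fun e _ => (Real.exp_pos _).le) hc

/-- The phase reached after `i` symbols of a code. -/
def codePhase {N : ℕ} (z : Fin J × (Fin N → Fin J × Fin (m + 1) × Bool)) (i : ℕ) : ℕ :=
  z.1 + ∑ l ∈ Finset.range i, if h : l < N then symbolAdvance (z.2 ⟨l, h⟩) else 0

/-- The initial phase together with `N` symbols determines the `N`-name: the symbols update the
phase, and phase and symbol give the label. The phase costs `log J` once. Each symbol costs at most
`c * ε + η` on average, since the induced map preserves the measure. -/
lemma partitionEntropy_join_le [NeZero J] (hT : MeasurePreserving T μ μ) (hcons : Conservative T μ)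
    (hF : MeasurableSet F) (hF0 : μ F ≠ 0) (hFt : μ F ≠ ⊤) (hF' : MeasurableSet F') {Φ : α → ℕ}
    (hΦ : Measurable Φ) (hΦT : ∀ᵐ x ∂μ, Φ (T x) ≡ Φ x + F'.indicator 1 x [MOD J])
    (V : ℕ → Fin m) {P : α → Fin m} (hP : Measurable P) {c η ε : ℝ} (hc0 : 0 < c)
    (hc : ∑ e : Fin J × Fin (m + 1) × Bool, Real.exp (-(c * symbolSize e + η)) ≤ 1)
    (hε : ∫ y, (symbolSize (codeSymbol (J := J) T F F' Φ V P y) : ℝ)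
      ∂(ProbabilityTheory.cond μ F) ≤ ε) (N : ℕ) :
    partitionEntropy (ProbabilityTheory.cond μ F) (joinPartition (inducedMap T F) P N) ≤
      Real.log J + N * (c * ε + η) := by
  have hprob : IsProbabilityMeasure (ProbabilityTheory.cond μ F) :=
    ProbabilityTheory.cond_isProbabilityMeasure_of_finite hF0 hFt
  have hind := measurePreserving_inducedMap hT hcons hF hF0 hFt
  set ν := ProbabilityTheory.cond μ F with hν
  set E := codeSymbol (J := J) T F F' Φ V P with hE
  have hEm : Measurable E := measurable_codeSymbol hT.measurable hF hF' hΦ V hP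
  let Z : α → Fin J × (Fin N → Fin J × Fin (m + 1) × Bool) :=
    fun y => (Fin.ofNat J (Φ y), fun i => E ((inducedMap T F)^[i] y))
  have hZ : Measurable Z :=
    ((measurable_from_nat (f := fun n => Fin.ofNat J n)).comp hΦ).prodMk
      (measurable_pi_lambda _ fun i => hEm.comp (hind.measurable.iterate i))
  let f : Fin J × (Fin N → Fin J × Fin (m + 1) × Bool) → Fin N → Fin m :=
    fun z i => symbolLabel V (codePhase z i) (z.2 i)
  have hstep : ∀ᵐ y ∂ν, Φ (inducedMap T F y) ≡ Φ y + symbolAdvance (E y) [MOD J] := by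
    have h1 : ∀ᵐ x ∂μ, ∀ j : ℕ, Φ (T^[j + 1] x) ≡ Φ (T^[j] x) + F'.indicator 1 (T^[j] x) [MOD J] := by
      refine ae_all_iff.2 fun j => ?_
      have := (hT.iterate j).quasiMeasurePreserving.ae hΦT
      filter_upwards [this] with x hx
      rwa [Function.iterate_succ_apply']
    filter_upwards [ae_cond_returns hcons hF,
      (ProbabilityTheory.cond_absolutelyContinuous (μ := μ) (s := F)).ae_le h1] with y hy hy'
    exact phase_codeSymbol (phase_inducedMap hy.2 hy')
  have hcode : ∀ᵐ y ∂ν, joinPartition (inducedMap T F) P N y = f (Z y) := by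
    have h1 : ∀ᵐ y ∂ν, ∀ i : ℕ, Φ ((inducedMap T F)^[i + 1] y) ≡
        Φ ((inducedMap T F)^[i] y) + symbolAdvance (E ((inducedMap T F)^[i] y)) [MOD J] := by
      refine ae_all_iff.2 fun i => ?_
      have := (hind.iterate i).quasiMeasurePreserving.ae hstep
      filter_upwards [this] with x hx
      rwa [Function.iterate_succ_apply']
    filter_upwards [h1] with y hy
    have hphase : ∀ i ≤ N, Φ ((inducedMap T F)^[i] y) ≡ codePhase (Z y) i [MOD J] := by
      intro i hi
      induction i with
      | zero => simp [codePhase, Z, Nat.ModEq]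
      | succ i ih =>
        refine (hy i).trans ?_
        rw [codePhase, Finset.sum_range_succ, ← add_assoc, dif_pos (show i < N by omega)]
        exact Nat.ModEq.add_right _ (ih (by omega))
    funext i
    have hlab := symbolLabel_codeSymbol (J := J) (T := T) (F := F) (F' := F') (V := V) (P := P)
      (hphase i i.2.le)
    rw [← hE] at hlab
    exact hlab
  refine (partitionEntropy_le_integral hZ hcode (sum_exp_code_le (NeZero.pos J) hc N)).trans ?_
  have hbdd : ∀ g : Fin J × Fin (m + 1) × Bool → ℝ, Integrable (fun y => g (E y)) ν := fun g =>
    Integrable.of_bound (C := ∑ e, |g e|)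
      ((measurable_of_finite g).comp hEm).aestronglyMeasurable
      (ae_of_all _ fun y => by
        rw [Real.norm_eq_abs]
        exact Finset.single_le_sum (f := fun e => |g e|) (fun e _ => abs_nonneg _)
          (Finset.mem_univ _))
  have hint : ∀ i : ℕ, Integrable
      (fun y => c * (symbolSize (E ((inducedMap T F)^[i] y)) : ℝ) + η) ν := fun i =>
    (hind.iterate i).integrable_comp_of_integrable (hbdd fun e => c * symbolSize e + η)
  have hval : ∀ i : ℕ, ∫ y, (c * (symbolSize (E ((inducedMap T F)^[i] y)) : ℝ) + η) ∂ν ≤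
      c * ε + η := by
    intro i
    have h1 : ∫ y, (c * (symbolSize (E ((inducedMap T F)^[i] y)) : ℝ) + η) ∂ν =
        ∫ y, (c * (symbolSize (E y) : ℝ) + η) ∂ν := by
      have h2 := (hind.iterate i).map_eq
      conv_rhs => rw [← h2]
      rw [integral_map (hind.iterate i).measurable.aemeasurable]
      exact ((measurable_of_finite fun e => c * (symbolSize e : ℝ) + η).comp
        hEm).aestronglyMeasurable
    rw [h1, integral_add ((hbdd fun e => (symbolSize e : ℝ)).const_mul c) (integrable_const _),
      integral_const_mul, integral_const, probReal_univ, one_smul]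
    gcongr
  calc ∫ y, (Real.log J + ∑ i : Fin N,
        (c * (symbolSize (E ((inducedMap T F)^[i] y)) : ℝ) + η)) ∂ν
      = Real.log J + ∑ i : Fin N,
          ∫ y, (c * (symbolSize (E ((inducedMap T F)^[i] y)) : ℝ) + η) ∂ν := by
        rw [integral_add (integrable_const _) (integrable_finsetSum _ fun (i : Fin N) _ => hint i),
          integral_const, probReal_univ, one_smul, integral_finsetSum _ fun (i : Fin N) _ => hint i]
    _ ≤ Real.log J + ∑ i : Fin N, (c * ε + η) := by
        gcongr with i
        exact hval i
    _ = _ := by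
        rw [Finset.sum_const, Finset.card_univ, Fintype.card_fin, nsmul_eq_mul]

/-- If the set `F` and its partitions are approximated by a set that is visited cyclically, the
transformation induced on `F` has zero entropy. -/
lemma ksEntropy_inducedMap_eq_zero (hT : MeasurePreserving T μ μ) (hcons : Conservative T μ)
    (hF : MeasurableSet F) (hF0 : μ F ≠ 0) (hFt : μ F ≠ ⊤)
    (happ : ∀ (m : ℕ) (P : α → Fin m), Measurable P → ∀ ε : ℝ≥0∞, 0 < ε →
      ∃ (J : ℕ) (F' : Set α) (Φ : α → ℕ) (V : ℕ → Fin m), 0 < J ∧ MeasurableSet F' ∧ Measurable Φ ∧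
        (∀ᵐ x ∂μ, Φ (T x) ≡ Φ x + F'.indicator 1 x [MOD J]) ∧
        μ (F' \ F) + (μ (F ∩ {x | P x ≠ V (Φ x % J)}) + μ (F \ F')) ≤ ε) :
    ksEntropy (inducedMap T F) (ProbabilityTheory.cond μ F) = 0 := by
  rw [ksEntropy, ← nonpos_iff_eq_zero]
  refine iSup_le fun m => iSup_le fun P => iSup_le fun hP => ?_
  refine le_of_forall_gt_imp_ge_of_dense fun δ' hδ' => ?_
  obtain ⟨δ, hδ0, hδδ'⟩ : ∃ δ : ℝ, 0 < δ ∧ ENNReal.ofReal δ ≤ δ' := by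
    obtain ⟨d, hd0, hd⟩ := ENNReal.lt_iff_exists_nnreal_btwn.1 hδ'
    exact ⟨d, by exact_mod_cast hd0, by rw [ENNReal.ofReal_coe_nnreal]; exact hd.le⟩
  refine le_trans ?_ hδδ'
  -- The rate `δ` is shared equally between `η`, the mean symbol cost `c * (δ / (3 * c))`, and `log
  -- J / n` for large `n`. The approximation is chosen after `c`.
  obtain ⟨c, hc0, hc⟩ := exists_symbol_cost m (show 0 < δ / 3 by positivity)
  have hε0 : 0 < δ / (3 * c) := by positivity
  obtain ⟨J, F', Φ, V, hJ, hF', hΦ, hΦT, hle⟩ := happ m P hP (μ F * ENNReal.ofReal (δ / (3 * c)))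
    (ENNReal.mul_pos hF0 (by simpa using hε0))
  have : NeZero J := ⟨hJ.ne'⟩
  have hε : ∫ y, (symbolSize (codeSymbol (J := J) T F F' Φ V P y) : ℝ)
      ∂(ProbabilityTheory.cond μ F) ≤ δ / (3 * c) := by
    rw [integral_eq_lintegral_of_nonneg_ae (ae_of_all _ fun _ => Nat.cast_nonneg _)]
    · refine ENNReal.toReal_le_of_le_ofReal hε0.le ?_
      simp only [ENNReal.ofReal_natCast]
      rw [ProbabilityTheory.cond, lintegral_smul_measure, smul_eq_mul]
      refine ENNReal.inv_mul_le_iff hF0 hFt |>.2 ?_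
      exact (lintegral_symbolSize_le hT hF hF' hΦ V hP).trans hle
    · exact ((measurable_of_finite fun e => (symbolSize e : ℝ)).comp
        (measurable_codeSymbol hT.measurable hF hF' hΦ V hP)).aestronglyMeasurable
  have hbound := partitionEntropy_join_le hT hcons hF hF0 hFt hF' hΦ hΦT V hP hc0 (hc J) hε
  have hcε : c * (δ / (3 * c)) + δ / 3 = 2 * δ / 3 := by field_simp; ring
  rw [hcε] at hbound
  have hlim : Tendsto (fun n : ℕ => Real.log J / n) atTop (nhds 0) :=
    tendsto_const_div_atTop_nhds_zero_nat _
  refine limsup_le_of_le (by isBoundedDefault) ?_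
  filter_upwards [hlim.eventually (gt_mem_nhds (show 0 < δ / 3 by positivity)),
    eventually_gt_atTop 0] with n hn hn0
  have hn0' : (0 : ℝ) < n := by exact_mod_cast hn0
  refine ENNReal.ofReal_le_ofReal ?_
  rw [div_le_iff₀ hn0']
  rw [div_lt_iff₀ hn0'] at hn
  linarith [hbound n]

end Coding

/-! ### Zero Krengel entropy of a system of columns -/

namespace StackSystem

open ColumnSystem

variable {S : StackSystem}

lemma conservative_T (hS : HasInfiniteConservativeIndex S.T S.μ) : Conservative S.T S.μ := by
  have h1 := hS 1 le_rfl
  refine ⟨measurePreserving_T.quasiMeasurePreserving, fun s hs hs0 => ?_⟩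
  have hmp : MeasurePreserving (fun x : Fin 1 → ℝ => x 0) (S.μpi 1) S.μ :=
    measurePreserving_funUnique S.μ (Fin 1)
  obtain ⟨x, hx, n, hn, hxn⟩ := h1.exists_mem_iterate_mem' (s := (fun x : Fin 1 → ℝ => x 0) ⁻¹' s)
    (hmp.measurable hs) (by
      change S.μpi 1 _ ≠ 0
      rwa [hmp.measure_preimage hs.nullMeasurableSet])
  refine ⟨x 0, hx, n, hn, ?_⟩
  rwa [mem_preimage, prodPow_iterate] at hxn

open Classical in
/-- The number of levels with index in `J` below a point of the `n`-th column (zero outside of that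
column). -/
def phase (S : StackSystem) (n : ℕ) (J : Finset ℕ) (x : ℝ) : ℕ :=
  ∑ i ∈ Finset.range (S.h n), (S.lev n i).indicator (fun _ => (J.filter (· < i)).card) x

lemma phase_of_mem {n i : ℕ} {J : Finset ℕ} {x : ℝ} (hi : i < S.h n) (hx : x ∈ S.lev n i) :
    S.phase n J x = (J.filter (· < i)).card := by
  classical
  rw [phase, Finset.sum_eq_single i]
  · rw [indicator_of_mem hx]
  · intro j hj hji
    rw [indicator_of_notMem]
    intro hxj
    exact hji (lev_unique (Finset.mem_range.1 hj) hi hxj hx)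
  · intro h
    exact absurd (Finset.mem_range.2 hi) h

lemma phase_of_notMem {n : ℕ} {J : Finset ℕ} {x : ℝ} (hx : ∀ i < S.h n, x ∉ S.lev n i) :
    S.phase n J x = 0 := by
  refine Finset.sum_eq_zero fun i hi => indicator_of_notMem (hx i (Finset.mem_range.1 hi)) _

lemma measurable_phase (n : ℕ) (J : Finset ℕ) : Measurable (S.phase n J) :=
  Finset.measurable_sum _ fun i _ => measurable_const.indicator (measurableSet_lev n i)

lemma mem_lev_zero_of_T {n : ℕ} {x : ℝ} {i : ℕ} (hi : i < S.h n) (hx : S.T x ∈ S.lev n i)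
    (hx' : ∀ j, j + 1 < S.h n → x ∉ S.lev n j) : i = 0 := by
  rcases Nat.eq_zero_or_pos i with h | h
  · exact h
  · obtain ⟨i, rfl⟩ : ∃ j, i = j + 1 := ⟨i - 1, by omega⟩
    exact absurd (mem_lev_of_T hi hx) (hx' i hi)

/-- Going up one level increases the count exactly when the level left belongs to `J`. From the top
level the count becomes `J.card`, congruent to the value `0` outside the column, and the column can
be entered only at its bottom level, where the phase is again `0`. -/
lemma phase_T {n : ℕ} {J : Finset ℕ} (hJ : J ⊆ Finset.range (S.h n)) (x : ℝ) :
    S.phase n J (S.T x) ≡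
      S.phase n J x + (⋃ i ∈ J, S.lev n i).indicator 1 x [MOD J.card] := by
  classical
  have hmem : ∀ {i}, i < S.h n → x ∈ S.lev n i → ((x ∈ ⋃ i ∈ J, S.lev n i) ↔ i ∈ J) := by
    intro i hi hx
    simp only [mem_iUnion, exists_prop]
    constructor
    · rintro ⟨j, hj, hxj⟩
      rwa [lev_unique hi (Finset.mem_range.1 (hJ hj)) hx hxj]
    · exact fun h => ⟨i, h, hx⟩
  have hcard : ∀ i, (J.filter (· < i + 1)).card = (J.filter (· < i)).card + if i ∈ J then 1 else 0 := by
    intro i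
    have : J.filter (· < i + 1) = J.filter (· < i) ∪ J.filter (· = i) := by
      rw [← Finset.filter_or]
      exact Finset.filter_congr fun j _ => by omega
    rw [this, Finset.card_union_of_disjoint]
    · congr 1
      rw [Finset.filter_eq']
      split_ifs <;> simp
    · exact Finset.disjoint_filter.2 fun j _ h1 h2 => by omega
  have hzero : (∀ j, j + 1 < S.h n → x ∉ S.lev n j) → S.phase n J (S.T x) = 0 := by
    intro hx
    by_cases h : ∃ i < S.h n, S.T x ∈ S.lev n i
    · obtain ⟨i, hi, hTx⟩ := h
      obtain rfl := mem_lev_zero_of_T hi hTx hx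
      rw [phase_of_mem hi hTx]
      simp
    · push Not at h
      exact phase_of_notMem h
  by_cases h : ∃ i < S.h n, x ∈ S.lev n i
  · obtain ⟨i, hi, hx⟩ := h
    have hind : (⋃ i ∈ J, S.lev n i).indicator (1 : ℝ → ℕ) x = if i ∈ J then 1 else 0 := by
      rw [indicator_apply]
      exact if_congr (hmem hi hx) rfl rfl
    rw [hind, phase_of_mem hi hx, ← hcard]
    by_cases hi' : i + 1 < S.h n
    · rw [phase_of_mem hi' (T_mem_lev hi' hx)]
    · have hall : J.filter (· < i + 1) = J :=
        Finset.filter_true_of_mem fun j hj => by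
          have := Finset.mem_range.1 (hJ hj); omega
      rw [hall, hzero]
      · simp [Nat.ModEq]
      · intro j hj hxj
        have := lev_unique hi (by omega) hx hxj
        omega
  · push Not at h
    have hx : x ∉ ⋃ i ∈ J, S.lev n i := by
      simp only [mem_iUnion, exists_prop, not_exists, not_and]
      exact fun i hi => h i (Finset.mem_range.1 (hJ hi))
    rw [phase_of_notMem h, indicator_of_notMem hx, hzero fun j hj => h j (by omega), add_zero]

lemma card_filter_lt_injOn {J : Finset ℕ} {i j : ℕ} (hi : i ∈ J) (hj : j ∈ J)
    (h : (J.filter (· < i)).card = (J.filter (· < j)).card) : i = j := by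
  have key : ∀ {i j}, i ∈ J → i < j → (J.filter (· < i)).card < (J.filter (· < j)).card := by
    intro i j hi hij
    refine Finset.card_lt_card ⟨?_, ?_⟩
    · exact fun l hl => by
        simp only [Finset.mem_filter] at hl ⊢
        exact ⟨hl.1, by omega⟩
    · intro hsub
      have := hsub (Finset.mem_filter.2 ⟨hi, hij⟩)
      simp at this
  rcases lt_trichotomy i j with hij | hij | hij
  · exact absurd h (key hi hij).ne
  · exact hij
  · exact absurd h (key hj hij).ne'

/-- Approximate every atom of the partition of `F` by levels of one column and let `F'` be their
union. The phase of a level in `J` is its rank in `J`, so it determines the level and hence a label.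
Every error of the code lies in the union of the symmetric differences. -/
lemma krengelEntropy_eq_zero (hS : HasInfiniteConservativeIndex S.T S.μ) :
    krengelEntropy S.T S.μ = 0 := by
  classical
  rw [krengelEntropy, ← nonpos_iff_eq_zero]
  refine iSup_le fun F => iSup_le fun hF => iSup_le fun hF0 => iSup_le fun hFt => ?_
  rw [ksEntropy_inducedMap_eq_zero measurePreserving_T (conservative_T hS) hF hF0 hFt, mul_zero]
  intro m P hP ε hε
  have hm : (m : ℝ≥0∞) ≠ 0 := by
    have : 0 < m := (P 0).pos
    exact_mod_cast this.ne'
  -- The second entry of the minimum keeps the total error below `μ F`, which forces `J` to be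
  -- nonempty.
  have hε' : 0 < min (ε / 3 / m) (S.μ F / 2 / m) := by
    refine lt_min (ENNReal.div_pos (ENNReal.div_pos hε.ne' (by norm_num)).ne'
      (ENNReal.natCast_ne_top _)) (ENNReal.div_pos (ENNReal.half_pos hF0).ne' (ENNReal.natCast_ne_top _))
  have hPm : ∀ j, MeasurableSet (F ∩ P ⁻¹' {j}) := fun j =>
    hF.inter (hP (measurableSet_singleton j))
  have hev := fun j : Fin m => exists_finset_approx (hPm j)
    (ne_top_of_le_ne_top hFt (measure_mono inter_subset_left)) hε'
  obtain ⟨n, hn⟩ := (eventually_all.2 hev).exists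
  choose Js hJs happ using hn
  set J := Finset.univ.biUnion Js with hJ
  have hJr : J ⊆ Finset.range (S.h n) := Finset.biUnion_subset.2 fun j _ => hJs j
  set F' := ⋃ i ∈ J, S.lev n i with hF'
  -- A level may occur in several `Js j`. The choice is harmless: each point of such a level is an
  -- error for at least one of these `j`.
  let lab : ℕ → Fin m := fun i => if h : ∃ j, i ∈ Js j then h.choose else P 0
  let V : ℕ → Fin m := fun φ =>
    if h : ∃ i ∈ J, (J.filter (· < i)).card = φ then lab h.choose else P 0
  have hV : ∀ i ∈ J, V (J.filter (· < i)).card = lab i := by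
    intro i hi
    have h : ∃ i' ∈ J, (J.filter (· < i')).card = (J.filter (· < i)).card := ⟨i, hi, rfl⟩
    simp only [V, dif_pos h]
    congr 1
    exact card_filter_lt_injOn h.choose_spec.1 hi h.choose_spec.2
  set err := ⋃ j, symmDiff (F ∩ P ⁻¹' {j}) (⋃ i ∈ Js j, S.lev n i) with herr
  have herrle : ∀ δ : ℝ≥0∞, min (ε / 3 / m) (S.μ F / 2 / m) ≤ δ / m → S.μ err ≤ δ := by
    intro δ hδ
    calc S.μ err ≤ ∑ j, S.μ (symmDiff (F ∩ P ⁻¹' {j}) (⋃ i ∈ Js j, S.lev n i)) :=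
          measure_iUnion_fintype_le _ _
      _ ≤ ∑ _j : Fin m, δ / m := Finset.sum_le_sum fun j _ => (happ j).le.trans hδ
      _ = δ := by
          rw [Finset.sum_const, Finset.card_univ, Fintype.card_fin, nsmul_eq_mul,
            ENNReal.mul_div_cancel hm (ENNReal.natCast_ne_top _)]
  have hmemF' : ∀ {x}, x ∈ F' ↔ ∃ j, ∃ i ∈ Js j, x ∈ S.lev n i := by
    intro x
    simp only [hF', hJ, mem_iUnion, Finset.mem_biUnion, Finset.mem_univ, true_and, exists_prop]
    constructor
    · rintro ⟨i, ⟨j, hj⟩, hx⟩; exact ⟨j, i, hj, hx⟩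
    · rintro ⟨j, i, hj, hx⟩; exact ⟨i, ⟨j, hj⟩, hx⟩
  have hlevJ : ∀ {x j i}, i ∈ Js j → x ∈ S.lev n i → x ∈ ⋃ i ∈ Js j, S.lev n i :=
    fun hi hx => mem_iUnion₂.2 ⟨_, hi, hx⟩
  have h1 : F' \ F ⊆ err := by
    rintro x ⟨hx, hxF⟩
    obtain ⟨j, i, hi, hx⟩ := hmemF'.1 hx
    exact mem_iUnion.2 ⟨j, Or.inr ⟨hlevJ hi hx, fun h => hxF h.1⟩⟩
  have h3 : F \ F' ⊆ err := by
    rintro x ⟨hxF, hx⟩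
    refine mem_iUnion.2 ⟨P x, Or.inl ⟨⟨hxF, rfl⟩, fun h => hx ?_⟩⟩
    obtain ⟨i, hi, hxi⟩ := mem_iUnion₂.1 h
    exact hmemF'.2 ⟨_, i, hi, hxi⟩
  have hJpos : 0 < J.card := by
    rw [Finset.card_pos, Finset.nonempty_iff_ne_empty]
    intro hJe
    have hF'e : F' = ∅ := by rw [hF', hJe]; simp
    have hlt : S.μ err < S.μ F :=
      (herrle _ (min_le_right _ _)).trans_lt (ENNReal.half_lt_self hF0 hFt)
    rw [hF'e, sdiff_empty] at h3
    exact absurd (measure_mono h3) (not_le.2 hlt)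
  have h2 : F ∩ {x | P x ≠ V (S.phase n J x % J.card)} ⊆ err := by
    rintro x ⟨hxF, hx⟩
    by_contra hxe
    have hxF' : x ∈ F' := by
      by_contra h
      exact hxe (h3 ⟨hxF, h⟩)
    obtain ⟨j, i, hij, hxi⟩ := hmemF'.1 hxF'
    have hiJ : i ∈ J := Finset.mem_biUnion.2 ⟨j, Finset.mem_univ _, hij⟩
    have hir := Finset.mem_range.1 (hJr hiJ)
    have hPx : ∀ j', i ∈ Js j' → P x = j' := by
      intro j' hj'
      by_contra hne
      exact hxe (mem_iUnion.2 ⟨j', Or.inr ⟨hlevJ hj' hxi, fun h => hne h.2⟩⟩)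
    have hlab : lab i = P x := by
      have h : ∃ j, i ∈ Js j := ⟨j, hij⟩
      simp only [lab, dif_pos h]
      exact (hPx _ h.choose_spec).symm
    have hlt : (J.filter (· < i)).card < J.card :=
      Finset.card_lt_card ⟨Finset.filter_subset _ _, fun h => by
        have := (Finset.mem_filter.1 (h hiJ)).2
        omega⟩
    refine hx ?_
    rw [phase_of_mem hir hxi, Nat.mod_eq_of_lt hlt, hV i hiJ, hlab]
  refine ⟨J.card, F', S.phase n J, V, hJpos,
    Finset.measurableSet_biUnion _ fun i _ => measurableSet_lev n i, measurable_phase n J,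
    ae_of_all _ (phase_T hJr), ?_⟩
  have h0 : S.μ err ≤ ε / 3 := herrle _ (min_le_left _ _)
  calc S.μ (F' \ F) + (S.μ (F ∩ {x | P x ≠ V (S.phase n J x % J.card)}) + S.μ (F \ F'))
      ≤ ε / 3 + (ε / 3 + ε / 3) := add_le_add ((measure_mono h1).trans h0)
        (add_le_add ((measure_mono h2).trans h0) ((measure_mono h3).trans h0))
    _ = ε := by rw [← add_assoc, ENNReal.add_thirds]

end StackSystem

/-! ### Positions of the copies of a column -/

section Positions

/-- The position of copy `c` in the stack of copies of a column of height `h` with `s i` spacers on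
copy `i`. -/
def copyPos (h : ℕ) (s : ℕ → ℕ) (c : ℕ) : ℕ := ∑ i ∈ Finset.range c, (h + s i)

lemma copyPos_succ (h : ℕ) (s : ℕ → ℕ) (c : ℕ) :
    copyPos h s (c + 1) = copyPos h s c + (h + s c) := Finset.sum_range_succ _ _

lemma copyPos_mono (h : ℕ) (s : ℕ → ℕ) : Monotone (copyPos h s) :=
  monotone_nat_of_le_succ fun c => by rw [copyPos_succ]; omega

lemma mul_le_copyPos (h : ℕ) (s : ℕ → ℕ) (c : ℕ) : c * h ≤ copyPos h s c := by
  induction c with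
  | zero => simp
  | succ c ih => rw [copyPos_succ, add_mul, one_mul]; omega

lemma length_flatMap_range {f : ℕ → List ℝ} {g : ℕ → ℕ} (r : ℕ) (hf : ∀ i < r, (f i).length = g i) :
    ((List.range r).flatMap f).length = ∑ i ∈ Finset.range r, g i := by
  induction r with
  | zero => simp
  | succ r ih =>
    rw [List.range_succ, List.flatMap_append, List.length_append, ih fun i hi => hf i (by omega),
      Finset.sum_range_succ, List.flatMap_singleton, hf r (by omega)]

lemma getElem?_flatMap_range {f : ℕ → List ℝ} {g : ℕ → ℕ} {r : ℕ}
    (hf : ∀ i < r, (f i).length = g i) {c i : ℕ} (hc : c < r) (hi : i < g c) :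
    ((List.range r).flatMap f)[∑ i ∈ Finset.range c, g i + i]? = (f c)[i]? := by
  induction r with
  | zero => omega
  | succ r ih =>
    have hlen := length_flatMap_range r fun i hi => hf i (by omega)
    rw [List.range_succ, List.flatMap_append, List.flatMap_singleton]
    rcases Nat.lt_succ_iff_lt_or_eq.1 hc with h | rfl
    · rw [List.getElem?_append_left, ih (fun i hi => hf i (by omega)) h]
      rw [hlen]
      calc ∑ i ∈ Finset.range c, g i + i < ∑ i ∈ Finset.range (c + 1), g i := by
            rw [Finset.sum_range_succ]; omega
        _ ≤ _ := Finset.sum_le_sum_of_subset (Finset.range_mono h)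
    · rw [List.getElem?_append_right (by omega), hlen]
      congr 1
      omega

variable {L h r : ℕ} {u : Fin L → ℕ}

lemma spacerCount_of_lt {i : ℕ} (hi : i < r - L - 1) :
    spacerCount L h r u i = (2 * L + 1) * h + ∑ d, u d := if_pos hi

lemma spacerCount_add (d : Fin L) : spacerCount L h r u (r - L - 1 + d) = h + u d := by
  have h1 : ¬ r - L - 1 + d < r - L - 1 := by omega
  have h2 : r - L - 1 + d - (r - L - 1) = (d : ℕ) := by omega
  rw [spacerCount, if_neg h1]
  simp only [h2, d.2, dif_pos]

lemma spacerCount_last (hr : L < r) : spacerCount L h r u (r - 1) =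
    r * h + (r - L - 1) * ((2 * L + 1) * h + ∑ d, u d) + (L * h + ∑ d, u d) := by
  have h1 : ¬ r - 1 < r - L - 1 := by omega
  have h2 : ¬ r - 1 - (r - L - 1) < L := by omega
  rw [spacerCount, if_neg h1, dif_neg h2]

/-- The distance between consecutive copies among the first `r - L - 1`. -/
def copyGap (L h : ℕ) (u : Fin L → ℕ) : ℕ := (2 * L + 2) * h + ∑ d, u d

lemma copyPos_succ_of_lt {c : ℕ} (hc : c < r - L - 1) : copyPos h (spacerCount L h r u) (c + 1) =
    copyPos h (spacerCount L h r u) c + copyGap L h u := by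
  rw [copyPos_succ, spacerCount_of_lt hc, copyGap]; ring

lemma copyPos_add_succ (d : Fin L) : copyPos h (spacerCount L h r u) (r - L - 1 + d + 1) =
    copyPos h (spacerCount L h r u) (r - L - 1 + d) + (2 * h + u d) := by
  rw [copyPos_succ, spacerCount_add]; ring

lemma copyPos_of_le {c : ℕ} (hc : c ≤ r - L - 1) :
    copyPos h (spacerCount L h r u) c = c * copyGap L h u := by
  induction c with
  | zero => simp [copyPos]
  | succ c ih => rw [copyPos_succ_of_lt (by omega), ih (by omega)]; ring

/-- The position of copy `r - L - 1 + t` relative to that of copy `r - L - 1`. -/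
def lastPos (L h : ℕ) (u : Fin L → ℕ) (t : ℕ) : ℕ :=
  ∑ d ∈ Finset.range t, (2 * h + if hd : d < L then u ⟨d, hd⟩ else 0)

lemma lastPos_add_le {t t' : ℕ} (ht : t ≤ t') :
    lastPos L h u t + 2 * h * (t' - t) ≤ lastPos L h u t' := by
  induction t', ht using Nat.le_induction with
  | base => simp
  | succ n hn ih =>
    have h1 : lastPos L h u n + 2 * h ≤ lastPos L h u (n + 1) := by
      simp only [lastPos, Finset.sum_range_succ]
      omega
    rw [Nat.succ_sub hn, Nat.mul_succ]
    omega

/-- This is the purpose of the constant `(2L+1)h + σ`: the last `L` distances together fall short of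
one regular distance by exactly `2h`. -/
lemma lastPos_eq : lastPos L h u L + 2 * h = copyGap L h u := by
  have : lastPos L h u L = ∑ d : Fin L, (2 * h + u d) := by
    rw [lastPos, ← Fin.sum_univ_eq_sum_range fun d => 2 * h + if hd : d < L then u ⟨d, hd⟩ else 0]
    simp
  rw [this, Finset.sum_add_distrib, copyGap]
  simp only [Finset.sum_const, Finset.card_univ, Fintype.card_fin, smul_eq_mul]
  ring

lemma copyPos_add {t : ℕ} (ht : t ≤ L) : copyPos h (spacerCount L h r u) (r - L - 1 + t) =
    (r - L - 1) * copyGap L h u + lastPos L h u t := by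
  induction t with
  | zero => rw [add_zero, copyPos_of_le le_rfl]; simp [lastPos]
  | succ t ih =>
    have htL : t < L := by omega
    rw [← add_assoc, copyPos_add_succ ⟨t, htL⟩, ih (by omega)]
    simp only [lastPos, Finset.sum_range_succ, htL, dif_pos]
    ring

lemma copyPos_eq (hr : L < r) {c : ℕ} (hc : c < r) : copyPos h (spacerCount L h r u) c =
    min c (r - L - 1) * copyGap L h u + lastPos L h u (c - (r - L - 1)) := by
  rcases le_total c (r - L - 1) with h1 | h1
  · rw [copyPos_of_le h1, min_eq_left h1, Nat.sub_eq_zero_of_le h1]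
    simp [lastPos]
  · obtain ⟨t, rfl⟩ := Nat.exists_eq_add_of_le h1
    rw [copyPos_add (by omega), min_eq_right h1, Nat.add_sub_cancel_left]

/-- Confirms that the explicit number of top spacers is the height of the stack below them. -/
lemma copyPos_sub_one_add (hr : L < r) :
    copyPos h (spacerCount L h r u) (r - 1) + h = spacerCount L h r u (r - 1) := by
  have h1 : r - 1 = r - L - 1 + L := by omega
  have h2 := lastPos_eq (L := L) (h := h) (u := u)
  rw [spacerCount_last hr, h1, copyPos_add le_rfl]
  obtain ⟨q, hq⟩ : ∃ q, r = q + L + 1 := ⟨r - L - 1, by omega⟩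
  have h3 : r - L - 1 = q := by omega
  have h4 : lastPos L h u L = 2 * L * h + ∑ d, u d := by
    have : copyGap L h u = 2 * L * h + ∑ d, u d + 2 * h := by rw [copyGap]; ring
    omega
  rw [h3, h4, hq, copyGap]
  ring

/-- Differences of two positions are equal or far apart, if the first copy is not one of the
last `L + 1`. -/
lemma copyPos_separated (hr : L < r) {c c' e e' : ℕ} (hcq : c < r - L - 1) (hc' : c' < r)
    (he : e < r) (he' : e' < r)
    (hne : (copyPos h (spacerCount L h r u) c' : ℤ) - copyPos h (spacerCount L h r u) c ≠
      copyPos h (spacerCount L h r u) e' - copyPos h (spacerCount L h r u) e) :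
    2 * (h : ℤ) ≤ |((copyPos h (spacerCount L h r u) c' : ℤ) -
      copyPos h (spacerCount L h r u) c) -
        (copyPos h (spacerCount L h r u) e' - copyPos h (spacerCount L h r u) e)| := by
  -- Copies up to `q` sit at multiples of `a`, the later ones at `q * a + τ t`. The values `τ 0, …,
  -- τ L` lie in `[0, a - 2h]` and are at least `2h` apart. An ascending difference is thus `s * a +
  -- y` with `0 ≤ y ≤ a - 2h`, and only equal `s` need attention. Without `c < q`, two distances `2h
  -- + u_d` could be unequal but close.
  set p := copyPos h (spacerCount L h r u) with hp
  set a : ℤ := (copyGap L h u : ℤ) with ha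
  set q := r - L - 1 with hq
  let τ : ℕ → ℤ := fun t => lastPos L h u t
  have hpe : ∀ c < r, (p c : ℤ) = (min c q : ℕ) * a + τ (c - q) := by
    intro c hc
    have := copyPos_eq (h := h) (u := u) hr hc
    simp only [hp, τ, ha]
    exact_mod_cast this
  have hτ0 : τ 0 = 0 := by simp [τ, lastPos]
  have hτm : ∀ t t', t < t' → τ t + 2 * h ≤ τ t' := by
    intro t t' htt
    have h1 := lastPos_add_le (L := L) (h := h) (u := u) htt.le
    have h2 : 2 * h * 1 ≤ 2 * h * (t' - t) := Nat.mul_le_mul_left _ (by omega)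
    simp only [τ]
    have h3 : lastPos L h u t + 2 * h ≤ lastPos L h u t' := by omega
    exact_mod_cast h3
  have hτL : τ L + 2 * h = a := by
    simp only [τ, ha]
    exact_mod_cast lastPos_eq (L := L) (h := h) (u := u)
  have hh : (0 : ℤ) ≤ h := Int.natCast_nonneg _
  have hτle : ∀ t t', t ≤ t' → τ t ≤ τ t' := by
    intro t t' htt
    rcases htt.eq_or_lt with rfl | h1
    · exact le_rfl
    · have := hτm t t' h1; linarith
  have hτa : ∀ t ≤ L, τ t ≤ a - 2 * h := fun t ht => by
    have := hτle t L ht; linarith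
  have ha2 : 2 * (h : ℤ) ≤ a := by have := hτle 0 L (by omega); linarith
  have hpm : ∀ c c', c < c' → c' < r → (p c : ℤ) + 2 * h ≤ p c' := by
    intro c c' hcc hc
    rw [hpe c (by omega), hpe c' hc]
    rcases lt_or_ge c q with h1 | h1
    · have h2 : ((min c q : ℕ) : ℤ) + 1 ≤ (min c' q : ℕ) := by omega
      have h3 : c - q = 0 := by omega
      have h4 := hτle 0 (c' - q) (by omega)
      rw [h3, hτ0]
      nlinarith
    · have h2 : (min c q : ℕ) = q := by omega
      have h3 : (min c' q : ℕ) = q := by omega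
      have := hτm (c - q) (c' - q) (by omega)
      rw [h2, h3]
      linarith
  -- the comparison of two ascending differences
  have far : ∀ s s' x y : ℤ, 0 ≤ x → x ≤ a - 2 * h → 0 ≤ y → y ≤ a - 2 * h → s < s' →
      (s * a + x) + 2 * h ≤ s' * a + y := by
    intro s s' x y _ hx hy _ hss
    have : (s + 1) * a ≤ s' * a := mul_le_mul_of_nonneg_right hss (by linarith)
    linarith
  -- parts of an ascending difference
  have parts : ∀ e e', e < e' → e' < r → ∃ (s : ℕ) (y : ℤ), 0 ≤ y ∧ y ≤ a - 2 * h ∧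
      (p e' : ℤ) - p e = s * a + y ∧ s = min e' q - min e q ∧ y = τ (e' - q) - τ (e - q) := by
    intro e e' hee he'
    refine ⟨min e' q - min e q, τ (e' - q) - τ (e - q), ?_, ?_, ?_, rfl, rfl⟩
    · have := hτle (e - q) (e' - q) (by omega); linarith
    · have h1 := hτa (e' - q) (by omega)
      have h2 := hτle 0 (e - q) (by omega)
      linarith
    · rw [hpe e (by omega), hpe e' he']
      have : ((min e' q - min e q : ℕ) : ℤ) = (min e' q : ℕ) - (min e q : ℕ) := by
        rw [Nat.cast_sub]; omega
      rw [this]; ring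
  have conclude : ∀ D D' : ℤ, D ≠ D' → (∃ (s : ℕ) (x : ℤ) (s' : ℕ) (y : ℤ), 0 ≤ x ∧
      x ≤ a - 2 * h ∧ 0 ≤ y ∧ y ≤ a - 2 * h ∧ D = s * a + x ∧ D' = s' * a + y ∧
      (s = s' → x = y ∨ x + 2 * h ≤ y ∨ y + 2 * h ≤ x)) → 2 * (h : ℤ) ≤ |D - D'| := by
    rintro D D' hD ⟨s, x, s', y, hx0, hx1, hy0, hy1, rfl, rfl, hss⟩
    rcases lt_trichotomy s s' with h1 | h1 | h1
    · have := far s s' x y hx0 hx1 hy0 hy1 (by exact_mod_cast h1)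
      rw [abs_sub_comm]
      exact le_trans (by linarith) (le_abs_self _)
    · subst h1
      rcases hss rfl with h2 | h2 | h2
      · exact absurd (by rw [h2]) hD
      · rw [abs_sub_comm]
        exact le_trans (by linarith) (le_abs_self _)
      · exact le_trans (by linarith) (le_abs_self _)
    · have := far s' s y x hy0 hy1 hx0 hx1 (by exact_mod_cast h1)
      exact le_trans (by linarith) (le_abs_self _)
  rcases lt_trichotomy c c' with h1 | h1 | h1 <;> rcases lt_trichotomy e e' with h2 | h2 | h2
  · obtain ⟨s, x, hx0, hx1, hs, hsv, hxv⟩ := parts c c' h1 hc'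
    obtain ⟨s', y, hy0, hy1, hs', hsv', hyv⟩ := parts e e' h2 he'
    refine conclude _ _ hne ⟨s, x, s', y, hx0, hx1, hy0, hy1, hs, hs', fun hss => ?_⟩
    -- As `c < q`, the number `s = s'` is at least `1`, so `e` also comes before `q`, and both
    -- remainders are values of `τ`.
    have h3 : e < q := by omega
    have h4 : c - q = 0 := by omega
    have h5 : e - q = 0 := by omega
    rw [hxv, hyv, h4, h5, hτ0, sub_zero, sub_zero]
    rcases lt_trichotomy (c' - q) (e' - q) with h6 | h6 | h6
    · exact Or.inr (Or.inl (hτm _ _ h6))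
    · rw [h6]; exact Or.inl rfl
    · exact Or.inr (Or.inr (hτm _ _ h6))
  · subst h2
    have := hpm c c' h1 hc'
    exact le_trans (by linarith) (le_abs_self _)
  · have h3 := hpm c c' h1 hc'
    have h4 := hpm e' e h2 he
    exact le_trans (by linarith) (le_abs_self _)
  · subst h1
    have := hpm e e' h2 he'
    rw [abs_sub_comm]
    exact le_trans (by linarith) (le_abs_self _)
  · subst h1 h2
    exact absurd (by ring) hne
  · subst h1
    have := hpm e' e h2 he
    exact le_trans (by linarith) (le_abs_self _)
  · have h3 := hpm c' c h1 (by omega)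
    have h4 := hpm e e' h2 he'
    rw [abs_sub_comm]
    exact le_trans (by linarith) (le_abs_self _)
  · subst h2
    have := hpm c' c h1 (by omega)
    rw [abs_sub_comm]
    exact le_trans (by linarith) (le_abs_self _)
  · obtain ⟨s, x, hx0, hx1, hs, hsv, hxv⟩ := parts c' c h1 (by omega)
    obtain ⟨s', y, hy0, hy1, hs', hsv', hyv⟩ := parts e' e h2 he
    have h3 : ((p c' : ℤ) - p c) - (p e' - p e) = ((p e : ℤ) - p e') - (p c - p c') := by ring
    rw [h3, abs_sub_comm]
    refine conclude _ _ (fun h => hne (by linarith))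
      ⟨s, x, s', y, hx0, hx1, hy0, hy1, hs, hs', fun hss => ?_⟩
    -- Here `c' < c < q`, so the first remainder is `0`; again `s' = s ≥ 1` places `e'` before `q`.
    have h4 : e' < q := by omega
    have h5 : c - q = 0 := by omega
    have h6 : c' - q = 0 := by omega
    have h7 : e' - q = 0 := by omega
    rw [hxv, hyv, h5, h6, h7, hτ0, sub_zero, sub_zero]
    rcases Nat.eq_zero_or_pos (e - q) with h8 | h8
    · rw [h8, hτ0]; exact Or.inl rfl
    · have := hτm 0 (e - q) h8
      rw [hτ0] at this
      exact Or.inr (Or.inl this)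

end Positions

/-! ### The column system of a construction -/

section Construction

variable {L : ℕ} {r : ℕ → ℕ} {v : ℕ → Fin L → ℕ} {C : ℕ → IntervalColumn}

/-- The number of spacers on copy `i` in step `n` of a construction. -/
def stepSpacers (L : ℕ) (r : ℕ → ℕ) (v : ℕ → Fin L → ℕ) (C : ℕ → IntervalColumn) (n : ℕ) : ℕ → ℕ :=
  spacerCount L (C n).height (r n) (v (padicValNat 2 (n + 1)))

lemma height_succ (hC : IsConstruction L r v C) (n : ℕ) :
    (C (n + 1)).height = copyPos (C n).height (stepSpacers L r v C n) (r n) := by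
  obtain ⟨-, ⟨S, hS, hbase⟩, -⟩ := hC.2 n
  rw [IntervalColumn.height, hbase]
  refine length_flatMap_range _ fun i hi => ?_
  simp [hS i hi, IntervalColumn.height, stepSpacers]

lemma base_copy (hC : IsConstruction L r v C) {n c i : ℕ} (hc : c < r n)
    (hi : i < (C n).height) :
    (C (n + 1)).base.getD (copyPos (C n).height (stepSpacers L r v C n) c + i) 0 =
      (C n).base.getD i 0 + c * (C (n + 1)).width := by
  obtain ⟨-, ⟨S, hS, hbase⟩, -⟩ := hC.2 n
  have hi' : i < (C n).base.length := hi
  rw [List.getD_eq_getElem?_getD, hbase, copyPos, getElem?_flatMap_range _ hc]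
  · rw [List.getElem?_append_left (by simpa using hi'), List.getElem?_map,
      List.getElem?_eq_getElem hi', List.getD_eq_getElem _ _ hi']
    rfl
  · omega
  · intro i hi
    simp [hS i hi, IntervalColumn.height, stepSpacers]

lemma height_pos (hC : IsConstruction L r v C) (hr : ∀ n, L < r n) (n : ℕ) :
    0 < (C n).height := by
  induction n with
  | zero => rw [hC.1]; simp [IntervalColumn.height]
  | succ n ih =>
    rw [height_succ hC]
    refine lt_of_lt_of_le ?_ (mul_le_copyPos _ _ _)
    exact Nat.mul_pos (by have := hr n; omega) ih

lemma width_pos (hC : IsConstruction L r v C) (hr : ∀ n, L < r n) (n : ℕ) : 0 < (C n).width := by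
  induction n with
  | zero => rw [hC.1]; exact one_pos
  | succ n ih =>
    rw [(hC.2 n).1]
    have : 0 < r n := by have := hr n; omega
    positivity

lemma height_room (hC : IsConstruction L r v C) (hr : ∀ n, L < r n) {n c : ℕ}
    (hc : c < r n) : copyPos (C n).height (stepSpacers L r v C n) c + 2 * (C n).height ≤
      (C (n + 1)).height := by
  have h1 := hr n
  have h2 := copyPos_mono (C n).height (stepSpacers L r v C n) (show c ≤ r n - 1 by omega)
  have h3 := copyPos_succ (C n).height (stepSpacers L r v C n) (r n - 1)
  have h4 : copyPos (C n).height (stepSpacers L r v C n) (r n - 1) + (C n).height =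
    stepSpacers L r v C n (r n - 1) := copyPos_sub_one_add h1
  rw [Nat.sub_add_cancel (by omega), ← height_succ hC] at h3
  omega

/-- The column system of a construction. -/
def columnSystem (hC : IsConstruction L r v C) (hL : 1 ≤ L) (hr : ∀ n, L < r n) :
    ColumnSystem where
  X := stackSpace C
  h n := (C n).height
  r := r
  pos n := copyPos (C n).height (stepSpacers L r v C n)
  w n := (C n).width
  b n i := (C n).base.getD i 0
  w_pos := width_pos hC hr
  two_le n := by have := hr n; omega
  w_succ n := by
    have : (r n : ℝ) ≠ 0 := by have := hr n; exact_mod_cast (by omega : r n ≠ 0)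
    rw [(hC.2 n).1]; field_simp
  h_pos := height_pos hC hr
  disj n i j hi hj hij := by
    have hpair : (C n).base.Pairwise
        fun a b => Disjoint (Ico a (a + (C n).width)) (Ico b (b + (C n).width)) := by
      cases n with
      | zero => rw [hC.1]; simp
      | succ n => exact (hC.2 n).2.2
    rw [List.getD_eq_getElem _ _ hi, List.getD_eq_getElem _ _ hj]
    rcases lt_or_gt_of_ne hij with h | h
    · exact List.pairwise_iff_getElem.1 hpair _ _ hi hj h
    · exact (List.pairwise_iff_getElem.1 hpair _ _ hj hi h).symm
  base_succ n c i hc hi := base_copy hC hc hi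
  room n c i hc hi := by have := height_room hC hr hc; omega
  mem_X x := by
    simp only [stackSpace, mem_iUnion, exists_prop]
    refine exists_congr fun n => ⟨?_, ?_⟩
    · rintro ⟨a, ha, hx⟩
      obtain ⟨i, hi, rfl⟩ := List.getElem_of_mem ha
      exact ⟨i, hi, by rwa [List.getD_eq_getElem _ _ hi]⟩
    · rintro ⟨i, hi, hx⟩
      rw [List.getD_eq_getElem _ _ hi] at hx
      exact ⟨_, List.getElem_mem hi, hx⟩

lemma stackStep_iff (hC : IsConstruction L r v C) (hL : 1 ≤ L) (hr : ∀ n, L < r n) {x y : ℝ} :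
    StackStep C x y ↔ ∃ n i, i + 1 < (columnSystem hC hL hr).h n ∧
      x ∈ (columnSystem hC hL hr).lev n i ∧
      y = x + ((columnSystem hC hL hr).b n (i + 1) - (columnSystem hC hL hr).b n i) := by
  constructor
  · rintro ⟨n, i, hi, hx, hy⟩
    refine ⟨n, i, hi, ?_, ?_⟩
    · simpa only [ColumnSystem.lev, columnSystem, List.getD_eq_getElem _ _ (Nat.lt_of_succ_lt hi)]
        using hx
    · simpa only [columnSystem, List.getD_eq_getElem _ _ (Nat.lt_of_succ_lt hi),
        List.getD_eq_getElem _ _ hi] using hy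
  · rintro ⟨n, i, hi, hx, hy⟩
    have hi' : i + 1 < (C n).base.length := hi
    refine ⟨n, i, hi', ?_, ?_⟩
    · simpa only [ColumnSystem.lev, columnSystem, List.getD_eq_getElem _ _ (Nat.lt_of_succ_lt hi')]
        using hx
    · simpa only [columnSystem, List.getD_eq_getElem _ _ (Nat.lt_of_succ_lt hi'),
        List.getD_eq_getElem _ _ hi'] using hy

lemma stackStep_unique (hC : IsConstruction L r v C) (hL : 1 ≤ L) (hr : ∀ n, L < r n) {x y y' : ℝ}
    (h : StackStep C x y) (h' : StackStep C x y') : y = y' := by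
  obtain ⟨n, i, hi, hx, rfl⟩ := (stackStep_iff hC hL hr).1 h
  obtain ⟨n', i', hi', hx', rfl⟩ := (stackStep_iff hC hL hr).1 h'
  rcases le_total n n' with hn | hn
  · rw [ColumnSystem.base_sub_eq hn hi hx hi' hx']
  · rw [ColumnSystem.base_sub_eq hn hi' hx' hi hx]

/-- The column system of a construction, with its transformation. -/
def stackSystem (hC : IsConstruction L r v C) (hL : 1 ≤ L) (hr : ∀ n, L < r n) : StackSystem where
  toColumnSystem := columnSystem hC hL hr
  T := stackMap C
  step n i x hi hx := by
    have hstep : StackStep C x _ := (stackStep_iff hC hL hr).2 ⟨n, i, hi, hx, rfl⟩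
    have hex : ∃ y, StackStep C x y := ⟨_, hstep⟩
    rw [stackMap, dif_pos hex]
    exact stackStep_unique hC hL hr hex.choose_spec hstep
  off x hx := by
    refine dif_neg ?_
    rintro ⟨y, hy⟩
    obtain ⟨n, i, hi, hxi, -⟩ := (stackStep_iff hC hL hr).1 hy
    exact hx (ColumnSystem.lev_subset_X (by omega) hxi)

/-! ### Existence of constructions -/

/-- All spacers are placed to the right of the old column, on a grid of mesh `w`; `Nat.pair` gives
the spacers of different subcolumns different grid cells. -/
lemma exists_cutStack (D : IntervalColumn) (hw : 0 < D.width)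
    (hD : D.base.Pairwise fun a b => Disjoint (Ico a (a + D.width)) (Ico b (b + D.width)))
    {r : ℕ} (hr : 0 < r) (s : ℕ → ℕ) : ∃ D', D.CutStack D' r s := by
  obtain ⟨B, hB⟩ : ∃ B : ℝ, ∀ a ∈ D.base, a + D.width ≤ B := by
    obtain ⟨B, hB⟩ := (D.base.toFinset.image fun a => a + D.width).bddAbove
    refine ⟨B, fun a ha => hB ?_⟩
    simp only [Finset.coe_image, List.coe_toFinset, mem_image, mem_ofPred_eq]
    exact ⟨a, ha, rfl⟩
  set w := D.width / r with hwdef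
  have hr' : (0 : ℝ) < r := by exact_mod_cast hr
  have hw' : 0 < w := by positivity
  have hrw : (r : ℝ) * w = D.width := by rw [hwdef]; field_simp
  let S : ℕ → List ℝ := fun i => (List.range (s i)).map fun t => B + (Nat.pair i t : ℝ) * w
  have hcopy : ∀ i < r, ∀ a, Ico (a + (i : ℝ) * w) (a + i * w + w) ⊆ Ico a (a + D.width) := by
    intro i hi a x hx
    have h1 : (i : ℝ) + 1 ≤ r := by exact_mod_cast hi
    have h2 : ((i : ℝ) + 1) * w ≤ r * w := by gcongr
    have h3 : 0 ≤ (i : ℝ) * w := by positivity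
    rw [hrw] at h2
    constructor <;> linarith [hx.1, hx.2]
  have hsp : ∀ i, ∀ b ∈ S i, B ≤ b := by
    intro i b hb
    obtain ⟨t, -, rfl⟩ := List.mem_map.1 hb
    have : 0 ≤ (Nat.pair i t : ℝ) * w := by positivity
    linarith
  have hgrid : ∀ x : ℝ, ∀ p p' : ℕ, p ≠ p' →
      Disjoint (Ico (x + (p : ℝ) * w) (x + p * w + w)) (Ico (x + (p' : ℝ) * w) (x + p' * w + w)) := by
    have key : ∀ x : ℝ, ∀ p p' : ℕ, p < p' →
        Disjoint (Ico (x + (p : ℝ) * w) (x + p * w + w))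
          (Ico (x + (p' : ℝ) * w) (x + p' * w + w)) := by
      intro x p p' hpp
      have h1 : (p : ℝ) + 1 ≤ p' := by exact_mod_cast hpp
      have h2 : ((p : ℝ) + 1) * w ≤ p' * w := by gcongr
      exact Set.disjoint_left.2 fun z hz hz' => by linarith [hz.2, hz'.1]
    intro x p p' hpp
    rcases lt_or_gt_of_ne hpp with h | h
    · exact key x p p' h
    · exact (key x p' p h).symm
  have hcs : ∀ i < r, ∀ a ∈ D.base, ∀ b, B ≤ b →
      Disjoint (Ico (a + (i : ℝ) * w) (a + i * w + w)) (Ico b (b + w)) := by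
    intro i hi a ha b hb
    refine Set.disjoint_left.2 fun z hz hz' => ?_
    linarith [(hcopy i hi a hz).2, hB a ha, hz'.1]
  refine ⟨⟨w, (List.range r).flatMap fun i : ℕ => D.base.map (fun a => a + (i : ℝ) * w) ++ S i⟩,
    rfl, ⟨S, fun i _ => by simp [S], rfl⟩, ?_⟩
  rw [List.pairwise_flatMap]
  constructor
  · intro i hi
    rw [List.mem_range] at hi
    rw [List.pairwise_append]
    refine ⟨?_, ?_, ?_⟩
    · rw [List.pairwise_map]
      exact hD.imp fun hab => hab.mono (hcopy i hi _) (hcopy i hi _)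
    · rw [List.pairwise_map]
      refine List.nodup_range.imp fun hab => hgrid _ _ _ fun h => hab ?_
      exact (Nat.pair_eq_pair.1 h).2
    · intro a ha b hb
      obtain ⟨a', ha', rfl⟩ := List.mem_map.1 ha
      exact hcs i hi a' ha' b (hsp i b hb)
  · refine List.pairwise_lt_range.imp_of_mem fun {i j} hi hj hij => ?_
    rw [List.mem_range] at hi hj
    intro a ha b hb
    rw [List.mem_append] at ha hb
    rcases ha with ha | ha <;> rcases hb with hb | hb
    · obtain ⟨a', ha', rfl⟩ := List.mem_map.1 ha
      obtain ⟨b', hb', rfl⟩ := List.mem_map.1 hb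
      by_cases hab : a' = b'
      · subst hab
        exact hgrid a' i j hij.ne
      · have : Std.Symm fun a b : ℝ =>
            Disjoint (Ico a (a + D.width)) (Ico b (b + D.width)) := ⟨fun _ _ h => h.symm⟩
        have := hD.forall ha' hb' hab
        exact this.mono (hcopy i hi _) (hcopy j hj _)
    · obtain ⟨a', ha', rfl⟩ := List.mem_map.1 ha
      exact hcs i hi a' ha' b (hsp j b hb)
    · obtain ⟨b', hb', rfl⟩ := List.mem_map.1 hb
      exact (hcs j hj b' hb' a (hsp i a ha)).symm
    · obtain ⟨t, -, rfl⟩ := List.mem_map.1 ha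
      obtain ⟨t', -, rfl⟩ := List.mem_map.1 hb
      exact hgrid _ _ _ fun h => hij.ne (Nat.pair_eq_pair.1 h).1

lemma exists_isConstruction (hr : ∀ n, L < r n) : ∃ C, IsConstruction L r v C := by
  let Good := {D : IntervalColumn // 0 < D.width ∧
    D.base.Pairwise fun a b => Disjoint (Ico a (a + D.width)) (Ico b (b + D.width))}
  have hstep : ∀ (n : ℕ) (D : Good), ∃ D' : Good, D.1.CutStack D'.1 (r n)
      (spacerCount L D.1.height (r n) (v (padicValNat 2 (n + 1)))) := by
    intro n D
    have hrn : 0 < r n := by have := hr n; omega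
    obtain ⟨D', hD'⟩ := exists_cutStack D.1 D.2.1 D.2.2 hrn
      (spacerCount L D.1.height (r n) (v (padicValNat 2 (n + 1))))
    refine ⟨⟨D', ?_, hD'.2.2⟩, hD'⟩
    rw [hD'.1]
    have := D.2.1
    positivity
  choose next hnext using hstep
  let G : ℕ → Good := fun n => Nat.rec ⟨⟨1, [0]⟩, one_pos, by simp⟩ next n
  exact ⟨fun n => (G n).1, rfl, fun n => hnext n (G n)⟩

end Construction

/-! ### Series along the steps in which a given tuple is used -/

section Series

lemma padicValNat_two_pow_mul (j n : ℕ) : padicValNat 2 (2 ^ j * (2 * n + 1)) = j := by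
  have : ¬ 2 ∣ 2 * n + 1 := by omega
  rw [padicValNat.mul (by positivity) (by omega), padicValNat.prime_pow,
    padicValNat.eq_zero_of_not_dvd this, add_zero]

/-- The steps in question contain the residue class of `2 ^ j - 1` modulo `2 ^ (j + 1)`, and a
divergent antitone series diverges along every residue class. -/
lemma not_summable_indicator_padicValNat {f : ℕ → ℝ} (hf : Antitone f) (hs : ¬ Summable f) (j : ℕ) :
    ¬ Summable ({l | padicValNat 2 (l + 1) = j}.indicator f) := by
  intro h
  refine hs ((summable_indicator_mod_iff hf ((2 ^ j - 1 : ℕ) : ZMod (2 ^ (j + 1)))).1 ?_)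
  rw [summable_indicator_mod_iff_summable]
  have hinj : Function.Injective fun n : ℕ => 2 ^ (j + 1) * n + (2 ^ j - 1) := by
    intro a b hab
    exact Nat.eq_of_mul_eq_mul_left (by positivity) (Nat.add_right_cancel hab)
  refine (h.comp_injective hinj).congr fun n => ?_
  refine indicator_of_mem ?_ f
  have h1 : 2 ^ (j + 1) * n + (2 ^ j - 1) + 1 = 2 ^ j * (2 * n + 1) := by
    have := Nat.one_le_two_pow (n := j)
    rw [add_assoc, Nat.sub_add_cancel this]; ring
  change padicValNat 2 _ = j
  rw [h1, padicValNat_two_pow_mul]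

lemma tendsto_prod_one_sub_zero {x : ℕ → ℝ} (hx : ∀ l, 0 ≤ x l) (hs : ¬ Summable x) (n : ℕ) :
    Tendsto (fun K => ∏ l ∈ Finset.range K, ENNReal.ofReal (1 - x (n + l))) atTop (nhds 0) := by
  have hs' : ¬ Summable fun l => x (n + l) := fun h =>
    hs ((summable_nat_add_iff n).1 (by simpa only [add_comm] using h))
  have h1 := (not_summable_iff_tendsto_nat_atTop_of_nonneg fun l => hx (n + l)).1 hs'
  have h2 := ENNReal.tendsto_ofReal (Real.tendsto_exp_neg_atTop_nhds_zero.comp h1)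
  rw [ENNReal.ofReal_zero] at h2
  refine tendsto_of_tendsto_of_tendsto_of_le_of_le tendsto_const_nhds h2 (fun _ => zero_le) ?_
  intro K
  simp only [Function.comp_apply]
  rw [← Finset.sum_neg_distrib, Real.exp_sum, ENNReal.ofReal_prod_of_nonneg
    fun l _ => (Real.exp_pos _).le]
  refine Finset.prod_le_prod' fun l _ => ENNReal.ofReal_le_ofReal ?_
  linarith [Real.add_one_le_exp (-x (n + l))]

end Series

/-! ### Parameters -/

section Parameters

variable {L : ℕ}

/-- The distinct values of `x` are at most `L` in number and extend to a set of `L` positive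
integers. Repetitions are harmless, as several coordinates may use the same entry. Subtracting `1`
first makes positivity automatic. -/
lemma exists_mem_increasingTuples {m : ℕ} (hm : m ≤ L) (x : Fin m → ℕ) (hx : ∀ i, 0 < x i) :
    ∃ u ∈ increasingTuples L, ∀ i, ∃ d, u d = x i := by
  classical
  obtain ⟨t, ht, hcard⟩ := Infinite.exists_superset_card_eq (Finset.univ.image fun i => x i - 1) L
    (Finset.card_image_le.trans (by simpa using hm))
  refine ⟨fun d => t.orderEmbOfFin hcard d + 1, ⟨fun d e h => ?_, fun d => Nat.succ_pos _⟩,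
    fun i => ?_⟩
  · exact Nat.succ_lt_succ ((t.orderEmbOfFin hcard).strictMono h)
  · have h1 : x i - 1 ∈ range (t.orderEmbOfFin hcard) := by
      rw [Finset.range_orderEmbOfFin]
      exact ht (Finset.mem_image_of_mem _ (Finset.mem_univ i))
    obtain ⟨d, hd⟩ := h1
    exact ⟨d, by have := hx i; simp only [hd]; omega⟩

lemma exists_listing (L : ℕ) : ∃ v : ℕ → Fin L → ℕ, range v = increasingTuples L := by
  have hne : (increasingTuples L).Nonempty :=
    ⟨fun d => d + 1, fun a b h => by simpa using h, fun d => Nat.succ_pos _⟩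
  obtain ⟨v, hv⟩ := (Set.to_countable (increasingTuples L)).exists_eq_range hne
  exact ⟨v, hv.symm⟩

/-- The choice `r n ≈ n ^ (1 / k)` turns the two series into those of `1 / n` and `n ^ (-(1 + 1 /
k))`. -/
lemma exists_parameter {k : ℕ} (hk : 1 ≤ k) (L : ℕ) :
    ∃ (r : ℕ → ℕ) (v : ℕ → Fin L → ℕ), IsParameter L r v ∧
      ¬ Summable (fun n => (1 / (r n : ℝ)) ^ k) ∧
      Summable (fun n => (1 / (r n : ℝ)) ^ (k + 1)) := by
  obtain ⟨v, hv⟩ := exists_listing L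
  have hk0 : (0 : ℝ) < k := by exact_mod_cast hk
  let ρ : ℕ → ℝ := fun n => (n : ℝ) ^ (1 / (k : ℝ))
  have hρ : ∀ n, 0 ≤ ρ n := fun n => by positivity
  have hρk : ∀ n, ρ n ^ k = n := fun n => by
    rw [← Real.rpow_natCast, ← Real.rpow_mul (by positivity), one_div_mul_cancel hk0.ne',
      Real.rpow_one]
  have hmono : Monotone ρ := fun a b hab =>
    Real.rpow_le_rpow (by positivity) (by exact_mod_cast hab) (by positivity)
  refine ⟨fun n => L + 1 + ⌊ρ n⌋₊, v, ⟨fun a b hab => ?_, fun n => by omega, hv⟩, ?_, ?_⟩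
  · exact Nat.add_le_add_left (Nat.floor_mono (hmono hab)) _
  · intro hs
    have h1 : Summable fun n : ℕ => ((1 / ((L : ℝ) + 2)) ^ k) * (1 / (n : ℝ)) := by
      refine (hs.of_norm_bounded_eventually_nat ?_)
      filter_upwards [eventually_ge_atTop 1] with n hn
      have hn1 : (1 : ℝ) ≤ ρ n := Real.one_le_rpow (by exact_mod_cast hn) (by positivity)
      have hfl : ((L + 1 + ⌊ρ n⌋₊ : ℕ) : ℝ) ≤ (L + 2) * ρ n := by
        push_cast
        have := Nat.floor_le (hρ n)
        nlinarith [(Nat.cast_nonneg L : (0 : ℝ) ≤ L)]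
      rw [Real.norm_of_nonneg (by positivity), ← hρk n, ← one_div_pow, ← mul_pow]
      gcongr
      rw [one_div_mul_one_div]
      exact one_div_le_one_div_of_le (by positivity) hfl
    rw [summable_mul_left_iff (by positivity)] at h1
    exact Real.not_summable_one_div_natCast h1
  · have h1 : Summable fun n : ℕ => 1 / (n : ℝ) ^ (1 + 1 / (k : ℝ)) :=
      Real.summable_one_div_nat_rpow.2 (by linarith [one_div_pos.2 hk0])
    refine h1.of_norm_bounded_eventually_nat ?_
    filter_upwards [eventually_ge_atTop 1] with n hn
    have hn0 : (0 : ℝ) < n := by exact_mod_cast hn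
    have hn1 : (0 : ℝ) < ρ n := Real.rpow_pos_of_pos hn0 _
    have h2 : (n : ℝ) ^ (1 + 1 / (k : ℝ)) = ρ n ^ (k + 1) := by
      rw [Real.rpow_add hn0, Real.rpow_one, pow_succ, hρk]
    rw [Real.norm_of_nonneg (by positivity), h2, ← one_div_pow]
    gcongr
    push_cast
    have := Nat.lt_floor_add_one (ρ n)
    linarith [(Nat.cast_nonneg L : (0 : ℝ) ≤ L)]

end Parameters

/-! ### The four properties of a construction -/

section Properties

variable {L : ℕ} {r : ℕ → ℕ} {v : ℕ → Fin L → ℕ} {C : ℕ → IntervalColumn}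

lemma height_growth (hC : IsConstruction L r v C) (hr : ∀ n, L < r n) (n : ℕ) :
    2 * (r n * (C n).height + ∑ d, v (padicValNat 2 (n + 1)) d) ≤ (C (n + 1)).height := by
  have h1 := hr n
  have h3 := copyPos_succ (C n).height (stepSpacers L r v C n) (r n - 1)
  have h4 : copyPos (C n).height (stepSpacers L r v C n) (r n - 1) + (C n).height =
    stepSpacers L r v C n (r n - 1) := copyPos_sub_one_add h1
  have h5 : stepSpacers L r v C n (r n - 1) = _ := spacerCount_last h1
  rw [Nat.sub_add_cancel (by omega), ← height_succ hC] at h3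
  have h6 : r n * (C n).height + ∑ d, v (padicValNat 2 (n + 1)) d ≤
      stepSpacers L r v C n (r n - 1) := by rw [h5]; omega
  omega

lemma strictMono_copyGap (hC : IsConstruction L r v C) (hL : 1 ≤ L) (hr : ∀ n, L < r n) :
    StrictMono fun n => copyGap L (C n).height (v (padicValNat 2 (n + 1))) := by
  refine strictMono_nat_of_lt_succ fun n => ?_
  have h1 := height_growth hC hr n
  have h2 := height_pos hC hr n
  have h3 : 2 * (C n).height ≤ r n * (C n).height :=
    Nat.mul_le_mul_right _ (by have := hr n; omega)
  have h4 : (2 * L + 2) * (2 * (2 * (C n).height + ∑ d, v (padicValNat 2 (n + 1)) d)) ≤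
      (2 * L + 2) * (C (n + 1)).height := Nat.mul_le_mul_left _ (by omega)
  have h5 : 0 < (2 * L + 2) * (C n).height := Nat.mul_pos (by omega) h2
  have h6 := Nat.zero_le (L * ∑ d, v (padicValNat 2 (n + 1)) d)
  simp only [copyGap]
  linarith [Nat.zero_le (∑ d, v (padicValNat 2 (n + 1)) d),
    Nat.zero_le (∑ d, v (padicValNat 2 (n + 1 + 1)) d)]

/-- In coordinate `i`, pass from copy `r l - L - 1 + d i` to the next one, at distance `2h + N + a i
- b i`. Going from level `a i` to level `b i` then takes the time `2h + N`, which does not depend on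
`i`. -/
lemma connects_stackSystem (hC : IsConstruction L r v C) (hL : 1 ≤ L) (hr : ∀ n, L < r n)
    {m l N : ℕ} {a b : Fin m → ℕ} (hb : ∀ i, b i < N) {d : Fin m → Fin L} (hm : 1 ≤ m)
    (hd : ∀ i, v (padicValNat 2 (l + 1)) (d i) = N + a i - b i) :
    (stackSystem hC hL hr).Connects l a b := by
  have hrl := hr l
  refine ⟨fun i => r l - L - 1 + d i, ?_, fun i => r l - L - 1 + d i + 1, ?_, ?_,
    2 * (C l).height + N, fun i => ?_⟩
  · exact StackSystem.mem_copies.2 fun i => show _ < r l by have := (d i).2; omega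
  · exact StackSystem.mem_copies.2 fun i => show _ < r l by have := (d i).2; omega
  · intro h
    have := congrFun h ⟨0, hm⟩
    simp at this
  · have h1 := copyPos_add_succ (h := (C l).height) (r := r l)
      (u := v (padicValNat 2 (l + 1))) (d i)
    have h2 := hd i
    have h3 := hb i
    change copyPos (C l).height (stepSpacers L r v C l) _ + a i + _ =
      copyPos (C l).height (stepSpacers L r v C l) _ + b i
    simp only [stepSpacers, h1]
    omega

theorem ergodic_stackSystem (hp : IsParameter L r v) (hC : IsConstruction L r v C) (hL : 1 ≤ L)
    {m : ℕ} (hm : 1 ≤ m) (hmL : m ≤ L) (hs : ¬ Summable fun n => (1 / (r n : ℝ)) ^ m) :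
    Ergodic (prodPow (stackMap C) m) (Measure.pi fun _ : Fin m => stackMeasure C) := by
  have hr2 : ∀ n, 2 ≤ r n := fun n => by have := hp.lt n; omega
  have hr0 : ∀ n, (0 : ℝ) < r n := fun n => by exact_mod_cast (by have := hr2 n; omega : 0 < r n)
  refine StackSystem.ergodic_prodPow (S := stackSystem hC hL hp.lt) fun n a b ha hb => ?_
  -- The summand `h_n + 1` makes all entries positive, so the truncated subtraction is a true one.
  obtain ⟨u, hu, hud⟩ := exists_mem_increasingTuples hmL
    (fun i => (C n).height + 1 + a i - b i)
    (fun i => by have : b i < (C n).height := hb i; omega)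
  rw [← hp.listing] at hu
  obtain ⟨j, rfl⟩ := hu
  choose d hd using hud
  let f : ℕ → ℝ := fun l => 2 * (1 / (r l : ℝ)) ^ m
  have hf : Antitone f := fun l l' h => by
    have : (r l : ℝ) ≤ r l' := by exact_mod_cast hp.mono h
    have := hr0 l
    simp only [f]; gcongr
  have hfs : ¬ Summable f := by rwa [summable_mul_left_iff two_ne_zero]
  let x : ℕ → ℝ := {l | padicValNat 2 (l + 1) = j}.indicator f
  have hx : ∀ l, 0 ≤ x l := fun l => indicator_nonneg (fun l _ => by
    have := hr0 l; simp only [f]; positivity) l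
  refine ⟨fun l => ENNReal.ofReal (1 - x l), fun l _ => ?_,
    tendsto_prod_one_sub_zero hx (not_summable_indicator_padicValNat hf hfs j) n⟩
  by_cases hl : padicValNat 2 (l + 1) = j
  · right
    refine ⟨connects_stackSystem hC hL hp.lt (N := (C n).height + 1) (d := d)
      (fun i => Nat.lt_succ_of_lt (hb i)) hm fun i => by rw [hl]; exact hd i, ?_⟩
    have hxl : x l = 2 * (1 / (r l : ℝ)) ^ m := if_pos hl
    have hpow : 2 ≤ r l ^ m := (hr2 l).trans (Nat.le_self_pow (by omega) _)
    have hpow' : (2 : ℝ) ≤ (r l : ℝ) ^ m := by exact_mod_cast hpow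
    have h1 : (1 - x l) * ((r l ^ m : ℕ) : ℝ) + 2 = ((r l ^ m : ℕ) : ℝ) := by
      have := hr0 l
      rw [hxl]; push_cast; rw [one_div_pow]; field_simp; ring
    have h2 : 0 ≤ 1 - x l := by
      push_cast at h1
      by_contra hneg
      push Not at hneg
      nlinarith
    change ENNReal.ofReal (1 - x l) * ((r l ^ m : ℕ) : ℝ≥0∞) + 2 = ((r l ^ m : ℕ) : ℝ≥0∞)
    rw [← ENNReal.ofReal_natCast (r l ^ m), ← ENNReal.ofReal_mul h2,
      show (2 : ℝ≥0∞) = ENNReal.ofReal 2 by simp, ← ENNReal.ofReal_add (by positivity) two_pos.le,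
      h1]
  · left
    have hxl : x l = 0 := if_neg hl
    simp [hxl]

lemma tendsto_atTop_of_summable {k : ℕ} (hr : ∀ n, L < r n)
    (hs : Summable fun n => (1 / (r n : ℝ)) ^ (k + 1)) :
    Tendsto (fun n => (r n : ℝ)) atTop atTop := by
  refine tendsto_atTop.2 fun B => ?_
  have hB : (0 : ℝ) < 1 / (|B| + 1) := by positivity
  filter_upwards [hs.tendsto_atTop_zero.eventually_lt_const (pow_pos hB (k + 1))] with n hn
  have h0 : (0 : ℝ) < r n := by
    have : 0 < r n := by have := hr n; omega
    exact_mod_cast this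
  have h1 := (one_div_lt_one_div h0 (by positivity)).1 (lt_of_pow_lt_pow_left₀ _ hB.le hn)
  linarith [le_abs_self B]

lemma tendsto_ratio (hr : Tendsto (fun n => (r n : ℝ)) atTop atTop) (hL : ∀ n, L < r n) :
    Tendsto (fun n => ((r n - L - 1 : ℕ) / r n : ℝ≥0∞)) atTop (nhds 1) := by
  have h1 : Tendsto (fun n => 1 - (L + 1) / (r n : ℝ)) atTop (nhds (1 - 0)) :=
    tendsto_const_nhds.sub (hr.const_div_atTop _)
  have h2 := ENNReal.tendsto_ofReal h1
  rw [sub_zero, ENNReal.ofReal_one] at h2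
  refine h2.congr fun n => ?_
  have h3 := hL n
  have h4 : (0 : ℝ) < r n := by exact_mod_cast (by omega : 0 < r n)
  rw [← ENNReal.ofReal_natCast, ← ENNReal.ofReal_natCast (r n), ← ENNReal.ofReal_div_of_pos h4,
    Nat.sub_sub, Nat.cast_sub (by omega)]
  congr 1
  push_cast
  field_simp

lemma pos_add_one (hC : IsConstruction L r v C) (hL : 1 ≤ L) (hr : ∀ n, L < r n)
    (n c : ℕ) (hc : c < r n - L - 1) : c + 1 < r n ∧
    (stackSystem hC hL hr).pos n (c + 1) =
      (stackSystem hC hL hr).pos n c + copyGap L (C n).height (v (padicValNat 2 (n + 1))) :=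
  ⟨by omega, copyPos_succ_of_lt hc⟩

theorem partiallyRigid_stackMap (hC : IsConstruction L r v C) (hL : 1 ≤ L)
    (hr : ∀ n, L < r n) (hlim : Tendsto (fun n => (r n : ℝ)) atTop atTop) :
    PartiallyRigid (stackMap C) (stackMeasure C) :=
  StackSystem.partiallyRigid (S := stackSystem hC hL hr) (q := fun n => r n - L - 1)
    (fun _ => (Nat.sub_le _ _).trans (Nat.sub_le _ _)) (pos_add_one hC hL hr)
    (tendsto_ratio hlim hr) (strictMono_copyGap hC hL hr)

theorem hasInfiniteConservativeIndex_stackMap (hC : IsConstruction L r v C) (hL : 1 ≤ L)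
    (hr : ∀ n, L < r n) (hlim : Tendsto (fun n => (r n : ℝ)) atTop atTop) :
    HasInfiniteConservativeIndex (stackMap C) (stackMeasure C) :=
  StackSystem.hasInfiniteConservativeIndex (S := stackSystem hC hL hr) (q := fun n => r n - L - 1)
    (fun _ => (Nat.sub_le _ _).trans (Nat.sub_le _ _)) (pos_add_one hC hL hr)
    (tendsto_ratio hlim hr) (strictMono_copyGap hC hL hr)

/-- The tail consists of the last `L + 1` copies, so the series is that of `((L + 1) / r n) ^ m`.
Being convergent, it has remainders below `1`, and `n₀` is chosen accordingly. -/
theorem not_ergodic_stackMap (hC : IsConstruction L r v C) (hL : 1 ≤ L) (hr : ∀ n, L < r n)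
    {m : ℕ} (hm : 2 ≤ m)
    (hcons : Conservative (prodPow (stackMap C) m) (Measure.pi fun _ : Fin m => stackMeasure C))
    (hs : Summable fun n => (1 / (r n : ℝ)) ^ m) :
    ¬ Ergodic (prodPow (stackMap C) m) (Measure.pi fun _ : Fin m => stackMeasure C) := by
  let f : ℕ → ℝ≥0∞ := fun n => ((r n - (r n - L - 1) : ℕ) / r n : ℝ≥0∞) ^ m
  have hf : ∑' n, f n ≠ ⊤ := by
    have h1 : ∀ n, f n = ENNReal.ofReal (((L : ℝ) + 1) ^ m * (1 / (r n : ℝ)) ^ m) := by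
      intro n
      have h3 := hr n
      have h4 : (0 : ℝ) < r n := by exact_mod_cast (by omega : 0 < r n)
      have h5 : r n - (r n - L - 1) = L + 1 := by omega
      simp only [f, h5]
      rw [← mul_pow, ENNReal.ofReal_pow (by positivity), mul_one_div, ENNReal.ofReal_div_of_pos h4,
        ENNReal.ofReal_natCast, show (L : ℝ) + 1 = ((L + 1 : ℕ) : ℝ) by push_cast; rfl,
        ENNReal.ofReal_natCast]
    simp only [h1]
    exact (hs.mul_left _).tsum_ofReal_ne_top
  obtain ⟨n₀, hn₀, hn₁⟩ := ((((ENNReal.tendsto_sum_nat_add f hf).eventually_lt_const one_pos)).and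
    (eventually_ge_atTop 1)).exists
  refine StackSystem.not_ergodic_prodPow (S := stackSystem hC hL hr) (q := fun n => r n - L - 1)
    (fun n c c' e e' hcq _ hc' he he' hne => copyPos_separated (hr n) hcq hc' he he' hne) hm hcons
    hn₁ ?_
  change ∑' k, f (n₀ + k) < 1
  simpa only [add_comm] using hn₀

theorem hasErgodicIndex_stackMap {k : ℕ} (hk : 1 ≤ k) (hL : k < L) (hp : IsParameter L r v)
    (hC : IsConstruction L r v C) (hdiv : ¬ Summable fun n => (1 / (r n : ℝ)) ^ k)
    (hconv : Summable fun n => (1 / (r n : ℝ)) ^ (k + 1))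
    (hcons : HasInfiniteConservativeIndex (stackMap C) (stackMeasure C)) :
    HasErgodicIndex (stackMap C) (stackMeasure C) k := by
  have hr1 : ∀ n, (1 : ℝ) ≤ r n := fun n => by
    exact_mod_cast (by have := hp.lt n; omega : 1 ≤ r n)
  have hle : ∀ {m m' : ℕ}, m ≤ m' → Summable (fun n => (1 / (r n : ℝ)) ^ m) →
      Summable fun n => (1 / (r n : ℝ)) ^ m' := by
    intro m m' h hs
    refine hs.of_nonneg_of_le (fun n => by positivity) fun n => ?_
    exact pow_le_pow_of_le_one (by positivity)
      ((div_le_one (by linarith [hr1 n])).2 (hr1 n)) h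
  refine fun m hm => ⟨fun he => ?_, fun hmk => ?_⟩
  · by_contra hmk
    push Not at hmk
    exact not_ergodic_stackMap hC (by omega) hp.lt (by omega) (hcons m hm) (hle hmk hconv) he
  · exact ergodic_stackSystem hp hC (by omega) hm (by omega) fun hs => hdiv (hle hmk hs)

end Properties

end

/-! ### The main theorem -/

theorem mainTheorem4 (k : ℕ) (hk : 1 ≤ k) (L : ℕ) (hL : k < L) :
    (∃ (r : ℕ → ℕ) (v : ℕ → Fin L → ℕ), IsParameter L r v ∧
      ¬ Summable (fun n => (1 / (r n : ℝ)) ^ k) ∧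
      Summable (fun n => (1 / (r n : ℝ)) ^ (k + 1))) ∧
    ∀ (r : ℕ → ℕ) (v : ℕ → Fin L → ℕ), IsParameter L r v →
      ¬ Summable (fun n => (1 / (r n : ℝ)) ^ k) →
      Summable (fun n => (1 / (r n : ℝ)) ^ (k + 1)) →
      (∃ C : ℕ → IntervalColumn, IsConstruction L r v C) ∧
      ∀ C : ℕ → IntervalColumn, IsConstruction L r v C →
        MeasurePreserving (stackMap C) (stackMeasure C) (stackMeasure C) ∧
        InvertibleMod (stackMap C) (stackMeasure C) ∧
        stackMeasure C Set.univ = ⊤ ∧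
        RankOne (stackMap C) (stackMeasure C) ∧
        krengelEntropy (stackMap C) (stackMeasure C) = 0 ∧
        HasErgodicIndex (stackMap C) (stackMeasure C) k ∧
        PartiallyRigid (stackMap C) (stackMeasure C) ∧
        HasInfiniteConservativeIndex (stackMap C) (stackMeasure C) := by
  refine ⟨exists_parameter hk L, fun r v hp hdiv hconv =>
    ⟨exists_isConstruction hp.lt, fun C hC => ?_⟩⟩
  have hL1 : 1 ≤ L := by omega
  have hlim := tendsto_atTop_of_summable hp.lt hconv
  have hcons := hasInfiniteConservativeIndex_stackMap hC hL1 hp.lt hlim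
  let S := stackSystem hC hL1 hp.lt
  exact ⟨S.measurePreserving_T, S.invertibleMod,
    S.μ_univ fun n => le_trans (Nat.mul_le_mul_left _ (Nat.le_add_right _ _)) (height_growth hC hp.lt n),
    S.rankOne, S.krengelEntropy_eq_zero hcons,
    hasErgodicIndex_stackMap hk hL hp hC hdiv hconv hcons,
    partiallyRigid_stackMap hC hL1 hp.lt hlim, hcons⟩
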